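/- \textbf{Lemma (Poincaré inequality for $\underline{C}_h^k$ with averages of edge unknowns).} \emph{Setting.} Let $\Omega\subset\mathbb R^3$ be an open connected polyhedral domain and $k\ge 0$ an integer. A polyhedral mesh $\mathcal M_h$ of $\Omega$ consists of finitely many disjoint open polyhedral elements $T\in\mathcal T_h$ whose closures cover $\overline\Omega$, of finitely many disjoint relatively open planar polygonal faces $F\in\mathcal F_h$ (each one contained in the boundaries of two distinct elements, or in the boundary of an element and in $\partial\Omega$; the boundary of each $T$ is the union of the closures of the set $\mathcal F_T$ of faces it contains), and of the disjoint open edges $E\in\mathcal E_h$ of the faces (the relative boundary of each $F$ is the union of the closures of the set $\mathcal E_F$ of edges it contains; no edge end point lies in an open edge; $\mathcal E_T=\bigcup_{F\in\mathcal F_T}\mathcal E_F$). Elements and faces are simply connected, with connected Lipschitz boundaries. Each face has a unit normal $n_F$, each edge a unit tangent $t_E$; $\omega_{TF}=1$ if $n_F$ points out of $T$ and $-1$ otherwise; $n_{FE}=n_F\times t_E$, and $\omega_{FE}=1$ if $n_{FE}$ points out of $F$ and $-1$ otherwise. $h_X$ is the diameter of $X$, $|E|$ the length of $E$, and $\|\cdot\|_X$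 the $L^2(X)$-norm. The mesh is $\rho$-regular, $\rho\in(0,1)$, if it admits a matching simplicial submesh (its simplices cover $\overline\Omega$ and meet along common sub-simplices, each open simplex lies in an element, each open simplicial face lies in a given mesh face or does not meet it, and edge end points are vertices of simplices) whose simplices $\tau$ have inradius $\ge\rho h_\tau$ and satisfy $\rho h_T\le h_\tau$ if $\tau\subset T$. A permeability with values $\mu_T\in[\underline\mu,\overline\mu]$, $\underline\mu>0$, is given on the elements. \emph{Spaces.} $P^\ell(X)$ denotes the restrictions to $X$ of polynomials of total degree $\le\ell$ ($P^{-1}=\{0\}$), and $P^\ell(F)^2$ the tangential fields on $F$ with components in $P^\ell(F)$; $P^{0,\ell}(X)$ is the subspace of $P^\ell(X)$ of functions with zero mean; $\mathbf{rot}_F r=\nabla_F r\times n_F$ is the tangential gradient rotated by $-\pi/2$. Put $\mathcal G^\ell(T)=\nabla P^{\ell+1}(T)$, $\mathcal R^\ell(T)=\mathrm{curl}\,P^{\ell+1}(T)^3$, $\mathcal R^\ell(F)=\mathbf{rot}_F P^{\ell+1}(F)$; ${}^\perp$ is the $L^2$-orthogonal complement in $P^\ell(T)^3$, resp. $P^\ell(F)^2$,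 and $\pi_{\mathcal Y}$ the $L^2$-orthogonal projector on $\mathcal Y$. Elements of $\underline X_{\mathrm{curl},h}$ are the families $\underline\upsilon_h=((\upsilon_{\mathcal R,T},\upsilon_{\mathcal R,T}^\perp)_T,(\upsilon_{\mathcal R,F},\upsilon_{\mathcal R,F}^\perp)_F,(\upsilon_E)_E)$ in $\prod_T\mathcal R^{k-1}(T)\times\mathcal R^k(T)^\perp\times\prod_F\mathcal R^{k-1}(F)\times\mathcal R^k(F)^\perp\times\prod_E P^k(E)$; elements of $\underline X_{\mathrm{div},h}$ are the families $\underline w_h=((w_{\mathcal G,T},w_{\mathcal G,T}^\perp)_T,(w_F)_F)$ in $\prod_T\mathcal G^{k-1}(T)\times\mathcal G^k(T)^\perp\times\prod_F P^k(F)$. \emph{Operators.} $C_F^k\underline\upsilon_F\in P^k(F)$, $\gamma_{t,F}^k\underline\upsilon_F\in P^k(F)^2$, $C_T^k\underline\upsilon_T\in P^k(T)^3$ are defined by $$\int_F C_F^k\underline\upsilon_F\,q=\int_F\upsilon_{\mathcal R,F}\cdot\mathbf{rot}_Fq-\sum_{E\in\mathcal E_F}\omega_{FE}\int_E\upsilon_Eq\quad\forall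 q\in P^k(F),$$ $$\int_F\gamma_{t,F}^k\underline\upsilon_F\cdot(\mathbf{rot}_Fr+\tau)=\int_FC_F^k\underline\upsilon_F\,r+\sum_{E\in\mathcal E_F}\omega_{FE}\int_E\upsilon_Er+\int_F\upsilon_{\mathcal R,F}^\perp\cdot\tau\quad\forall (r,\tau)\in P^{0,k+1}(F)\times\mathcal R^k(F)^\perp,$$ $$\int_TC_T^k\underline\upsilon_T\cdot\tau=\int_T\upsilon_{\mathcal R,T}\cdot\mathrm{curl}\,\tau+\sum_{F\in\mathcal F_T}\omega_{TF}\int_F\gamma_{t,F}^k\underline\upsilon_F\cdot(\tau\times n_F)\quad\forall\tau\in P^k(T)^3,$$ and $\underline C_h^k\underline\upsilon_h=((\pi_{\mathcal G^{k-1}(T)}C_T^k\underline\upsilon_T,\pi_{\mathcal G^k(T)^\perp}C_T^k\underline\upsilon_T)_T,(C_F^k\underline\upsilon_F)_F)\in\underline X_{\mathrm{div},h}$. \emph{Norms.} Let $P_T\underline\upsilon_T=\hat P_T\underline\upsilon_T-\pi_{\mathcal R^{k-1}(T)}\hat P_T\underline\upsilon_T+\upsilon_{\mathcal R,T}$, where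 $\hat P_T\underline\upsilon_T\in P^k(T)^3$ satisfies, for all $v\in\mathcal G^{k+1}(T)^\perp$ and $\tau\in\mathcal R^k(T)^\perp$, $$\int_T\hat P_T\underline\upsilon_T\cdot(\mathrm{curl}\,v+\tau)=\int_TC_T^k\underline\upsilon_T\cdot v-\sum_{F\in\mathcal F_T}\omega_{TF}\int_F\gamma_{t,F}^k\underline\upsilon_F\cdot(v\times n_F)+\int_T\upsilon_{\mathcal R,T}^\perp\cdot\tau .$$ Then $$\|\underline\upsilon_h\|_{\mu,\mathrm{curl},h}^2=\sum_{T}\mu_T\Big(\|P_T\underline\upsilon_T\|_T^2+\sum_{F\in\mathcal F_T}h_F\|\pi_{\mathcal R^{k-1}(F)}P_T\underline\upsilon_T-\upsilon_{\mathcal R,F}\|_F^2+\sum_{F\in\mathcal F_T}h_F\|\pi_{\mathcal R^k(F)^\perp}P_T\underline\upsilon_T-\upsilon_{\mathcal R,F}^\perp\|_F^2+\sum_{E\in\mathcal E_T}h_E^2\|P_T\underline\upsilon_T\cdot t_E-\upsilon_E\|_E^2\Big),$$ $|||\underline w_T|||_{\mathrm{div},T}^2=\|w_{\mathcal G,T}+w_{\mathcal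 G,T}^\perp\|_T^2+\sum_{F\in\mathcal F_T}h_F\|w_F\|_F^2$ and $|||\underline w_h|||_{\mathrm{div},h}^2=\sum_T|||\underline w_T|||_{\mathrm{div},T}^2$. Finally $\overline\upsilon_E$ is the average of $\upsilon_E$ on $E$. \emph{Statement.} (i) There is $C>0$ depending only on $\Omega$, $k$, $\rho$, $\underline\mu$, $\overline\mu$ such that, for every $\rho$-regular mesh, every such $\mu$, and every $\underline\upsilon_h\in\underline X_{\mathrm{curl},h}$, there exists $\underline\zeta_h\in\underline X_{\mathrm{curl},h}$ with $\underline\upsilon_h+\underline\zeta_h\in\operatorname{Ker}\underline C_h^k$ and $$\|\underline\zeta_h\|_{\mu,\mathrm{curl},h}\le C\left[\Big(\sum_{T\in\mathcal T_h}h_T^2\,|||(\underline C_h^k\underline\upsilon_h)_T|||_{\mathrm{div},T}^2\Big)^{1/2}+\Big(\sum_{E\in\mathcal E_h}h_E^2|E|\,\overline\upsilon_E^{\,2}\Big)^{1/2}\right].$$ (ii) Let $c_1,c_2>0$. There is $C>0$ depending only on $\Omega$, $k$, $\rho$, $\underline\mu$, $\overline\mu$, $c_1$, $c_2$ such that, for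 every $\rho$-regular mesh, every such $\mu$, and every inner product on $\underline X_{\mathrm{curl},h}$ whose norm $N$ satisfies $c_1\|\cdot\|_{\mu,\mathrm{curl},h}\le N\le c_2\|\cdot\|_{\mu,\mathrm{curl},h}$, if $(\operatorname{Ker}\underline C_h^k)^\perp$ is the orthogonal complement for this inner product, then $$\|\underline\upsilon_h\|_{\mu,\mathrm{curl},h}\le C\left[|||\underline C_h^k\underline\upsilon_h|||_{\mathrm{div},h}+\Big(\sum_{E\in\mathcal E_h}h_E^2|E|\,\overline\upsilon_E^{\,2}\Big)^{1/2}\right]\qquad\forall\underline\upsilon_h\in(\operatorname{Ker}\underline C_h^k)^\perp.$$ -/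

import Mathlib

open MeasureTheory Set Filter Topology
open scoped Matrix NNReal

namespace DDR

/-! ## Polynomials and polynomial vector fields on `ℝ³` -/

/-- Euclidean three-dimensional space. -/
abbrev E3 := EuclideanSpace ℝ (Fin 3)

/-- Real polynomials in three variables. -/
abbrev Poly3 := MvPolynomial (Fin 3) ℝ

/-- Polynomial vector fields on `ℝ³`. -/
abbrev VPoly3 := Fin 3 → Poly3

/-- Value of a polynomial at a point. -/
noncomputable def evalAt (x : E3) (p : Poly3) : ℝ := MvPolynomial.eval x.ofLp p

/-- The constant vector field with value `n`. -/
noncomputable def cst (n : E3) : VPoly3 := fun i => MvPolynomial.C (n i)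

/-- Gradient. -/
noncomputable def gradL : Poly3 →ₗ[ℝ] VPoly3 :=
  LinearMap.pi fun i => (MvPolynomial.pderiv i).toLinearMap

/-- Curl. -/
noncomputable def curlL : VPoly3 →ₗ[ℝ] VPoly3 where
  toFun v :=
    ![MvPolynomial.pderiv 1 (v 2) - MvPolynomial.pderiv 2 (v 1),
      MvPolynomial.pderiv 2 (v 0) - MvPolynomial.pderiv 0 (v 2),
      MvPolynomial.pderiv 0 (v 1) - MvPolynomial.pderiv 1 (v 0)]
  map_add' v w := by
    ext i : 1
    fin_cases i <;> simp <;> ring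
  map_smul' c v := by
    ext i : 1
    fin_cases i <;> simp [smul_sub]

/-- Derivative in the direction of the constant vector `w`. -/
noncomputable def dirDeriv (w : E3) : Poly3 →ₗ[ℝ] Poly3 :=
  ∑ i, w i • (MvPolynomial.pderiv i).toLinearMap

/-- The vector curl on a plane with unit normal `n`: the tangential gradient rotated by the angle
`-π/2` in the plane oriented by `n`, that is `∇r × n` (only the tangential part of `∇r`
contributes). -/
noncomputable def vrotL (n : E3) : Poly3 →ₗ[ℝ] VPoly3 where
  toFun r := gradL r ⨯₃ cst n
  map_add' p q := by simp
  map_smul' c p := by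
    ext i : 1
    fin_cases i <;> simp [cross_apply, smul_sub]

/-- Polynomials of total degree at most `ℓ`; for `ℓ = -1` this is `{0}`. -/
noncomputable def P (ℓ : ℤ) : Submodule ℝ Poly3 :=
  MvPolynomial.restrictSupport ℝ {m : Fin 3 →₀ ℕ | (m.degree : ℤ) ≤ ℓ}

/-- Vector fields whose components are polynomials of total degree at most `ℓ`. The restriction to
a polyhedron `T` (a nonempty open set) being injective on polynomials, this is also the space
`P^ℓ(T)³`, and `P ℓ` is the space `P^ℓ(T)`. -/
noncomputable def VP (ℓ : ℤ) : Submodule ℝ VPoly3 := Submodule.pi univ fun _ => P ℓ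

/-- The space `P^ℓ(F)` for a polygon `F` with unit normal `n`. A function on `F` that is the
restriction of a polynomial of degree at most `ℓ` has exactly one polynomial extension which is
constant in the direction `n`, and that extension has degree at most `ℓ` too; functions in `P^ℓ(F)`
are represented by this extension. -/
noncomputable def PF (ℓ : ℤ) (n : E3) : Submodule ℝ Poly3 := P ℓ ⊓ LinearMap.ker (dirDeriv n)

/-- The space `P^ℓ(F)²` of tangential polynomial vector fields on a polygon `F` with unit normal
`n`, with the same convention as for `P^ℓ(F)`. -/
noncomputable def VPF (ℓ : ℤ) (n : E3) : Submodule ℝ VPoly3 :=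
  (Submodule.pi univ fun _ => PF ℓ n) ⊓
    LinearMap.ker (∑ i, n i • (LinearMap.proj i : VPoly3 →ₗ[ℝ] Poly3))

/-- The space `P^ℓ(E)` for a segment `E` with unit tangent `t`: functions on `E` are represented by
their unique polynomial extension which is constant in the directions orthogonal to `t`. -/
noncomputable def PE (ℓ : ℤ) (t : E3) : Submodule ℝ Poly3 :=
  P ℓ ⊓ ⨅ (w : E3) (_ : inner ℝ w t = 0), LinearMap.ker (dirDeriv w)

/-- `G^ℓ(T) = ∇ P^{ℓ+1}(T)`. -/
noncomputable def Goly (ℓ : ℤ) : Submodule ℝ VPoly3 := (P (ℓ + 1)).map gradL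

/-- `R^ℓ(T) = curl P^{ℓ+1}(T)³`. -/
noncomputable def Roly (ℓ : ℤ) : Submodule ℝ VPoly3 := (VP (ℓ + 1)).map curlL

/-- `R^ℓ(F) = rot_F P^{ℓ+1}(F)`. -/
noncomputable def RolyF (ℓ : ℤ) (n : E3) : Submodule ℝ VPoly3 := (PF (ℓ + 1) n).map (vrotL n)

/-! ## `L²` products on polynomials -/

/-- `L²` product of scalar polynomials for the measure `μ`. -/
noncomputable def ipS (μ : Measure E3) (p q : Poly3) : ℝ := ∫ x, evalAt x (p * q) ∂μ

/-- `L²` product of polynomial vector fields for the measure `μ`. -/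
noncomputable def ipV (μ : Measure E3) (v w : VPoly3) : ℝ := ∫ x, evalAt x (v ⬝ᵥ w) ∂μ

/-- `L²` norm of a scalar polynomial. -/
noncomputable def normS (μ : Measure E3) (p : Poly3) : ℝ := √(ipS μ p p)

/-- `L²` norm of a polynomial vector field. -/
noncomputable def normV (μ : Measure E3) (v : VPoly3) : ℝ := √(ipV μ v v)

/-- The `L²(μ)`-orthogonal complement of `W` in `V`. -/
noncomputable def perpIn (μ : Measure E3) (hμ : ∀ p : Poly3, Integrable (fun x => evalAt x p) μ)
    (W V : Submodule ℝ VPoly3) : Submodule ℝ VPoly3 where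
  carrier := {v | v ∈ V ∧ ∀ w ∈ W, ipV μ v w = 0}
  zero_mem' := ⟨V.zero_mem, fun w _ => by simp [ipV, evalAt]⟩
  add_mem' := by
    rintro a b ⟨ha, ha'⟩ ⟨hb, hb'⟩
    refine ⟨V.add_mem ha hb, fun w hw => ?_⟩
    have h : ipV μ (a + b) w = ipV μ a w + ipV μ b w := by
      unfold ipV
      rw [← integral_add (hμ _) (hμ _)]
      simp [evalAt, add_dotProduct]
    rw [h, ha' w hw, hb' w hw, add_zero]
  smul_mem' := by
    rintro c a ⟨ha, ha'⟩
    refine ⟨V.smul_mem c ha, fun w hw => ?_⟩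
    have h : ipV μ (c • a) w = c * ipV μ a w := by
      unfold ipV
      rw [← integral_const_mul]
      simp [evalAt, smul_dotProduct]
    rw [h, ha' w hw, mul_zero]

/-- The `L²(μ)`-orthogonal projection of the field `f` on `W`: the element of `W` with the same
products as `f` against `W`. -/
noncomputable def projOn (μ : Measure E3) (W : Submodule ℝ VPoly3) (f : VPoly3) : W :=
  Classical.epsilon fun g : W => ∀ w ∈ W, ipV μ g w = ipV μ f w

/-! ## Polytopes and meshes -/

/-- A finite union of closed `d`-simplices. -/
def IsSimplexUnion (d : ℕ) (X : Set E3) : Prop :=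
  ∃ (m : ℕ) (s : Fin m → Fin (d + 1) → E3),
    (∀ i, AffineIndependent ℝ (s i)) ∧ X = ⋃ i, convexHull ℝ (range (s i))

/-- The relatively open subset `X` of the affine space `A` has a Lipschitz-continuous boundary in
`A`: near each of its boundary points it is the epigraph, in some orthonormal frame of `A`, of a
Lipschitz function. -/
def HasLipschitzBoundary (A : AffineSubspace ℝ E3) (X : Set E3) : Prop :=
  ∀ x ∈ closure X \ X, ∃ e ∈ A.direction, ‖e‖ = 1 ∧
    ∃ (φ : E3 → ℝ) (K : ℝ≥0), LipschitzWith K φ ∧ ∃ r > 0, ∀ y ∈ A, dist y x < r →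
      (y ∈ X ↔ φ (y - (inner ℝ e y : ℝ) • e) < (inner ℝ e y : ℝ))

/-- `X` is a `d`-dimensional polytope of the `d`-dimensional affine space `A`: a relatively open
subset of `A` whose closure is a finite union of `d`-simplices, simply connected, and with
connected Lipschitz-continuous boundary. -/
structure IsPolytope (d : ℕ) (A : AffineSubspace ℝ E3) (X : Set E3) : Prop where
  finrank_eq : Module.finrank ℝ A.direction = d
  relOpen : ∃ U : Set E3, IsOpen U ∧ X = U ∩ A
  simplices : IsSimplexUnion d (closure X)
  simplyConnected : IsSimplyConnected X
  boundary_connected : IsConnected (closure X \ X)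
  boundary_lipschitz : HasLipschitzBoundary A X

/-- Open connected polyhedral domain of `ℝ³`. -/
structure IsPolyhedralDomain (Ω : Set E3) : Prop where
  isOpen : IsOpen Ω
  isConnected : IsConnected Ω
  simplices : IsSimplexUnion 3 (closure Ω)

/-- A polyhedral mesh of `Ω`. Elements are open polyhedra, faces are relatively open polygons
endowed with a unit normal, and edges are open segments given by two distinct end points; the edge
is oriented from `src` to `tgt`. -/
structure PolyMesh (Ω : Set E3) where
  nT : ℕ
  nF : ℕ
  nE : ℕ
  elem : Fin nT → Set E3
  face : Fin nF → Set E3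
  normal : Fin nF → E3
  src : Fin nE → E3
  tgt : Fin nE → E3
  elem_polytope : ∀ T, IsPolytope 3 ⊤ (elem T)
  elem_subset : ∀ T, elem T ⊆ Ω
  elem_disjoint : ∀ T T', T ≠ T' → Disjoint (elem T) (elem T')
  elem_cover : closure Ω = ⋃ T, closure (elem T)
  normal_unit : ∀ F, ‖normal F‖ = 1
  face_polytope : ∀ F, ∃ A : AffineSubspace ℝ E3,
    A.direction = (ℝ ∙ normal F)ᗮ ∧ IsPolytope 2 A (face F)
  face_disjoint : ∀ F F', F ≠ F' → Disjoint (face F) (face F')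
  /-- each face is an interface between two elements or lies on the boundary of the domain -/
  face_adj : ∀ F,
    (∃ T T', T ≠ T' ∧ face F ⊆ frontier (elem T) ∩ frontier (elem T')) ∨
      ∃ T, face F ⊆ frontier (elem T) ∩ frontier Ω
  /-- the boundary of an element is made of the faces that it contains -/
  elem_boundary : ∀ T,
    frontier (elem T) = ⋃ F ∈ {F | face F ⊆ frontier (elem T)}, closure (face F)
  src_ne_tgt : ∀ E, src E ≠ tgt E
  edge_disjoint : ∀ E E', E ≠ E' →
    Disjoint (openSegment ℝ (src E) (tgt E)) (openSegment ℝ (src E') (tgt E'))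
  vertex_notMem_edge : ∀ E E',
    src E ∉ openSegment ℝ (src E') (tgt E') ∧ tgt E ∉ openSegment ℝ (src E') (tgt E')
  /-- edges are edges of faces -/
  edge_face : ∀ E, ∃ F, openSegment ℝ (src E) (tgt E) ⊆ closure (face F) \ face F
  /-- the boundary of a face is made of the edges that it contains -/
  face_boundary : ∀ F, closure (face F) \ face F =
    ⋃ E ∈ {E | openSegment ℝ (src E) (tgt E) ⊆ closure (face F) \ face F},
      segment ℝ (src E) (tgt E)

theorem IsPolytope.isBounded {d : ℕ} {A : AffineSubspace ℝ E3} {X : Set E3}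
    (h : IsPolytope d A X) : Bornology.IsBounded X := by
  obtain ⟨m, s, -, hs⟩ := h.simplices
  refine Bornology.IsBounded.subset ?_ subset_closure
  rw [hs]
  refine Bornology.isBounded_iUnion.2 fun i => ?_
  exact (isBounded_convexHull).2 (finite_range _).isBounded

theorem continuous_evalAt (p : Poly3) : Continuous fun x : E3 => evalAt x p :=
  (MvPolynomial.continuous_eval p).comp (PiLp.continuous_ofLp 2 _)

theorem integrable_of_bounded {μ : Measure E3} {X : Set E3} (hX : Bornology.IsBounded X)
    (hμ : μ X < ⊤) (p : Poly3) : Integrable (fun x => evalAt x p) (μ.restrict X) := by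
  have hc : IsCompact (closure X) := hX.isCompact_closure
  obtain ⟨C, hC⟩ := hc.exists_bound_of_continuousOn (continuous_evalAt p).continuousOn
  refine IntegrableOn.of_bound (C := C) hμ (continuous_evalAt p).aestronglyMeasurable ?_
  have : ∀ᵐ x ∂(μ.restrict X), x ∈ closure X :=
    ae_restrict_of_ae_restrict_of_subset subset_closure
      (ae_restrict_mem isClosed_closure.measurableSet)
  filter_upwards [this] with x hx using hC x hx

theorem IsPolytope.measure_lt_top {d : ℕ} {A : AffineSubspace ℝ E3} {X : Set E3}
    (h : IsPolytope d A X) : μHE[d] X < ⊤ := by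
  obtain ⟨x₀, hx₀⟩ := h.simplyConnected.nonempty
  obtain ⟨U, -, hU⟩ := h.relOpen
  have hA : X ⊆ A := by rw [hU]; exact inter_subset_right
  let f : A.direction → E3 := fun v => (v : E3) + x₀
  have hf : Isometry f := (isometry_add_right x₀).comp isometry_subtype_coe
  have hr : X ⊆ range f := fun y hy =>
    ⟨⟨y - x₀, A.vsub_mem_direction (hA hy) (hA hx₀)⟩, by simp [f]⟩
  have h1 := hf.euclideanHausdorffMeasure_preimage (d := d) X
  rw [inter_eq_left.2 hr] at h1
  rw [← h1, ← h.finrank_eq, InnerProductSpace.euclideanHausdorffMeasure_eq_volume]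
  exact (hf.antilipschitz.isBounded_preimage h.isBounded).measure_lt_top

namespace PolyMesh

variable {Ω : Set E3} (M : PolyMesh Ω)

/-- The open segment underlying an edge. -/
def edge (E : Fin M.nE) : Set E3 := openSegment ℝ (M.src E) (M.tgt E)

/-- The unit tangent vector of an edge. -/
noncomputable def tangent (E : Fin M.nE) : E3 :=
  (dist (M.src E) (M.tgt E))⁻¹ • (M.tgt E - M.src E)

/-- Diameters and lengths. -/
noncomputable def hT (T : Fin M.nT) : ℝ := Metric.diam (M.elem T)

noncomputable def hF (F : Fin M.nF) : ℝ := Metric.diam (M.face F)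

noncomputable def hE (E : Fin M.nE) : ℝ := Metric.diam (M.edge E)

noncomputable def len (E : Fin M.nE) : ℝ := dist (M.src E) (M.tgt E)

/-- Lebesgue measure on an element, area measure on a face, length measure on an edge. -/
noncomputable def mT (T : Fin M.nT) : Measure E3 := volume.restrict (M.elem T)

noncomputable def mF (F : Fin M.nF) : Measure E3 := (μHE[2]).restrict (M.face F)

noncomputable def mE (E : Fin M.nE) : Measure E3 := (μHE[1]).restrict (M.edge E)

theorem integrable_mT (T : Fin M.nT) (p : Poly3) : Integrable (fun x => evalAt x p) (M.mT T) :=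
  integrable_of_bounded (M.elem_polytope T).isBounded
    (M.elem_polytope T).isBounded.measure_lt_top p

theorem integrable_mF (F : Fin M.nF) (p : Poly3) : Integrable (fun x => evalAt x p) (M.mF F) := by
  obtain ⟨A, -, hA⟩ := M.face_polytope F
  exact integrable_of_bounded hA.isBounded hA.measure_lt_top p

open Classical in
/-- The faces of an element. -/
noncomputable def facesOf (T : Fin M.nT) : Finset (Fin M.nF) :=
  Finset.univ.filter fun F => M.face F ⊆ frontier (M.elem T)

open Classical in
/-- The edges of a face. -/
noncomputable def edgesOf (F : Fin M.nF) : Finset (Fin M.nE) :=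
  Finset.univ.filter fun E => M.edge E ⊆ closure (M.face F) \ M.face F

open Classical in
/-- The edges of an element: the edges of its faces. -/
noncomputable def elemEdges (T : Fin M.nT) : Finset (Fin M.nE) :=
  (M.facesOf T).biUnion M.edgesOf

open Classical in
/-- Orientation of a face relative to an element: `1` if the normal points out of the element,
`-1` otherwise. -/
noncomputable def omegaTF (T : Fin M.nT) (F : Fin M.nF) : ℝ :=
  if ∃ x ∈ M.face F, ∀ᶠ s : ℝ in 𝓝[>] 0, x - s • M.normal F ∈ M.elem T then 1 else -1

/-- The unit vector `n_FE`, normal to the edge in the plane of the face, for which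
`(t_E, n_FE, n_F)` is a right-handed system. -/
noncomputable def normalFE (F : Fin M.nF) (E : Fin M.nE) : E3 :=
  WithLp.toLp 2 ((M.normal F).ofLp ⨯₃ (M.tangent E).ofLp)

open Classical in
/-- Orientation of an edge relative to a face: `1` if `n_FE` points out of the face (that is, if
`t_E` is opposite to the counter-clockwise orientation of the boundary of the face with respect to
`n_F`), `-1` otherwise. -/
noncomputable def omegaFE (F : Fin M.nF) (E : Fin M.nE) : ℝ :=
  if ∃ x ∈ M.edge E, ∀ᶠ s : ℝ in 𝓝[>] 0, x - s • M.normalFE F E ∈ M.face F then 1 else -1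

/-! ### Regularity -/

/-- `s` is a matching simplicial submesh of `M`. -/
structure IsMatchingSubmesh {m : ℕ} (s : Fin m → Fin 4 → E3) : Prop where
  indep : ∀ i, AffineIndependent ℝ (s i)
  cover : closure Ω = ⋃ i, convexHull ℝ (range (s i))
  distinct : ∀ i j, i ≠ j → range (s i) ≠ range (s j)
  /-- two simplices meet along the convex hull of their common vertices -/
  matching : ∀ i j, convexHull ℝ (range (s i)) ∩ convexHull ℝ (range (s j)) =
    convexHull ℝ (range (s i) ∩ range (s j))
  /-- each open simplex is contained in an element -/
  elem : ∀ i, ∃ T, interior (convexHull ℝ (range (s i))) ⊆ M.elem T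
  /-- each open simplicial face is contained in a given face of the mesh or does not meet it -/
  face : ∀ i j F,
    Disjoint (intrinsicInterior ℝ (convexHull ℝ (s i '' {j}ᶜ))) (M.face F) ∨
      intrinsicInterior ℝ (convexHull ℝ (s i '' {j}ᶜ)) ⊆ M.face F
  /-- the vertices of the mesh are vertices of simplices -/
  vertex : ∀ E, (∃ i, M.src E ∈ range (s i)) ∧ ∃ i, M.tgt E ∈ range (s i)

/-- The mesh has regularity parameter `ρ`: it admits a matching simplicial submesh whose simplices
have inradius at least `ρ` times their diameter, and diameter at least `ρ` times that of the
element that contains them. -/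
def IsRegular (ρ : ℝ) : Prop :=
  ∃ (m : ℕ) (s : Fin m → Fin 4 → E3), M.IsMatchingSubmesh s ∧
    (∀ i, ∃ x, Metric.ball x (ρ * Metric.diam (convexHull ℝ (range (s i)))) ⊆
      convexHull ℝ (range (s i))) ∧
    ∀ i T, interior (convexHull ℝ (range (s i))) ⊆ M.elem T →
      ρ * M.hT T ≤ Metric.diam (convexHull ℝ (range (s i)))

/-! ### Discrete spaces -/

/-- `G^ℓ(T)^⊥`. -/
noncomputable def GolyPerp (ℓ : ℤ) (T : Fin M.nT) : Submodule ℝ VPoly3 :=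
  perpIn (M.mT T) (M.integrable_mT T) (Goly ℓ) (VP ℓ)

/-- `R^ℓ(T)^⊥`. -/
noncomputable def RolyPerp (ℓ : ℤ) (T : Fin M.nT) : Submodule ℝ VPoly3 :=
  perpIn (M.mT T) (M.integrable_mT T) (Roly ℓ) (VP ℓ)

/-- `R^ℓ(F)^⊥`. -/
noncomputable def RolyFPerp (ℓ : ℤ) (F : Fin M.nF) : Submodule ℝ VPoly3 :=
  perpIn (M.mF F) (M.integrable_mF F) (RolyF ℓ (M.normal F)) (VPF ℓ (M.normal F))

/-- The discrete `H(curl)` space: components in `R^{k-1}(T) × R^k(T)^⊥`, in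
`R^{k-1}(F) × R^k(F)^⊥`, and in `P^k(E)`. -/
abbrev Xcurl (k : ℕ) : Type :=
  (∀ T : Fin M.nT, Roly ((k : ℤ) - 1) × M.RolyPerp k T) ×
  (∀ F : Fin M.nF, RolyF ((k : ℤ) - 1) (M.normal F) × M.RolyFPerp k F) ×
  (∀ E : Fin M.nE, PE k (M.tangent E))

/-- The discrete `H(div)` space: components in `G^{k-1}(T) × G^k(T)^⊥` and in `P^k(F)`. -/
abbrev Xdiv (k : ℕ) : Type :=
  (∀ T : Fin M.nT, Goly ((k : ℤ) - 1) × M.GolyPerp k T) ×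
  (∀ F : Fin M.nF, PF k (M.normal F))

variable {k : ℕ}

/-- The components of an element of the discrete `H(curl)` space. -/
def compRT (υ : M.Xcurl k) (T : Fin M.nT) : VPoly3 := (υ.1 T).1

def compRTperp (υ : M.Xcurl k) (T : Fin M.nT) : VPoly3 := (υ.1 T).2

def compRF (υ : M.Xcurl k) (F : Fin M.nF) : VPoly3 := (υ.2.1 F).1

def compRFperp (υ : M.Xcurl k) (F : Fin M.nF) : VPoly3 := (υ.2.1 F).2

def compE (υ : M.Xcurl k) (E : Fin M.nE) : Poly3 := υ.2.2 E

/-! ### Reconstructions and discrete curl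

Each reconstruction is the unique element of a finite-dimensional polynomial space that satisfies
the displayed variational equation. -/

/-- The face curl `C_F^k`. -/
noncomputable def faceCurl (υ : M.Xcurl k) (F : Fin M.nF) : PF k (M.normal F) :=
  Classical.epsilon fun c : PF k (M.normal F) => ∀ q ∈ PF k (M.normal F),
    ipS (M.mF F) c q = ipV (M.mF F) (M.compRF υ F) (vrotL (M.normal F) q)
      - ∑ E ∈ M.edgesOf F, M.omegaFE F E * ipS (M.mE E) (M.compE υ E) q

/-- The tangential face potential `γ_{t,F}^k`. -/
noncomputable def gammaT (υ : M.Xcurl k) (F : Fin M.nF) : VPF k (M.normal F) :=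
  Classical.epsilon fun g : VPF k (M.normal F) =>
    ∀ r ∈ PF ((k : ℤ) + 1) (M.normal F), ∫ x, evalAt x r ∂(M.mF F) = 0 →
    ∀ τ ∈ M.RolyFPerp k F,
      ipV (M.mF F) g (vrotL (M.normal F) r + τ) =
        ipS (M.mF F) (M.faceCurl υ F) r
          + ∑ E ∈ M.edgesOf F, M.omegaFE F E * ipS (M.mE E) (M.compE υ E) r
          + ipV (M.mF F) (M.compRFperp υ F) τ

/-- The full element curl `C_T^k`. -/
noncomputable def elemCurl (υ : M.Xcurl k) (T : Fin M.nT) : VP k :=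
  Classical.epsilon fun c : VP k => ∀ τ ∈ VP k,
    ipV (M.mT T) c τ = ipV (M.mT T) (M.compRT υ T) (curlL τ)
      + ∑ F ∈ M.facesOf T, M.omegaTF T F *
          ipV (M.mF F) (M.gammaT υ F) (τ ⨯₃ cst (M.normal F))

/-- The global discrete curl `C_h^k`. -/
noncomputable def discCurl (υ : M.Xcurl k) : M.Xdiv k :=
  (fun T => (projOn (M.mT T) (Goly ((k : ℤ) - 1)) (M.elemCurl υ T),
      projOn (M.mT T) (M.GolyPerp k T) (M.elemCurl υ T)),
    fun F => M.faceCurl υ F)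

/-- The unprojected vector potential on an element. -/
noncomputable def potHat (υ : M.Xcurl k) (T : Fin M.nT) : VP k :=
  Classical.epsilon fun p : VP k =>
    ∀ v ∈ M.GolyPerp ((k : ℤ) + 1) T, ∀ τ ∈ M.RolyPerp k T,
      ipV (M.mT T) p (curlL v + τ) =
        ipV (M.mT T) (M.elemCurl υ T) v
          - ∑ F ∈ M.facesOf T, M.omegaTF T F *
              ipV (M.mF F) (M.gammaT υ F) (v ⨯₃ cst (M.normal F))
          + ipV (M.mT T) (M.compRTperp υ T) τ

/-- The vector potential `P_{curl,T}^k`. -/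
noncomputable def pot (υ : M.Xcurl k) (T : Fin M.nT) : VPoly3 :=
  (M.potHat υ T : VPoly3) - (projOn (M.mT T) (Roly ((k : ℤ) - 1)) (M.potHat υ T) : VPoly3)
    + M.compRT υ T

/-! ### Products and norms -/

/-- Differences between the potential on `T` and the face and edge unknowns. -/
noncomputable def diffRF (υ : M.Xcurl k) (T : Fin M.nT) (F : Fin M.nF) : VPoly3 :=
  (projOn (M.mF F) (RolyF ((k : ℤ) - 1) (M.normal F)) (M.pot υ T) : VPoly3) - M.compRF υ F

noncomputable def diffRFperp (υ : M.Xcurl k) (T : Fin M.nT) (F : Fin M.nF) : VPoly3 :=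
  (projOn (M.mF F) (M.RolyFPerp k F) (M.pot υ T) : VPoly3) - M.compRFperp υ F

noncomputable def diffE (υ : M.Xcurl k) (T : Fin M.nT) (E : Fin M.nE) : Poly3 :=
  M.pot υ T ⬝ᵥ cst (M.tangent E) - M.compE υ E

/-- The stabilisation bilinear form `s_{curl,T}`. -/
noncomputable def stab (υ ζ : M.Xcurl k) (T : Fin M.nT) : ℝ :=
  ∑ F ∈ M.facesOf T, M.hF F * ipV (M.mF F) (M.diffRF υ T F) (M.diffRF ζ T F)
  + ∑ F ∈ M.facesOf T, M.hF F * ipV (M.mF F) (M.diffRFperp υ T F) (M.diffRFperp ζ T F)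
  + ∑ E ∈ M.elemEdges T, M.hE E ^ 2 * ipS (M.mE E) (M.diffE υ T E) (M.diffE ζ T E)

/-- The discrete `L²` product `(υ, ζ)_{μ,curl,h}` for the piecewise constant permeability `μ`. -/
noncomputable def prodCurl (μ : Fin M.nT → ℝ) (υ ζ : M.Xcurl k) : ℝ :=
  ∑ T, (μ T * ipV (M.mT T) (M.pot υ T) (M.pot ζ T) + μ T * M.stab υ ζ T)

/-- The norm `‖υ‖_{μ,curl,h}`. -/
noncomputable def normCurl (μ : Fin M.nT → ℝ) (υ : M.Xcurl k) : ℝ := √(M.prodCurl μ υ υ)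

/-- The element norm `|||w|||_{div,T}`. -/
noncomputable def tnormDivT (w : M.Xdiv k) (T : Fin M.nT) : ℝ :=
  √(normV (M.mT T) ((w.1 T).1 + (w.1 T).2) ^ 2
    + ∑ F ∈ M.facesOf T, M.hF F * normS (M.mF F) (w.2 F) ^ 2)

/-- The norm `|||w|||_{div,h}`. -/
noncomputable def tnormDiv (w : M.Xdiv k) : ℝ := √(∑ T, M.tnormDivT w T ^ 2)

/-- The average of an edge unknown over the edge. -/
noncomputable def edgeAvg (υ : M.Xcurl k) (E : Fin M.nE) : ℝ :=
  ⨍ x, evalAt x (M.compE υ E) ∂(M.mE E)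

/-- The weighted norm `(∑_E h_E² |E| (average of υ_E)²)^{1/2}` of the edge averages. -/
noncomputable def avgNorm (υ : M.Xcurl k) : ℝ :=
  √(∑ E, M.hE E ^ 2 * M.len E * M.edgeAvg υ E ^ 2)

end PolyMesh

end DDR

/-! The correction `ζ` is built from the edges inwards. On an edge it is minus the average of the
edge unknown of `υ`. On a face it is a rotated gradient `rot q`, where `q ∈ P^k(F)` has zero mean
and solves a discrete Neumann problem that forces the face curl of `ζ` to be opposite to that of
`υ`. Testing the face curl of `υ` with constants shows that opposite edge averages are exactly the
compatibility condition of this problem. On an element it is `curl w`, with `w` orthogonal to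
`G^k(T)`, chosen so that the element curl of `υ + ζ` is orthogonal to `G^k(T)^⊥`. All other
components are zero (`MeshBound.exists_correction`).

What remains is the projection of the element curl of `υ + ζ` on `G^{k-1}(T)`. Tested with `∇q`, `q
∈ P^k(T)`, the volume term drops because `curl ∇ = 0`; the face curls being zero, the tangential
potentials turn the face terms into edge integrals against `q`. The two faces of `T` that share an
edge induce opposite orientations on it (`PolyMesh.sum_orientation`), so these integrals cancel
(`MeshBound.faceL_gradL_eq_zero`).

The cancellation rests on the local geometry of a Lipschitz polyhedron. Near an interior point of an
edge, `T` is an epigraph in some direction `e`, and each face through the edge is a half disc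
(`exists_halfDisc`) which, seen along `e`, lies on one of the two sides of the edge. Each side
carries at least one face, because the boundary is a graph and is covered by faces, and at most one,
because distinct faces are disjoint.

The estimates are made in sup norm on the convex hull of `T`. Regularity gives a ball in `T` and a
disc in each of its faces, of radius `ρ² h_T`, together with a lower bound on edge lengths and
bounds on the numbers of neighbours (`IsRegular.exists_shapeBound`). Norms are equivalent on
polynomials of bounded degree over a fixed ball, so translations and dilations give uniform
inequalities with no reference element (`exists_sup_bound`, `exists_potential_bound`). Every
component of `ζ` and every reconstruction solves a variational problem: tested with itself, it has
an energy linear in its sup norm, while the square of the sup norm is controlled by the energy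
(`le_of_sq_le_of_le`). This bounds in turn the face components, tangential potentials, element
components, element curl and vector potential of `ζ` (`exists_local_bound`); summation over the
elements gives (i).

For (ii), `υ` is orthogonal to `υ + ζ`, hence not longer than `ζ` in the given inner product. The
equivalence of norms and `h_T ≤ diam Ω` then reduce (ii) to (i). -/

namespace DDR
open MvPolynomial

/-! ### Values and degrees of polynomials -/

@[simp] theorem evalAt_add (x : E3) (p q : Poly3) : evalAt x (p + q) = evalAt x p + evalAt x q :=
  map_add _ _ _
@[simp] theorem evalAt_sub (x : E3) (p q : Poly3) : evalAt x (p - q) = evalAt x p - evalAt x q :=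
  map_sub _ _ _
@[simp] theorem evalAt_neg (x : E3) (p : Poly3) : evalAt x (-p) = -evalAt x p := map_neg _ _
@[simp] theorem evalAt_mul (x : E3) (p q : Poly3) : evalAt x (p * q) = evalAt x p * evalAt x q :=
  map_mul _ _ _
@[simp] theorem evalAt_zero (x : E3) : evalAt x 0 = 0 := map_zero _
@[simp] theorem evalAt_one (x : E3) : evalAt x 1 = 1 := map_one _
@[simp] theorem evalAt_C (x : E3) (c : ℝ) : evalAt x (C c) = c := eval_C _
@[simp] theorem evalAt_X (x : E3) (i : Fin 3) : evalAt x (X i) = x i := eval_X _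
@[simp] theorem evalAt_smul (x : E3) (c : ℝ) (p : Poly3) : evalAt x (c • p) = c * evalAt x p := by
  simp [evalAt]
theorem evalAt_sum {ι : Type*} (s : Finset ι) (x : E3) (p : ι → Poly3) :
    evalAt x (∑ i ∈ s, p i) = ∑ i ∈ s, evalAt x (p i) := map_sum _ _ _
theorem evalAt_dotProduct (x : E3) (v w : VPoly3) :
    evalAt x (v ⬝ᵥ w) = ∑ i, evalAt x (v i) * evalAt x (w i) := by
  simp [dotProduct, evalAt_sum]

theorem monomial_mem_P {ℓ : ℤ} {m : Fin 3 →₀ ℕ} (h : (m.degree : ℤ) ≤ ℓ) (c : ℝ) :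
    monomial m c ∈ P ℓ := by
  rw [P, monomial_mem_restrictSupport]; exact Or.inl h

theorem C_mem_P {ℓ : ℤ} (h : 0 ≤ ℓ) (c : ℝ) : (C c : Poly3) ∈ P ℓ :=
  monomial_mem_P (by simpa using h) c

theorem X_mem_P {ℓ : ℤ} (h : 1 ≤ ℓ) (i : Fin 3) : (X i : Poly3) ∈ P ℓ :=
  monomial_mem_P (by simpa using h) 1

theorem P_mono {a b : ℤ} (h : a ≤ b) : P a ≤ P b :=
  restrictSupport_mono ℝ fun _ hm => le_trans (by exact hm) h

/-- A linear map is bounded on `P ℓ` as soon as it is on monomials. -/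
theorem map_P_le {V : Type*} [AddCommGroup V] [Module ℝ V] {ℓ : ℤ} (L : Poly3 →ₗ[ℝ] V)
    (W : Submodule ℝ V)
    (h : ∀ m : Fin 3 →₀ ℕ, (m.degree : ℤ) ≤ ℓ → L (monomial m 1) ∈ W) {p : Poly3} (hp : p ∈ P ℓ) :
    L p ∈ W := by
  rw [P, restrictSupport_eq_span] at hp
  have : Submodule.span ℝ ((fun m => monomial m (1 : ℝ)) '' {m : Fin 3 →₀ ℕ | (m.degree : ℤ) ≤ ℓ})
      ≤ W.comap L := by
    rw [Submodule.span_le]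
    rintro _ ⟨m, hm, rfl⟩
    exact h m hm
  exact this hp

theorem mul_mem_P {a b : ℤ} {p q : Poly3} (hp : p ∈ P a) (hq : q ∈ P b) : p * q ∈ P (a + b) := by
  refine map_P_le (LinearMap.mulRight ℝ q) (P (a + b)) (fun m hm => ?_) hp
  change (monomial m (1 : ℝ)) * q ∈ P (a + b)
  refine map_P_le (LinearMap.mulLeft ℝ (monomial m (1 : ℝ))) (P (a + b)) (fun m' hm' => ?_) hq
  change monomial m (1 : ℝ) * monomial m' 1 ∈ P (a + b)
  rw [monomial_mul]
  refine monomial_mem_P ?_ _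
  rw [map_add]; push_cast; exact add_le_add hm hm'

theorem pderiv_mem_P {ℓ : ℤ} {p : Poly3} (hp : p ∈ P (ℓ + 1)) (i : Fin 3) : pderiv i p ∈ P ℓ := by
  refine map_P_le (pderiv (R := ℝ) i).toLinearMap (P ℓ) (fun m hm => ?_) hp
  change pderiv i (monomial m 1) ∈ _
  rw [pderiv_monomial]
  rcases Nat.eq_zero_or_pos (m i) with h | h
  · simp [h]
  · refine monomial_mem_P ?_ _
    have h1 : m - Finsupp.single i 1 + Finsupp.single i 1 = m :=
      tsub_add_cancel_of_le (by rw [Finsupp.single_le_iff]; exact h)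
    have h2 : (m - Finsupp.single i 1).degree + 1 = m.degree := by
      conv_rhs => rw [← h1]
      simp
    have h3 : (((m - Finsupp.single i 1).degree : ℕ) : ℤ) + 1 = (m.degree : ℤ) := by exact_mod_cast h2
    linarith

instance finite_P (ℓ : ℤ) : FiniteDimensional ℝ (P ℓ) := by
  have hf : {m : Fin 3 →₀ ℕ | (m.degree : ℤ) ≤ ℓ}.Finite := by
    refine (Set.Finite.preimage (f := fun m : Fin 3 →₀ ℕ => (m : Fin 3 → ℕ))
      (DFunLike.coe_injective.injOn) (Set.finite_Iic (fun _ => ℓ.toNat))).subset ?_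
    intro m hm i
    have : m i ≤ m.degree := Finsupp.le_degree i m
    have h2 : (m.degree : ℤ) ≤ ℓ := hm
    change m i ≤ ℓ.toNat
    omega
  have := hf.to_subtype
  exact Module.Finite.of_basis (basisRestrictSupport ℝ {m : Fin 3 →₀ ℕ | (m.degree : ℤ) ≤ ℓ})

theorem mem_VP {ℓ : ℤ} {v : VPoly3} : v ∈ VP ℓ ↔ ∀ i, v i ∈ P ℓ := by
  simp [VP, Submodule.mem_pi]

theorem VP_mono {a b : ℤ} (h : a ≤ b) : VP a ≤ VP b := fun _ hv =>
  mem_VP.2 fun i => P_mono h (mem_VP.1 hv i)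

instance finite_VP (ℓ : ℤ) : FiniteDimensional ℝ (VP ℓ) := by
  let f : VP ℓ →ₗ[ℝ] (Fin 3 → P ℓ) :=
    { toFun := fun v i => ⟨v.1 i, mem_VP.1 v.2 i⟩
      map_add' := fun _ _ => rfl
      map_smul' := fun _ _ => rfl }
  refine FiniteDimensional.of_injective f fun _ _ h => ?_
  ext1; funext i
  exact congrArg Subtype.val (congrFun h i)

theorem finite_of_le {V : Type*} [AddCommGroup V] [Module ℝ V] {A B : Submodule ℝ V} (h : A ≤ B)
    [FiniteDimensional ℝ B] : FiniteDimensional ℝ A := Submodule.finiteDimensional_of_le h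

/-! ### Derivatives -/

@[simp] theorem gradL_apply (p : Poly3) (i : Fin 3) : gradL p i = pderiv i p := rfl

theorem curlL_apply (v : VPoly3) : curlL v =
    ![pderiv 1 (v 2) - pderiv 2 (v 1), pderiv 2 (v 0) - pderiv 0 (v 2),
      pderiv 0 (v 1) - pderiv 1 (v 0)] := rfl

theorem dirDeriv_apply (w : E3) (p : Poly3) : dirDeriv w p = ∑ i, w i • pderiv i p := by
  simp [dirDeriv, LinearMap.sum_apply]

/-- The commutator of two derivations is a derivation, hence determined by its values on the
variables, where it vanishes. -/
theorem pderiv_comm (i j : Fin 3) (p : Poly3) : pderiv i (pderiv j p) = pderiv j (pderiv i p) := by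
  have := Derivation.congr_fun (D1 := ⁅pderiv (R := ℝ) (σ := Fin 3) i, pderiv j⁆) (D2 := 0)
    (MvPolynomial.derivation_ext fun k => by
      simp [Derivation.commutator_apply, pderiv_X, Pi.single_apply, apply_ite]) p
  rw [Derivation.commutator_apply] at this
  simpa [sub_eq_zero] using this

@[simp] theorem curlL_gradL (p : Poly3) : curlL (gradL p) = 0 := by
  rw [curlL_apply]
  ext i : 1
  fin_cases i <;> simp [pderiv_comm 1 2 p, pderiv_comm 2 0 p, pderiv_comm 0 1 p]

theorem gradL_mem_VP {ℓ : ℤ} {p : Poly3} (hp : p ∈ P (ℓ + 1)) : gradL p ∈ VP ℓ :=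
  mem_VP.2 fun i => pderiv_mem_P hp i

theorem curlL_mem_VP {ℓ : ℤ} {v : VPoly3} (hv : v ∈ VP (ℓ + 1)) : curlL v ∈ VP ℓ := by
  have h := fun i j => pderiv_mem_P (mem_VP.1 hv i) j
  refine mem_VP.2 fun i => ?_
  rw [curlL_apply]
  fin_cases i <;> exact Submodule.sub_mem _ (h _ _) (h _ _)

theorem Goly_le (ℓ : ℤ) : Goly ℓ ≤ VP ℓ := by
  rintro _ ⟨p, hp, rfl⟩; exact gradL_mem_VP hp

theorem Roly_le (ℓ : ℤ) : Roly ℓ ≤ VP ℓ := by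
  rintro _ ⟨p, hp, rfl⟩; exact curlL_mem_VP hp

/-- The linear map that divides the monomials of degree `d` by `d + s`. -/
noncomputable def degDiv (s : ℝ) : Poly3 →ₗ[ℝ] Poly3 :=
  (basisMonomials (Fin 3) ℝ).constr ℝ fun m => monomial m ((m.degree : ℝ) + s)⁻¹

theorem degDiv_monomial (s : ℝ) (m : Fin 3 →₀ ℕ) :
    degDiv s (monomial m 1) = monomial m ((m.degree : ℝ) + s)⁻¹ := by
  have := (basisMonomials (Fin 3) ℝ).constr_basis ℝ (fun m => monomial m ((m.degree : ℝ) + s)⁻¹) m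
  simpa [degDiv] using this

theorem degDiv_mem_P {s : ℝ} {ℓ : ℤ} {p : Poly3} (hp : p ∈ P ℓ) : degDiv s p ∈ P ℓ :=
  map_P_le (degDiv s) _ (fun m hm => by rw [degDiv_monomial]; exact monomial_mem_P hm _) hp

theorem linearMap_ext_monomial {V : Type*} [AddCommGroup V] [Module ℝ V] {f g : Poly3 →ₗ[ℝ] V}
    (h : ∀ m, f (monomial m 1) = g (monomial m 1)) : f = g :=
  (basisMonomials (Fin 3) ℝ).ext fun m => by simpa using h m

/-- Differentiation lowers the degree by one and the shift by `2` compensates: `d + 1 = (d - 1) +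
2`. -/
theorem pderiv_degDiv (i : Fin 3) (p : Poly3) :
    pderiv i (degDiv 1 p) = degDiv 2 (pderiv i p) := by
  have : (pderiv (R := ℝ) i).toLinearMap ∘ₗ degDiv 1
      = degDiv 2 ∘ₗ (pderiv (R := ℝ) i).toLinearMap := by
    refine linearMap_ext_monomial fun m => ?_
    change pderiv i (degDiv 1 (monomial m 1)) = degDiv 2 (pderiv i (monomial m 1))
    rw [degDiv_monomial, pderiv_monomial, pderiv_monomial]
    rcases Nat.eq_zero_or_pos (m i) with h | h
    · simp [h]
    · have h1 : m - Finsupp.single i 1 + Finsupp.single i 1 = m :=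
        tsub_add_cancel_of_le (by rw [Finsupp.single_le_iff]; exact h)
      have h2 : (m - Finsupp.single i 1).degree + 1 = m.degree := by
        conv_rhs => rw [← h1]
        simp
      rw [show monomial (m - Finsupp.single i 1) (1 * (m i : ℝ))
        = (m i : ℝ) • monomial (m - Finsupp.single i 1) (1 : ℝ) by
          rw [smul_monomial, smul_eq_mul, mul_comm], map_smul, degDiv_monomial, smul_monomial,
          smul_eq_mul, mul_comm, ← h2]
      push_cast
      ring_nf
  exact LinearMap.congr_fun this p

/-- By Euler's identity, identity plus radial derivative multiplies a monomial of degree `d` by `d +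
1`, which `degDiv 1` undoes. In integral form, `degDiv 1 p` is `∫₀¹ p(t x) dt`. -/
theorem euler_degDiv (p : Poly3) :
    degDiv 1 p + ∑ i, X i * pderiv i (degDiv 1 p) = p := by
  induction p using MvPolynomial.induction_on' with
  | monomial m a =>
    have h : degDiv 1 (monomial m a) = monomial m (a * ((m.degree : ℝ) + 1)⁻¹) := by
      rw [← mul_one a, ← smul_eq_mul, ← smul_monomial, map_smul, degDiv_monomial, smul_monomial]
      simp
    rw [h, (isHomogeneous_monomial (n := m.degree) _ rfl).sum_X_mul_pderiv,
      ← Nat.cast_smul_eq_nsmul ℝ, smul_monomial, ← map_add]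
    congr 1
    have : (m.degree : ℝ) + 1 ≠ 0 := by positivity
    rw [smul_eq_mul]
    field_simp
    ring
  | add p q hp hq =>
    conv_rhs => rw [← hp, ← hq]
    simp only [map_add, mul_add, Finset.sum_add_distrib]
    abel

/-- An irrotational polynomial field is a gradient. -/
theorem mem_Goly_of_curlL_eq_zero {ℓ : ℤ} {v : VPoly3} (hv : v ∈ VP ℓ) (hc : curlL v = 0) :
    v ∈ Goly ℓ := by
  have hs : ∀ i j, pderiv j (v i) = pderiv i (v j) := by
    rw [curlL_apply] at hc
    have h0 := congrFun hc 0
    have h1 := congrFun hc 1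
    have h2 := congrFun hc 2
    simp [sub_eq_zero] at h0 h1 h2
    intro i j
    fin_cases i <;> fin_cases j <;> simp [h0, h1, h2]
  -- The potential of the Poincaré lemma on a star-shaped domain, `∫₀¹ x · v(t x) dt`.
  refine ⟨∑ i, X i * degDiv 1 (v i), Submodule.sum_mem _ fun i _ => ?_, ?_⟩
  · rw [add_comm]
    exact mul_mem_P (X_mem_P le_rfl i) (degDiv_mem_P (mem_VP.1 hv i))
  · funext j
    rw [gradL_apply, map_sum]
    conv_rhs => rw [← euler_degDiv (v j)]
    have h1 : ∀ i, pderiv j (X i * degDiv 1 (v i))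
        = (if i = j then degDiv 1 (v i) else 0) + X i * pderiv i (degDiv 1 (v j)) := by
      intro i
      rw [pderiv_mul, pderiv_degDiv, pderiv_degDiv, hs i j]
      split_ifs with h
      · rw [h, pderiv_X_self, one_mul]
      · rw [pderiv_X_of_ne h, zero_mul]
    rw [Finset.sum_congr rfl fun i _ => h1 i, Finset.sum_add_distrib, Finset.sum_ite_eq' ]
    simp

/-! ### Polynomials along lines -/

theorem hasDerivAt_evalAt_line (x w : E3) (p : Poly3) (t : ℝ) :
    HasDerivAt (fun t : ℝ => evalAt (x + t • w) p) (evalAt (x + t • w) (dirDeriv w p)) t := by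
  induction p using MvPolynomial.induction_on with
  | C a => simpa [dirDeriv_apply] using hasDerivAt_const t a
  | add p q hp hq =>
    simp only [map_add, evalAt_add]
    exact hp.add hq
  | mul_X p i hp =>
    have hX : HasDerivAt (fun t : ℝ => evalAt (x + t • w) (X i)) (w i) t := by
      simp only [evalAt_X, PiLp.add_apply, PiLp.smul_apply, smul_eq_mul]
      simpa using ((hasDerivAt_id t).mul_const (w i)).const_add (x i)
    have h := hp.mul hX
    simp only [evalAt_mul]
    refine h.congr_deriv ?_
    simp only [dirDeriv_apply, pderiv_mul, pderiv_X, evalAt_sum, evalAt_smul, evalAt_add,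
      evalAt_mul, mul_add, Finset.sum_add_distrib, Finset.sum_mul]
    have : ∑ j, w j * (evalAt (x + t • w) p * evalAt (x + t • w) (Pi.single (M := fun _ => Poly3) j 1 i))
        = evalAt (x + t • w) p * w i := by
      rw [Finset.sum_eq_single i]
      · simp [mul_comm]
      · intro j _ hj; simp [hj.symm]
      · simp
    rw [this]
    congr 1
    exact Finset.sum_congr rfl fun j _ => by ring

theorem evalAt_add_smul_of_dirDeriv {w : E3} {p : Poly3} (h : dirDeriv w p = 0) (x : E3) (t : ℝ) :
    evalAt (x + t • w) p = evalAt x p := by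
  have := is_const_of_deriv_eq_zero (f := fun t : ℝ => evalAt (x + t • w) p)
    (fun t => (hasDerivAt_evalAt_line x w p t).differentiableAt)
    (fun t => by rw [(hasDerivAt_evalAt_line x w p t).deriv, h, evalAt_zero]) t 0
  simpa using this

/-- A Euclidean ball contains a box, and a polynomial that vanishes on a product of infinite sets is
zero. -/
theorem eq_zero_of_evalAt_ball {x : E3} {r : ℝ} (hr : 0 < r) {p : Poly3}
    (h : ∀ y ∈ Metric.ball x r, evalAt y p = 0) : p = 0 := by
  have hopen : IsOpen ((fun y : Fin 3 → ℝ => (WithLp.toLp 2 y : E3)) ⁻¹' Metric.ball x r) :=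
    Metric.isOpen_ball.preimage (PiLp.continuous_toLp 2 _)
  obtain ⟨ε, hε, hb⟩ := Metric.isOpen_iff.1 hopen x.ofLp (by simpa using hr)
  refine MvPolynomial.funext_set (fun i => Metric.ball (x.ofLp i) ε) (fun i => ?_) fun y hy => ?_
  · rw [Real.ball_eq_Ioo]; exact Set.Ioo_infinite (by linarith)
  · have h1 : y ∈ Metric.ball x.ofLp ε := by
      rw [← ball_pi _ hε] at *
      exact hy
    have := h _ (hb h1)
    simpa [evalAt] using this

/-! ### Affine substitutions -/

/-- Substitution of polynomials for the variables. -/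
noncomputable abbrev subst (f : Fin 3 → Poly3) : Poly3 →ₐ[ℝ] Poly3 := bind₁ f

theorem subst_mem_P {f : Fin 3 → Poly3} (hf : ∀ i, f i ∈ P 1) {ℓ : ℤ} {p : Poly3} (hp : p ∈ P ℓ) :
    subst f p ∈ P ℓ := by
  refine map_P_le (subst f).toLinearMap (P ℓ) (fun m hm => P_mono hm ?_) hp
  change bind₁ f (monomial m 1) ∈ _
  induction m using Finsupp.induction_linear with
  | zero => simpa using C_mem_P le_rfl 1
  | add a b ha hb =>
    rw [show monomial (a + b) (1 : ℝ) = monomial a 1 * monomial b 1 by simp [monomial_mul], map_mul,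
      map_add]
    push_cast
    exact mul_mem_P (ha ((by simp : ((a.degree : ℕ) : ℤ) ≤ ((a + b).degree : ℕ)).trans hm))
      (hb ((by simp : ((b.degree : ℕ) : ℤ) ≤ ((a + b).degree : ℕ)).trans hm))
  | single i n =>
    clear hm
    rw [bind₁_monomial]
    change C 1 * (Finsupp.single i n).prod (fun j e => f j ^ e) ∈ _
    rw [Finsupp.prod_single_index (h := fun j e => f j ^ e) (pow_zero _), map_one, one_mul, Finsupp.degree_single]
    induction n with
    | zero => simpa using C_mem_P le_rfl 1
    | succ n ih => rw [pow_succ]; push_cast; exact mul_mem_P ih (hf i)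

theorem evalAt_subst (f : Fin 3 → Poly3) (x : E3) (p : Poly3) :
    evalAt x (subst f p) = evalAt (WithLp.toLp 2 fun i => evalAt x (f i)) p := by
  unfold evalAt
  rw [← MvPolynomial.coe_aeval_eq_eval, ← MvPolynomial.coe_aeval_eq_eval, RingHom.coe_coe,
    RingHom.coe_coe, subst, aeval_bind₁]

theorem pderiv_subst (f : Fin 3 → Poly3) (i : Fin 3) (p : Poly3) :
    pderiv i (subst f p) = ∑ j, subst f (pderiv j p) * pderiv i (f j) := by
  induction p using MvPolynomial.induction_on with
  | C a => simp
  | add p q hp hq => simp only [map_add, hp, hq, add_mul, Finset.sum_add_distrib]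
  | mul_X p k hp =>
    simp only [map_mul, pderiv_mul, bind₁_X_right, hp, map_add, add_mul, Finset.sum_add_distrib, pderiv_X]
    congr 1
    · rw [Finset.sum_mul]; exact Finset.sum_congr rfl fun j _ => by ring
    · rw [Finset.sum_eq_single k]
      · simp
      · intro j _ hj; simp [hj.symm]
      · simp

/-- The substitution `y ↦ x + h y`. -/
noncomputable def scal (x : E3) (h : ℝ) : Poly3 →ₐ[ℝ] Poly3 := subst fun i => C (x i) + C h * X i

theorem scal_mem_P {x : E3} {h : ℝ} {ℓ : ℤ} {p : Poly3} (hp : p ∈ P ℓ) : scal x h p ∈ P ℓ := by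
  refine subst_mem_P (fun i => Submodule.add_mem _ (C_mem_P (by norm_num) _) ?_) hp
  rw [← smul_eq_C_mul]; exact Submodule.smul_mem _ _ (X_mem_P le_rfl i)

theorem evalAt_scal (x : E3) (h : ℝ) (y : E3) (p : Poly3) :
    evalAt y (scal x h p) = evalAt (x + h • y) p := by
  rw [scal, evalAt_subst]
  congr 1
  ext i
  simp

theorem pderiv_scal (x : E3) (h : ℝ) (i : Fin 3) (p : Poly3) :
    pderiv i (scal x h p) = h • scal x h (pderiv i p) := by
  rw [scal, pderiv_subst, Finset.sum_eq_single i]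
  · simp [smul_eq_C_mul, mul_comm]
  · intro j _ hj; simp [pderiv_X, hj]
  · simp

/-! ### Positive bilinear forms -/

section Bilin
variable {E : Type*} [AddCommGroup E] [Module ℝ E]

/-- The source of existence for all reconstructions and for the correction. The form lives on the
whole, infinite-dimensional, polynomial space and is only required to be definite on `W`; there the
induced map to the dual is injective, hence onto by dimension. -/
theorem exists_riesz (b : LinearMap.BilinForm ℝ E) (W : Submodule ℝ E) [FiniteDimensional ℝ W]
    (hpos : ∀ w ∈ W, b w w = 0 → w = 0) (L : E →ₗ[ℝ] ℝ) : ∃ g ∈ W, ∀ w ∈ W, b g w = L w := by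
  let f : W →ₗ[ℝ] Module.Dual ℝ W := b.domRestrict₁₂ W W
  have hinj : Function.Injective f := by
    rw [← LinearMap.ker_eq_bot, LinearMap.ker_eq_bot']
    intro w hw
    have : b w w = 0 := LinearMap.congr_fun hw w
    exact Subtype.ext (hpos w w.2 this)
  have hsurj : Function.Surjective f :=
    (LinearMap.injective_iff_surjective_of_finrank_eq_finrank
      (Subspace.dual_finrank_eq (K := ℝ) (V := W)).symm).1 hinj
  obtain ⟨g, hg⟩ := hsurj (L.domRestrict W)
  exact ⟨g, g.2, fun w hw => LinearMap.congr_fun hg ⟨w, hw⟩⟩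

theorem exists_orthogonal_decomposition (b : LinearMap.BilinForm ℝ E) (W : Submodule ℝ E)
    [FiniteDimensional ℝ W] (hpos : ∀ w ∈ W, b w w = 0 → w = 0) (v : E) :
    ∃ g ∈ W, ∀ w ∈ W, b (v - g) w = 0 := by
  obtain ⟨g, hg, h⟩ := exists_riesz b W hpos (b v)
  exact ⟨g, hg, fun w hw => by rw [map_sub, LinearMap.sub_apply, h w hw, sub_self]⟩

theorem abs_apply_le_sqrt (b : LinearMap.BilinForm ℝ E) (hs : ∀ v w, b v w = b w v)
    (hp : ∀ v, 0 ≤ b v v) (v w : E) : |b v w| ≤ √(b v v) * √(b w w) := by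
  rw [← Real.sqrt_mul (hp v)]
  refine Real.abs_le_sqrt ?_
  exact b.apply_sq_le_of_symm hp ⟨fun v w => by simpa using hs v w⟩ v w

/-- On a finite-dimensional space, a pointwise bounded family of linear forms is uniformly bounded
by any Euclidean norm. -/
theorem exists_uniform_bound (b : LinearMap.BilinForm ℝ E) (hs : ∀ v w, b v w = b w v)
    (hp : ∀ v, 0 ≤ b v v) (W : Submodule ℝ E) [FiniteDimensional ℝ W]
    (hpos : ∀ w ∈ W, b w w = 0 → w = 0) {A : Type*} (f : A → E →ₗ[ℝ] ℝ)
    (hf : ∀ w, ∃ M : ℝ, ∀ a, |f a w| ≤ M) :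
    ∃ C : ℝ, 0 < C ∧ ∀ w ∈ W, ∀ a, f a w ^ 2 ≤ C * b w w := by
  choose M hM using hf
  let e := Module.finBasis ℝ W
  have hext : ∀ i, ∃ L : E →ₗ[ℝ] ℝ, ∀ w : W, L w = e.coord i w := fun i => by
    obtain ⟨L, hL⟩ := LinearMap.exists_extend (e.coord i)
    exact ⟨L, fun w => LinearMap.congr_fun hL w⟩
  choose L hL using hext
  have hr := fun i => exists_riesz b W hpos (L i)
  choose g hg hgL using hr
  -- `g i` represents the `i`-th coordinate on `W`, so Cauchy–Schwarz bounds that coordinate of `w`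
  -- by the norm of `g i` times that of `w`.
  set K : ℝ := ∑ i, |M (e i)| * √(b (g i) (g i)) with hK
  have hK0 : 0 ≤ K := Finset.sum_nonneg fun i _ => by positivity
  refine ⟨K ^ 2 + 1, by positivity, fun w hw a => ?_⟩
  have h1 : |f a w| ≤ K * √(b w w) := by
    have hw' : w = ∑ i, e.coord i ⟨w, hw⟩ • (e i : E) := by
      have := congrArg Subtype.val (e.sum_repr ⟨w, hw⟩)
      rw [Submodule.coe_sum] at this
      exact this.symm
    conv_lhs => rw [hw', map_sum]
    refine (Finset.abs_sum_le_sum_abs _ _).trans ?_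
    rw [hK, Finset.sum_mul]
    refine Finset.sum_le_sum fun i _ => ?_
    rw [map_smul, smul_eq_mul, abs_mul, ← hL i ⟨w, hw⟩, ← hgL i w hw]
    calc _ ≤ (√(b (g i) (g i)) * √(b w w)) * |M (e i)| := by
            refine mul_le_mul (abs_apply_le_sqrt b hs hp _ _) ?_ (abs_nonneg _) (by positivity)
            exact (hM _ a).trans (le_abs_self _)
      _ = _ := by ring
  calc f a w ^ 2 = |f a w| ^ 2 := (sq_abs _).symm
    _ ≤ (K * √(b w w)) ^ 2 := by gcongr
    _ = K ^ 2 * b w w := by rw [mul_pow, Real.sq_sqrt (hp w)]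
    _ ≤ _ := by nlinarith [hp w]

end Bilin

/-! ### `L²` products as bilinear forms -/

/-- All polynomials are integrable for `μ`. -/
abbrev PolyIntegrable (μ : Measure E3) : Prop := ∀ p : Poly3, Integrable (fun x => evalAt x p) μ

variable {μ : Measure E3}

/-- The `L²` product of scalar polynomials as a bilinear form. -/
noncomputable def bilS (hμ : PolyIntegrable μ) : LinearMap.BilinForm ℝ Poly3 :=
  LinearMap.mk₂ ℝ (ipS μ)
    (fun p q r => by unfold ipS; rw [← integral_add (hμ _) (hμ _)]; simp [add_mul])
    (fun c p q => by unfold ipS; rw [smul_eq_mul, ← integral_const_mul]; simp)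
    (fun p q r => by unfold ipS; rw [← integral_add (hμ _) (hμ _)]; simp [mul_add])
    (fun c p q => by unfold ipS; rw [smul_eq_mul, ← integral_const_mul]; simp)

/-- The `L²` product of polynomial fields as a bilinear form. -/
noncomputable def bilV (hμ : PolyIntegrable μ) : LinearMap.BilinForm ℝ VPoly3 :=
  LinearMap.mk₂ ℝ (ipV μ)
    (fun p q r => by unfold ipV; rw [← integral_add (hμ _) (hμ _)]; simp [add_dotProduct])
    (fun c p q => by unfold ipV; rw [smul_eq_mul, ← integral_const_mul]; simp)
    (fun p q r => by unfold ipV; rw [← integral_add (hμ _) (hμ _)]; simp [dotProduct_add])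
    (fun c p q => by unfold ipV; rw [smul_eq_mul, ← integral_const_mul]; simp)

@[simp] theorem bilS_apply (hμ : PolyIntegrable μ) (p q : Poly3) : bilS hμ p q = ipS μ p q := rfl
@[simp] theorem bilV_apply (hμ : PolyIntegrable μ) (p q : VPoly3) : bilV hμ p q = ipV μ p q := rfl

theorem ipS_comm (p q : Poly3) : ipS μ p q = ipS μ q p := by unfold ipS; rw [mul_comm]
theorem ipV_comm (p q : VPoly3) : ipV μ p q = ipV μ q p := by unfold ipV; rw [dotProduct_comm]

theorem evalAt_dotProduct_self_nonneg (x : E3) (v : VPoly3) : 0 ≤ evalAt x (v ⬝ᵥ v) := by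
  rw [evalAt_dotProduct]; exact Finset.sum_nonneg fun i _ => mul_self_nonneg _

theorem ipS_self_nonneg (p : Poly3) : 0 ≤ ipS μ p p :=
  integral_nonneg fun x => by simp only [evalAt_mul]; exact mul_self_nonneg _
theorem ipV_self_nonneg (v : VPoly3) : 0 ≤ ipV μ v v :=
  integral_nonneg fun x => evalAt_dotProduct_self_nonneg x v

theorem normS_sq (p : Poly3) : normS μ p ^ 2 = ipS μ p p := Real.sq_sqrt (ipS_self_nonneg p)
theorem normV_sq (v : VPoly3) : normV μ v ^ 2 = ipV μ v v := Real.sq_sqrt (ipV_self_nonneg v)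

theorem ipV_eq_sum (hμ : PolyIntegrable μ) (v w : VPoly3) :
    ipV μ v w = ∑ i, ipS μ (v i) (w i) := by
  unfold ipV ipS
  rw [← integral_finsetSum _ fun i _ => hμ _]
  simp [dotProduct, evalAt_sum]

/-- The `L²` product is definite for a measure that contains Lebesgue measure on a ball. -/
theorem eq_zero_of_ipS_ball {x : E3} {r : ℝ} (hr : 0 < r) {p : Poly3}
    (h : ipS (volume.restrict (Metric.ball x r)) p p = 0) : p = 0 := by
  refine eq_zero_of_evalAt_ball (x := x) hr ?_
  have hc := continuous_evalAt (p * p)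
  have hnn : ∀ x, 0 ≤ evalAt x (p * p) := fun x => by rw [evalAt_mul]; exact mul_self_nonneg _
  have hi : IntegrableOn (fun x => evalAt x (p * p)) (Metric.ball x r) :=
    integrable_of_bounded Metric.isBounded_ball measure_ball_lt_top _
  have h0 := (setIntegral_eq_zero_iff_of_nonneg_ae (Eventually.of_forall hnn) hi).1 h
  have h1 := Measure.eqOn_open_of_ae_eq (f := fun x => evalAt x (p * p)) (g := fun _ => (0 : ℝ)) h0
    Metric.isOpen_ball hc.continuousOn continuousOn_const
  intro y hy
  have := h1 hy
  simpa using this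

theorem polyIntegrable_ball (x : E3) (r : ℝ) :
    PolyIntegrable (volume.restrict (Metric.ball x r)) :=
  integrable_of_bounded Metric.isBounded_ball measure_ball_lt_top

theorem eq_zero_of_ipV_ball {x : E3} {r : ℝ} (hr : 0 < r) {v : VPoly3}
    (h : ipV (volume.restrict (Metric.ball x r)) v v = 0) : v = 0 := by
  rw [ipV_eq_sum (polyIntegrable_ball x r),
    Finset.sum_eq_zero_iff_of_nonneg fun i _ => ipS_self_nonneg _] at h
  funext i
  exact eq_zero_of_ipS_ball hr (h i (Finset.mem_univ i))

/-! ### Scaled inequalities on polynomial spaces -/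

/-- Evaluation at a point, as a linear form. -/
noncomputable def evalL (y : E3) : Poly3 →ₗ[ℝ] ℝ :=
  { toFun := evalAt y, map_add' := evalAt_add y, map_smul' := fun c p => by simp }

theorem exists_bound_evalAt (p : Poly3) (x : E3) (R : ℝ) :
    ∃ M, ∀ y : Metric.closedBall x R, |evalAt y p| ≤ M := by
  obtain ⟨M, hM⟩ := (isCompact_closedBall x R).exists_bound_of_continuousOn
    (continuous_evalAt p).continuousOn
  exact ⟨M, fun y => hM y y.2⟩

/-- Evaluations of a polynomial and of its derivatives on a compact ball are pointwise bounded
families of linear forms on a finite-dimensional space. Radius 2 is ample: in units of `h_T`, an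
element lies at distance at most 1 from any of its points. -/
theorem exists_bound_reference (ℓ : ℤ) {κ : ℝ} (hκ : 0 < κ) :
    ∃ C : ℝ, 0 < C ∧ ∀ p ∈ P ℓ, ∀ y ∈ Metric.closedBall (0 : E3) 2,
      evalAt y p ^ 2 ≤ C * ipS (volume.restrict (Metric.ball (0 : E3) κ)) p p ∧
      ∀ i, evalAt y (pderiv i p) ^ 2 ≤ C * ipS (volume.restrict (Metric.ball (0 : E3) κ)) p p := by
  have hμ := polyIntegrable_ball 0 κ
  obtain ⟨C₁, h₁, H₁⟩ := exists_uniform_bound (bilS hμ) ipS_comm ipS_self_nonneg (P ℓ)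
    (fun w _ hw => eq_zero_of_ipS_ball hκ hw) (A := Metric.closedBall (0 : E3) 2)
    (fun y => evalL y) (fun p => exists_bound_evalAt p 0 2)
  have h2 := fun i => exists_uniform_bound (bilS hμ) ipS_comm ipS_self_nonneg (P ℓ)
    (fun w _ hw => eq_zero_of_ipS_ball hκ hw) (A := Metric.closedBall (0 : E3) 2)
    (fun y => evalL y ∘ₗ (pderiv (R := ℝ) i).toLinearMap)
    (fun p => exists_bound_evalAt (pderiv i p) 0 2)
  choose C₂ h₂ H₂ using h2
  have hC : ∀ i, C₂ i ≤ ∑ j, C₂ j := fun i =>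
    Finset.single_le_sum (fun j _ => (h₂ j).le) (Finset.mem_univ i)
  have hC0 : 0 ≤ ∑ j, C₂ j := Finset.sum_nonneg fun j _ => (h₂ j).le
  refine ⟨C₁ + ∑ i, C₂ i, by linarith, fun p hp y hy => ⟨?_, fun i => ?_⟩⟩
  · refine (H₁ p hp ⟨y, hy⟩).trans ?_
    have := ipS_self_nonneg (μ := volume.restrict (Metric.ball (0 : E3) κ)) p
    rw [bilS_apply]
    gcongr
    linarith
  · refine (H₂ i p hp ⟨y, hy⟩).trans ?_
    have := ipS_self_nonneg (μ := volume.restrict (Metric.ball (0 : E3) κ)) p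
    rw [bilS_apply]
    gcongr
    linarith [hC i]

theorem integral_ball_scal (x : E3) {h : ℝ} (hh : 0 < h) (κ : ℝ) (p : Poly3) :
    ∫ y in Metric.ball x (κ * h), evalAt y p
      = h ^ 3 * ∫ y in Metric.ball (0 : E3) κ, evalAt y (scal x h p) := by
  rw [← integral_indicator measurableSet_ball, ← integral_indicator measurableSet_ball]
  have h1 := integral_add_left_eq_self (μ := (volume : Measure E3))
    ((Metric.ball x (κ * h)).indicator fun y => evalAt y p) x
  have h2 := Measure.integral_comp_smul (volume : Measure E3)
    (fun y => (Metric.ball x (κ * h)).indicator (fun y => evalAt y p) (x + y)) h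
  rw [h1] at h2
  have h3 : ∀ y : E3, (Metric.ball x (κ * h)).indicator (fun y => evalAt y p) (x + h • y)
      = (Metric.ball (0 : E3) κ).indicator (fun y => evalAt y (scal x h p)) y := by
    intro y
    have : x + h • y ∈ Metric.ball x (κ * h) ↔ y ∈ Metric.ball (0 : E3) κ := by
      rw [mem_ball_iff_norm, mem_ball_zero_iff, add_sub_cancel_left, norm_smul, Real.norm_eq_abs,
        abs_of_pos hh, mul_comm, mul_lt_mul_iff_left₀ hh]
    by_cases hy : y ∈ Metric.ball (0 : E3) κ
    · rw [indicator_of_mem hy, indicator_of_mem (this.2 hy), evalAt_scal]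
    · rw [indicator_of_notMem hy, indicator_of_notMem (fun h => hy (this.1 h))]
  simp only [h3] at h2
  rw [h2, finrank_euclideanSpace_fin, abs_of_pos (by positivity), smul_eq_mul, ← mul_assoc,
    mul_inv_cancel₀ (by positivity), one_mul]

theorem ipS_ball_scal (x : E3) {h : ℝ} (hh : 0 < h) (κ : ℝ) (p q : Poly3) :
    ipS (volume.restrict (Metric.ball x (κ * h))) p q
      = h ^ 3 * ipS (volume.restrict (Metric.ball (0 : E3) κ)) (scal x h p) (scal x h q) := by
  unfold ipS
  rw [integral_ball_scal x hh, map_mul]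

theorem exists_eq_add_smul {x : E3} {h : ℝ} (hh : 0 < h) {R : ℝ} {y : E3}
    (hy : y ∈ Metric.closedBall x (R * h)) :
    ∃ z ∈ Metric.closedBall (0 : E3) R, y = x + h • z := by
  refine ⟨h⁻¹ • (y - x), ?_, by rw [smul_inv_smul₀ hh.ne']; abel⟩
  rw [mem_closedBall_zero_iff, norm_smul, norm_inv, Real.norm_eq_abs, abs_of_pos hh,
    inv_mul_le_iff₀ hh, mul_comm]
  exact mem_closedBall_iff_norm.1 hy

/-- The scaled form of the reference bound: `h ^ 3` is the volume factor, and a derivative costs one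
more `h`, squared. -/
theorem exists_sup_bound (ℓ : ℤ) {κ : ℝ} (hκ : 0 < κ) :
    ∃ C : ℝ, 0 < C ∧ ∀ (x : E3) (h : ℝ), 0 < h → ∀ p ∈ P ℓ, ∀ y ∈ Metric.closedBall x (2 * h),
      h ^ 3 * evalAt y p ^ 2 ≤ C * ipS (volume.restrict (Metric.ball x (κ * h))) p p ∧
      ∀ i, h ^ 5 * evalAt y (pderiv i p) ^ 2
        ≤ C * ipS (volume.restrict (Metric.ball x (κ * h))) p p := by
  obtain ⟨C, hC, H⟩ := exists_bound_reference ℓ hκ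
  refine ⟨C, hC, fun x h hh p hp y hy => ?_⟩
  obtain ⟨z, hz, rfl⟩ := exists_eq_add_smul hh hy
  obtain ⟨h1, h2⟩ := H (scal x h p) (scal_mem_P hp) z hz
  rw [ipS_ball_scal x hh]
  rw [evalAt_scal] at h1
  refine ⟨?_, fun i => ?_⟩
  · have := mul_le_mul_of_nonneg_left h1 (pow_pos hh 3).le
    linarith
  · have h3 := h2 i
    rw [pderiv_scal, evalAt_smul, evalAt_scal] at h3
    have := mul_le_mul_of_nonneg_left h3 (pow_pos hh 3).le
    calc _ = h ^ 3 * (h * evalAt (x + h • z) (pderiv i p)) ^ 2 := by ring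
      _ ≤ _ := by linarith

theorem perpIn_le (hμ : PolyIntegrable μ) (W V : Submodule ℝ VPoly3) : perpIn μ hμ W V ≤ V :=
  fun _ h => h.1

theorem exists_perpIn_decomposition (hμ : PolyIntegrable μ) {W V : Submodule ℝ VPoly3} (hWV : W ≤ V)
    [FiniteDimensional ℝ W] (hpos : ∀ w ∈ W, ipV μ w w = 0 → w = 0) {v : VPoly3} (hv : v ∈ V) :
    ∃ g ∈ W, v - g ∈ perpIn μ hμ W V := by
  obtain ⟨g, hg, h⟩ := exists_orthogonal_decomposition (bilV hμ) W hpos v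
  exact ⟨g, hg, V.sub_mem hv (hWV hg), h⟩

theorem eq_zero_of_mem_perpIn {hμ : PolyIntegrable μ} {W V : Submodule ℝ VPoly3} {v : VPoly3}
    (hpos : ∀ w ∈ W, ipV μ w w = 0 → w = 0) (hv : v ∈ perpIn μ hμ W V) (hW : v ∈ W) : v = 0 :=
  hpos v hW (hv.2 v hW)

/-- On the orthogonal complement of the gradients the curl is injective, since irrotational
polynomial fields are gradients. The `L²` norm of the curl is therefore a norm there and controls
point values; `g` is the gradient part of `w`. -/
theorem exists_potential_reference (ℓ : ℤ) {κ : ℝ} (hκ : 0 < κ) :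
    ∃ C : ℝ, 0 < C ∧ ∀ w ∈ VP ℓ, ∃ g ∈ Goly ℓ, ∀ y ∈ Metric.closedBall (0 : E3) 2, ∀ i,
      evalAt y ((w - g) i) ^ 2
        ≤ C * ipV (volume.restrict (Metric.ball (0 : E3) κ)) (curlL w) (curlL w) := by
  have hμ := polyIntegrable_ball 0 κ
  have := finite_of_le (Goly_le ℓ)
  have hpos : ∀ w : VPoly3, ipV (volume.restrict (Metric.ball (0 : E3) κ)) w w = 0 → w = 0 :=
    fun w hw => eq_zero_of_ipV_ball hκ hw
  set K := perpIn _ hμ (Goly ℓ) (VP ℓ) with hK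
  have := finite_of_le (perpIn_le hμ (Goly ℓ) (VP ℓ))
  obtain ⟨C, hC, H⟩ := exists_uniform_bound ((bilV hμ).compl₁₂ curlL curlL)
    (fun v w => ipV_comm _ _) (fun v => ipV_self_nonneg _) K
    (fun w hw h => eq_zero_of_mem_perpIn (fun w _ => hpos w) hw
      (mem_Goly_of_curlL_eq_zero hw.1 (hpos _ h)))
    (A := Metric.closedBall (0 : E3) 2 × Fin 3)
    (fun a => evalL a.1 ∘ₗ LinearMap.proj a.2) (fun w => by
      have h := fun i => exists_bound_evalAt (w i) 0 2
      choose M hM using h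
      refine ⟨∑ i, |M i|, fun a => ?_⟩
      exact ((hM a.2 a.1).trans (le_abs_self _)).trans
        (Finset.single_le_sum (f := fun i => |M i|) (fun j _ => abs_nonneg _) (Finset.mem_univ a.2)))
  refine ⟨C, hC, fun w hw => ?_⟩
  obtain ⟨g, hg, hwg⟩ := exists_perpIn_decomposition hμ (Goly_le ℓ) (fun w _ => hpos w) hw
  refine ⟨g, hg, fun y hy i => ?_⟩
  have h1 := H (w - g) hwg (⟨y, hy⟩, i)
  have h2 : curlL g = 0 := by obtain ⟨p, -, rfl⟩ := hg; exact curlL_gradL p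
  have h3 : ((bilV hμ).compl₁₂ curlL curlL) (w - g) (w - g)
    = ipV (volume.restrict (Metric.ball (0 : E3) κ)) (curlL w) (curlL w) := by
    rw [LinearMap.compl₁₂_apply, map_sub, h2, sub_zero]; rfl
  rw [h3] at h1
  exact h1

theorem exists_potential_bound (ℓ : ℤ) {κ : ℝ} (hκ : 0 < κ) :
    ∃ C : ℝ, 0 < C ∧ ∀ (x : E3) (h : ℝ), 0 < h → ∀ w ∈ VP ℓ, ∃ g ∈ Goly ℓ,
      ∀ y ∈ Metric.closedBall x (2 * h), ∀ i, h * evalAt y ((w - g) i) ^ 2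
        ≤ C * ipV (volume.restrict (Metric.ball x (κ * h))) (curlL w) (curlL w) := by
  obtain ⟨C, hC, H⟩ := exists_potential_reference ℓ hκ
  refine ⟨C, hC, fun x h hh w hw => ?_⟩
  obtain ⟨_, ⟨p, hp, rfl⟩, hg⟩ := H (fun i => scal x h (w i))
    (mem_VP.2 fun i => scal_mem_P (mem_VP.1 hw i))
  -- The reference potential is composed with the inverse dilation `y ↦ (y - x)/h`; the factor `h`
  -- cancels the `h⁻¹` produced by differentiation.
  refine ⟨gradL (h • scal (-(h⁻¹ • x)) h⁻¹ p), ⟨_, Submodule.smul_mem _ _ (scal_mem_P hp), rfl⟩,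
    fun y hy i => ?_⟩
  obtain ⟨z, hz, rfl⟩ := exists_eq_add_smul hh hy
  have h1 := hg z hz i
  have h2 : curlL (fun i => scal x h (w i)) = h • fun i => scal x h (curlL w i) := by
    rw [curlL_apply, curlL_apply]
    ext i : 1
    fin_cases i <;> simp [pderiv_scal, smul_sub]
  have h3 : evalAt z (((fun i => scal x h (w i)) - gradL p) i)
      = evalAt (x + h • z) ((w - gradL (h • scal (-(h⁻¹ • x)) h⁻¹ p)) i) := by
    simp only [Pi.sub_apply, evalAt_sub, evalAt_scal, gradL_apply]
    rw [Derivation.map_smul, pderiv_scal, smul_smul, mul_inv_cancel₀ hh.ne', one_smul, evalAt_scal]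
    congr 2
    rw [smul_add, smul_smul, inv_mul_cancel₀ hh.ne', one_smul]; abel
  have h4 : ipV (volume.restrict (Metric.ball x (κ * h))) (curlL w) (curlL w)
      = h ^ 3 * ipV (volume.restrict (Metric.ball (0 : E3) κ)) (fun i => scal x h (curlL w i))
        (fun i => scal x h (curlL w i)) := by
    rw [ipV_eq_sum (polyIntegrable_ball _ _), ipV_eq_sum (polyIntegrable_ball _ _), Finset.mul_sum]
    exact Finset.sum_congr rfl fun i _ => ipS_ball_scal x hh κ _ _
  have h5 : ∀ v, ipV (volume.restrict (Metric.ball (0 : E3) κ)) (h • v) (h • v)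
      = h ^ 2 * ipV (volume.restrict (Metric.ball (0 : E3) κ)) v v := by
    intro v
    rw [← bilV_apply (polyIntegrable_ball 0 κ), map_smul, map_smul, LinearMap.smul_apply]
    simp only [smul_eq_mul, bilV_apply]; ring
  rw [h3, h2, h5] at h1
  rw [h4]
  have := mul_le_mul_of_nonneg_left h1 hh.le
  linarith

/-! ### Simplices in barycentric coordinates -/

/-- The affine basis made of the vertices of a nondegenerate tetrahedron. -/
noncomputable def simplexBasis {s : Fin 4 → E3} (h : AffineIndependent ℝ s) :
    AffineBasis (Fin 4) ℝ E3 :=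
  ⟨s, h, h.affineSpan_eq_top_iff_card_eq_finrank_add_one.2 (by simp)⟩

section Basis
variable (b : AffineBasis (Fin 4) ℝ E3)

/-- The linear part of a barycentric coordinate. -/
noncomputable def dcoord (i : Fin 4) : E3 →ₗ[ℝ] ℝ := (b.coord i).linear

theorem coord_add (i : Fin 4) (x v : E3) :
    b.coord i (x + v) = b.coord i x + dcoord b i v := by
  have := (b.coord i).map_vadd x v
  simp only [vadd_eq_add] at this
  rw [add_comm x, this, add_comm, dcoord]

theorem coord_linear_sub (i a c : Fin 4) :
    dcoord b i (b a - b c) = (if i = a then 1 else 0) - (if i = c then 1 else 0) := by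
  have := (b.coord i).linearMap_vsub (b a) (b c)
  simp only [vsub_eq_sub] at this
  rw [dcoord, this, b.coord_apply, b.coord_apply]

theorem coord_vertex (i j : Fin 4) : b.coord i (b j) = if i = j then 1 else 0 := b.coord_apply i j

theorem mem_convexHull_iff_coord {x : E3} :
    x ∈ convexHull ℝ (range b) ↔ ∀ i, 0 ≤ b.coord i x := by
  rw [b.convexHull_eq_nonneg_coord]; rfl

theorem mem_interior_iff_coord {x : E3} :
    x ∈ interior (convexHull ℝ (range b)) ↔ ∀ i, 0 < b.coord i x := by
  rw [b.interior_convexHull]; rfl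

theorem mem_convexHull_image {S : Set (Fin 4)} {x : E3} (h0 : ∀ i, 0 ≤ b.coord i x)
    (hS : ∀ i ∉ S, b.coord i x = 0) : x ∈ convexHull ℝ (b '' S) := by
  have hx := b.linear_combination_coord_eq_self x
  have h1 := b.sum_coord_apply_eq_one x
  classical
  have e1 : ∑ i with i ∈ S, b.coord i x = 1 := by
    rw [← h1]; exact Finset.sum_subset (Finset.filter_subset _ _) fun i _ hi => hS i (by simpa using hi)
  have e2 : ∑ i with i ∈ S, b.coord i x • b i = x := by
    refine (Finset.sum_subset (Finset.filter_subset _ _) fun i _ hi => ?_).trans hx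
    rw [hS i (by simpa using hi), zero_smul]
  rw [← e2]
  refine (convex_convexHull ℝ _).sum_mem (fun i _ => h0 i) e1 fun i hi => ?_
  exact subset_convexHull ℝ _ ⟨i, by simpa using hi, rfl⟩

theorem coord_eq_zero_of_mem_affineSpan {j : Fin 4} {x : E3}
    (hx : x ∈ affineSpan ℝ (b '' {j}ᶜ)) : b.coord j x = 0 := by
  have : affineSpan ℝ (b '' {j}ᶜ) ≤ (AffineSubspace.mk' (0 : ℝ) ⊥).comap (b.coord j) := by
    rw [affineSpan_le]
    rintro _ ⟨i, hi, rfl⟩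
    simp [AffineSubspace.mem_mk', Ne.symm hi]
  simpa [AffineSubspace.mem_mk'] using this hx

/-- Otherwise the hull would lie in the plane where the `j`-th coordinate is zero, while that
coordinate is 1 at the `j`-th vertex. -/
theorem mem_of_vertex_mem_convexHull {j : Fin 4} {S : Set (Fin 4)}
    (h : b j ∈ convexHull ℝ (b '' S)) : j ∈ S := by
  by_contra hj
  have h1 : b j ∈ affineSpan ℝ (b '' {j}ᶜ) := by
    refine affineSpan_mono ℝ (image_mono fun i hi => ?_) (convexHull_subset_affineSpan _ h)
    rintro rfl; exact hj hi
  have h2 := coord_eq_zero_of_mem_affineSpan b h1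
  rw [coord_vertex, if_pos rfl] at h2
  exact one_ne_zero h2

/-- The submesh condition on faces is stated with intrinsic interiors; this makes it accessible from
barycentric coordinates. Positivity of the three other coordinates is an open condition within the
span of the face. -/
theorem mem_intrinsicInterior_face {j : Fin 4} {x : E3} (hj : b.coord j x = 0)
    (h : ∀ k, k ≠ j → 0 < b.coord k x) : x ∈ intrinsicInterior ℝ (convexHull ℝ (b '' {j}ᶜ)) := by
  have h0 : ∀ k, 0 ≤ b.coord k x := fun k => by
    by_cases hk : k = j
    · rw [hk, hj]
    · exact (h k hk).le
  have hx : x ∈ convexHull ℝ (b '' {j}ᶜ) := mem_convexHull_image b h0 fun k hk => by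
    have : k = j := by simpa using hk
    rw [this, hj]
  rw [mem_intrinsicInterior]
  have hxs : x ∈ affineSpan ℝ (convexHull ℝ (b '' {j}ᶜ)) := subset_affineSpan ℝ _ hx
  refine ⟨⟨x, hxs⟩, ?_, rfl⟩
  rw [mem_interior]
  refine ⟨{y | ∀ k, k ≠ j → 0 < b.coord k (y : E3)}, ?_, ?_, h⟩
  · rintro ⟨y, hy⟩ hyk
    rw [affineSpan_convexHull] at hy
    have hyj := coord_eq_zero_of_mem_affineSpan b hy
    refine mem_convexHull_image b (fun k => ?_) fun k hk => ?_
    · by_cases hk : k = j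
      · rw [hk, hyj]
      · exact (hyk k hk).le
    · have : k = j := by simpa using hk
      rw [this, hyj]
  · simp only [ofPred_forall]
    refine isOpen_iInter_of_finite fun k => isOpen_iInter_of_finite fun _ => ?_
    have hc : Continuous fun y : affineSpan ℝ (convexHull ℝ (b '' {j}ᶜ)) => b.coord k (y : E3) :=
      (AffineMap.continuous_of_finiteDimensional (b.coord k)).comp continuous_subtype_val
    exact isOpen_lt continuous_const hc

/-- Two vertices of a simplex are at least as far apart as the radius of any inscribed ball. -/
theorem le_dist_vertex {x : E3} {r : ℝ} (hr : Metric.ball x r ⊆ convexHull ℝ (range b))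
    {a c : Fin 4} (hac : a ≠ c) : r ≤ dist (b a) (b c) := by
  by_contra! hlt
  have hpos : 0 < dist (b a) (b c) := dist_pos.2 fun h => hac (b.ind.injective h)
  obtain ⟨r', h1, h2⟩ := exists_between hlt
  have hx : x ∈ Metric.ball x r := Metric.mem_ball_self (hpos.trans hlt)
  -- A displacement by `r' > |ac|` parallel to the edge stays in the inscribed ball, but raises the
  -- coordinate of `a` by more than 1, which no two points of the simplex allow.
  have hy : x + (r' / dist (b a) (b c)) • (b a - b c) ∈ Metric.ball x r := by
    rw [mem_ball_iff_norm, add_sub_cancel_left, norm_smul, ← dist_eq_norm, Real.norm_eq_abs,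
      abs_of_pos (div_pos (hpos.trans h1) hpos), div_mul_cancel₀ _ hpos.ne']
    exact h2
  have h3 := (mem_convexHull_iff_coord b).1 (hr hx)
  have h4 := (mem_convexHull_iff_coord b).1 (hr hy)
  have h5 := b.sum_coord_apply_eq_one (x + (r' / dist (b a) (b c)) • (b a - b c))
  have h6 : b.coord a (x + (r' / dist (b a) (b c)) • (b a - b c)) ≤ 1 := by
    rw [← h5]; exact Finset.single_le_sum (fun i _ => h4 i) (Finset.mem_univ a)
  rw [coord_add, map_smul, coord_linear_sub, if_pos rfl, if_neg hac, smul_eq_mul] at h6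
  have := h3 a
  have h7 : 1 < r' / dist (b a) (b c) := by rwa [one_lt_div hpos]
  linarith

/-- Two distinct barycentric coordinates are linearly independent, so they vanish together at most
on a line; the plane of a mesh face cannot fit in it. -/
theorem finrank_ker_coord_inf_le {c d : Fin 4} (hcd : c ≠ d) :
    Module.finrank ℝ (LinearMap.ker ((dcoord b c).prod (dcoord b d))) ≤ 1 := by
  obtain ⟨e, he1, he2⟩ : ∃ e : Fin 4, e ≠ c ∧ e ≠ d := by
    revert c d; decide
  have hs : Function.Surjective ((dcoord b c).prod (dcoord b d)) := by
    rintro ⟨u, v⟩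
    refine ⟨u • (b c - b e) + v • (b d - b e), ?_⟩
    simp [coord_linear_sub, hcd, hcd.symm, he1.symm, he2.symm]
  have h1 := LinearMap.finrank_range_add_finrank_ker ((dcoord b c).prod (dcoord b d))
  rw [LinearMap.range_eq_top.2 hs, finrank_top] at h1
  have h2 : Module.finrank ℝ (ℝ × ℝ) = 2 := by simp
  have h3 : Module.finrank ℝ E3 = 3 := by simp
  omega

/-- If the plane `A` contains an open subset of the `j`-th face of a simplex, then the `j`-th
coordinate vanishes on the directions of `A`. -/
theorem coord_linear_eq_zero {A : AffineSubspace ℝ E3} (hA : Module.finrank ℝ A.direction = 2)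
    {j : Fin 4} (h : ∀ x, b.coord j x = 0 → (∀ k, k ≠ j → 0 < b.coord k x) → x ∈ A)
    {u : E3} (hu : u ∈ A.direction) : dcoord b j u = 0 := by
  obtain ⟨c, d, e, hc, hd, he, hcd, hce, hde, hall⟩ : ∃ c d e : Fin 4, c ≠ j ∧ d ≠ j ∧ e ≠ j ∧
      c ≠ d ∧ c ≠ e ∧ d ≠ e ∧ ∀ k, k = j ∨ k = c ∨ k = d ∨ k = e := by
    clear h; revert j; decide
  -- The centroid of the face. Parameters of size at most `1/12` move its three coordinates `1/3` by
  -- at most `1/6`, so they stay positive.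
  let x : E3 := b e + (1/3 : ℝ) • (b c - b e) + (1/3 : ℝ) • (b d - b e)
  have key : ∀ α β : ℝ, |α| ≤ 1/12 → |β| ≤ 1/12 → x + (α • (b c - b e) + β • (b d - b e)) ∈ A := by
    intro α β hα hβ
    rw [abs_le] at hα hβ
    refine h _ ?_ fun k hk => ?_
    · simp [x, coord_add, coord_linear_sub, hc.symm, hd.symm, he.symm]
    · rcases hall k with rfl | rfl | rfl | rfl
      · exact absurd rfl hk
      all_goals simp [x, coord_add, coord_linear_sub, hcd, hce, hde, hcd.symm,
        hce.symm, hde.symm]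
      all_goals linarith
  have hx : x ∈ A := by simpa using key 0 0 (by norm_num) (by norm_num)
  have hmem : ∀ v, x + (1/12 : ℝ) • v ∈ A → v ∈ A.direction := fun v hv => by
    have := A.vsub_mem_direction hv hx
    rw [vsub_eq_sub, add_sub_cancel_left] at this
    have := A.direction.smul_mem 12 this
    rwa [smul_smul, show (12 : ℝ) * (1/12) = 1 by norm_num, one_smul] at this
  have h1 : b c - b e ∈ A.direction := hmem _ (by
    simpa using key (1/12) 0 (by norm_num [abs_of_pos]) (by norm_num))
  have h2 : b d - b e ∈ A.direction := hmem _ (by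
    simpa using key 0 (1/12) (by norm_num) (by norm_num [abs_of_pos]))
  let f : (Fin 2 → ℝ) →ₗ[ℝ] A.direction :=
    Fintype.linearCombination ℝ ![⟨_, h1⟩, ⟨_, h2⟩]
  have hf : ∀ g, (f g : E3) = g 0 • (b c - b e) + g 1 • (b d - b e) := fun g => by
    simp [f, Fintype.linearCombination_apply]
  have hinj : Function.Injective f := by
    rw [← LinearMap.ker_eq_bot, LinearMap.ker_eq_bot']
    intro g hg
    have h3 : (f g : E3) = 0 := by rw [hg]; rfl
    rw [hf] at h3
    have e1 := congrArg (dcoord b c) h3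
    have e2 := congrArg (dcoord b d) h3
    simp [coord_linear_sub, hcd, hcd.symm, hce, hde] at e1 e2
    funext i
    fin_cases i <;> simp [e1, e2]
  have hsurj := (LinearMap.injective_iff_surjective_of_finrank_eq_finrank
    (show Module.finrank ℝ (Fin 2 → ℝ) = Module.finrank ℝ A.direction by simp [hA])).1 hinj
  obtain ⟨g, hg⟩ := hsurj ⟨u, hu⟩
  have : u = g 0 • (b c - b e) + g 1 • (b d - b e) := by rw [← hf, hg]
  rw [this]
  simp [coord_linear_sub, hc.symm, hd.symm, he.symm]

/-- A face of a simplex contains a disc of the same radius as a ball inscribed in the simplex. -/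
theorem exists_disc_in_face {x : E3} {r : ℝ} (hr0 : 0 < r)
    (hr : Metric.ball x r ⊆ convexHull ℝ (range b)) (j : Fin 4) :
    ∃ y, ∀ u : E3, dcoord b j u = 0 → ‖u‖ < r →
      b.coord j (y + u) = 0 ∧ ∀ k, k ≠ j → 0 < b.coord k (y + u) := by
  have hint : ∀ z ∈ Metric.ball x r, ∀ k, 0 < b.coord k z := fun z hz =>
    (mem_interior_iff_coord b).1 (interior_maximal hr Metric.isOpen_ball hz)
  have hx := hint x (Metric.mem_ball_self hr0)
  set s := b.coord j x with hs
  have hs1 : s < 1 := by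
    obtain ⟨c, hc⟩ : ∃ c : Fin 4, c ≠ j := ⟨j + 1, by simp⟩
    have h5 := b.sum_coord_apply_eq_one x
    have h7 : b.coord j x + b.coord c x ≤ ∑ i, b.coord i x := by
      rw [← Finset.sum_pair (f := fun i => b.coord i x) hc.symm]
      exact Finset.sum_le_sum_of_subset_of_nonneg (Finset.subset_univ _) fun i _ _ => (hx i).le
    linarith [hx c]
  have hs0 := hx j
  have h1s : 0 < 1 - s := by linarith
  have hlin : ∀ k, dcoord b k (x - b j) = b.coord k x - (if k = j then 1 else 0) := fun k => by
    have := (b.coord k).linearMap_vsub x (b j)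
    simp only [vsub_eq_sub] at this
    rw [dcoord, this, b.coord_apply]
  -- Projection from the vertex `b j` carries the parallel section of the inscribed ball through `x`
  -- to the opposite face. It is a dilation of ratio `(1 - s)⁻¹ > 1`, so the radius does not
  -- decrease.
  refine ⟨b j + (1 - s)⁻¹ • (x - b j), fun u hu hur => ⟨?_, fun k hk => ?_⟩⟩
  · rw [coord_add, coord_add, hu, map_smul, hlin, coord_vertex, if_pos rfl, ← hs, smul_eq_mul]
    field_simp; ring
  · have hz : x + (1 - s) • u ∈ Metric.ball x r := by
      rw [mem_ball_iff_norm, add_sub_cancel_left, norm_smul, Real.norm_eq_abs, abs_of_pos h1s]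
      nlinarith [norm_nonneg u]
    have := hint _ hz k
    rw [coord_add, map_smul, smul_eq_mul] at this
    rw [coord_add, coord_add, map_smul, hlin, coord_vertex, if_neg hk, smul_eq_mul]
    have h2 : 0 + (1 - s)⁻¹ * (b.coord k x - 0) + dcoord b k u
        = (1 - s)⁻¹ * (b.coord k x + (1 - s) * dcoord b k u) := by
      field_simp; ring
    rw [h2]; positivity

end Basis

/-! ### Generic points and volume counting -/

/-- A nonempty relatively open subset of an affine subspace is not covered by finitely many
affine subspaces that do not contain it. -/
theorem exists_mem_forall_notMem {ι : Type*} [Finite ι] (A : AffineSubspace ℝ E3)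
    (B : ι → AffineSubspace ℝ E3) (hB : ∀ i, ¬ A ≤ B i) {V : Set E3} (hV : IsOpen V)
    (hne : (V ∩ A).Nonempty) : ∃ x ∈ V ∩ A, ∀ i, x ∉ B i := by
  obtain ⟨x₀, hx₀V, hx₀⟩ := hne
  let f : A.direction →ᵃ[ℝ] E3 := A.direction.subtype.toAffineMap + AffineMap.const ℝ _ x₀
  have hf : ∀ v : A.direction, f v = (v : E3) + x₀ := fun v => rfl
  have hfc : Continuous f := by
    have : (f : A.direction → E3) = fun v : A.direction => (v : E3) + x₀ := funext hf
    rw [this]; fun_prop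
  have hfA : ∀ v, f v ∈ A := fun v => by
    rw [hf]; exact AffineSubspace.vadd_mem_of_mem_direction v.2 hx₀
  -- Each intersection with `B i` is a proper affine subspace of the plane, hence Lebesgue null; an
  -- open set has positive measure.
  have hnull : volume (⋃ i, ((B i).comap f : Set A.direction)) = 0 := by
    rw [measure_iUnion_null_iff]
    refine fun i => Measure.addHaar_affineSubspace _ _ fun htop => hB i fun x hx => ?_
    have : (⟨x - x₀, A.vsub_mem_direction hx hx₀⟩ : A.direction) ∈ (B i).comap f := by
      rw [htop]; trivial
    rw [AffineSubspace.mem_comap, hf] at this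
    simpa using this
  have hopen : IsOpen (f ⁻¹' V) := hV.preimage hfc
  have hpos : 0 < volume (f ⁻¹' V) :=
    hopen.measure_pos _ ⟨0, by change f 0 ∈ V; rw [hf]; simpa using hx₀V⟩
  obtain ⟨v, hv1, hv2⟩ : ∃ v ∈ f ⁻¹' V, v ∉ ⋃ i, ((B i).comap f : Set A.direction) := by
    by_contra! hcon
    exact hpos.ne' (measure_mono_null hcon hnull)
  refine ⟨f v, ⟨hv1, hfA v⟩, fun i hi => hv2 (mem_iUnion.2 ⟨i, hi⟩)⟩

/-- Disjoint balls of radius `r` are packed in a ball of radius `R`: the volumes are compared and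
the volume of the unit ball cancels. -/
theorem card_mul_le_of_disjoint {ι : Type*} (S : Finset ι) (X : ι → Set E3) (c : ι → E3) {x : E3}
    {r R : ℝ} (hr : 0 ≤ r) (hR : 0 ≤ R) (hX : ∀ i ∈ S, Metric.ball (c i) r ⊆ X i)
    (hd : ∀ i ∈ S, ∀ j ∈ S, i ≠ j → Disjoint (X i) (X j))
    (hsub : ∀ i ∈ S, X i ⊆ Metric.closedBall x R) : (S.card : ℝ) * r ^ 3 ≤ R ^ 3 := by
  have h1 : volume (⋃ i ∈ S, Metric.ball (c i) r) ≤ volume (Metric.closedBall x R) :=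
    measure_mono (iUnion₂_subset fun i hi => (hX i hi).trans (hsub i hi))
  rw [measure_biUnion_finset (fun i hi j hj hij =>
      (hd i hi j hj hij).mono (hX i hi) (hX j hj)) (fun i _ => measurableSet_ball)] at h1
  simp only [Measure.addHaar_ball _ _ hr, Measure.addHaar_closedBall _ _ hR, finrank_euclideanSpace_fin,
    Finset.sum_const, nsmul_eq_mul] at h1
  have hb0 : volume (Metric.ball (0 : E3) 1) ≠ 0 := (Metric.measure_ball_pos _ _ one_pos).ne'
  have hbt : volume (Metric.ball (0 : E3) 1) ≠ ⊤ := measure_ball_lt_top.ne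
  rw [← mul_assoc, ENNReal.mul_le_mul_iff_left hb0 hbt] at h1
  have h2 : ENNReal.ofReal ((S.card : ℝ) * r ^ 3) ≤ ENNReal.ofReal (R ^ 3) := by
    rw [ENNReal.ofReal_mul (by positivity), ENNReal.ofReal_natCast]; exact h1
  exact (ENNReal.ofReal_le_ofReal_iff (by positivity)).1 h2

/-! ### Geometry of regular meshes -/

namespace PolyMesh
variable {Ω : Set E3} (M : PolyMesh Ω)

theorem isOpen_elem (T : Fin M.nT) : IsOpen (M.elem T) := by
  obtain ⟨U, hU, h⟩ := (M.elem_polytope T).relOpen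
  rw [h]; simpa using hU

theorem elem_nonempty (T : Fin M.nT) : (M.elem T).Nonempty :=
  (M.elem_polytope T).simplyConnected.nonempty

theorem face_nonempty (F : Fin M.nF) : (M.face F).Nonempty := by
  obtain ⟨A, -, hA⟩ := M.face_polytope F
  exact hA.simplyConnected.nonempty

theorem exists_plane (F : Fin M.nF) : ∃ (A : AffineSubspace ℝ E3) (U : Set E3),
    A.direction = (ℝ ∙ M.normal F)ᗮ ∧ Module.finrank ℝ A.direction = 2 ∧ IsOpen U ∧
      M.face F = U ∩ A := by
  obtain ⟨A, hd, hA⟩ := M.face_polytope F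
  obtain ⟨U, hU, h⟩ := hA.relOpen
  exact ⟨A, U, hd, hA.finrank_eq, hU, h⟩

variable {M}

theorem mem_facesOf {T : Fin M.nT} {F : Fin M.nF} :
    F ∈ M.facesOf T ↔ M.face F ⊆ frontier (M.elem T) := by
  simp [facesOf]

theorem mem_edgesOf {F : Fin M.nF} {E : Fin M.nE} :
    E ∈ M.edgesOf F ↔ M.edge E ⊆ closure (M.face F) \ M.face F := by
  simp [edgesOf]

theorem mem_elemEdges {T : Fin M.nT} {E : Fin M.nE} :
    E ∈ M.elemEdges T ↔ ∃ F ∈ M.facesOf T, E ∈ M.edgesOf F := by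
  simp [elemEdges]

theorem len_pos (E : Fin M.nE) : 0 < M.len E := dist_pos.2 (M.src_ne_tgt E)

theorem isClosed_simplex (s : Fin 4 → E3) : IsClosed (convexHull ℝ (range s)) :=
  (finite_range s).isClosed_convexHull _

/-! ### Simplices of the submesh against elements and faces -/

namespace IsMatchingSubmesh
variable {m : ℕ} {s : Fin m → Fin 4 → E3} (hs : M.IsMatchingSubmesh s)
include hs

/-- The barycentric basis of a simplex of the submesh. -/
noncomputable def basis (i : Fin m) : AffineBasis (Fin 4) ℝ E3 := simplexBasis (hs.indep i)

theorem interior_nonempty (i : Fin m) : (interior (convexHull ℝ (range (s i)))).Nonempty :=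
  ⟨_, (hs.basis i).centroid_mem_interior_convexHull⟩

theorem closure_interior (i : Fin m) :
    closure (interior (convexHull ℝ (range (s i)))) = convexHull ℝ (range (s i)) := by
  rw [(convex_convexHull ℝ _).closure_interior_eq_closure_of_nonempty_interior
    (hs.interior_nonempty i), (isClosed_simplex (s i)).closure_eq]

/-- A simplex is the closure of its interior. If that interior lies in another element, it misses
the open set `T`, hence so does the simplex. Thus `T` is covered by its own simplices, a finite
closed union, which contains the closure as well. -/
theorem exists_simplex_of_mem_closure {T : Fin M.nT} {x : E3} (hx : x ∈ closure (M.elem T)) :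
    ∃ i, interior (convexHull ℝ (range (s i))) ⊆ M.elem T ∧ x ∈ convexHull ℝ (range (s i)) := by
  have hsub : M.elem T ⊆ ⋃ i ∈ {i | interior (convexHull ℝ (range (s i))) ⊆ M.elem T},
      convexHull ℝ (range (s i)) := by
    intro y hy
    have h1 : y ∈ closure Ω := subset_closure (M.elem_subset T hy)
    rw [hs.cover] at h1
    obtain ⟨i, hi⟩ := mem_iUnion.1 h1
    obtain ⟨T', hT'⟩ := hs.elem i
    refine mem_biUnion (x := i) ?_ hi
    by_cases hTT : T' = T
    · exact hTT ▸ hT'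
    · rw [← hs.closure_interior i] at hi
      obtain ⟨z, hz1, hz2⟩ := mem_closure_iff.1 hi _ (M.isOpen_elem T) hy
      exact absurd hz1 (disjoint_left.1 (M.elem_disjoint T' T hTT) (hT' hz2))
  have hclosed : IsClosed (⋃ i ∈ {i | interior (convexHull ℝ (range (s i))) ⊆ M.elem T},
      convexHull ℝ (range (s i))) :=
    (Set.toFinite _).isClosed_biUnion fun i _ => isClosed_simplex (s i)
  simpa using closure_minimal hsub hclosed hx

/-- Points of a face in general position lie in open simplicial faces. -/
theorem exists_generic {T : Fin M.nT} {F : Fin M.nF} (hF : F ∈ M.facesOf T) {V : Set E3}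
    (hV : IsOpen V) (hne : (V ∩ M.face F).Nonempty) :
    ∃ x ∈ V ∩ M.face F, ∃ i, interior (convexHull ℝ (range (s i))) ⊆ M.elem T ∧
      ∃ j, (hs.basis i).coord j x = 0 ∧ ∀ k, k ≠ j → 0 < (hs.basis i).coord k x := by
  obtain ⟨A, U, hd, hr, hU, hUA⟩ := M.exists_plane F
  -- `B q` is the set where two given coordinates of one simplex vanish. A point of the face outside
  -- all of them has at most one zero coordinate in any simplex.
  let B : {q : Fin m × Fin 4 × Fin 4 // q.2.1 ≠ q.2.2} → AffineSubspace ℝ E3 := fun q =>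
    (AffineSubspace.mk' (0 : ℝ) ⊥).comap ((hs.basis q.1.1).coord q.1.2.1) ⊓
      (AffineSubspace.mk' (0 : ℝ) ⊥).comap ((hs.basis q.1.1).coord q.1.2.2)
  have hB : ∀ q x, x ∈ B q ↔ (hs.basis q.1.1).coord q.1.2.1 x = 0 ∧
      (hs.basis q.1.1).coord q.1.2.2 x = 0 := fun q x => by
    simp [B, AffineSubspace.mem_mk', AffineSubspace.mem_inf_iff]
  have hBA : ∀ q, ¬ A ≤ B q := by
    intro q hle
    obtain ⟨x₀, hx₀⟩ := M.face_nonempty F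
    have hx₀A : x₀ ∈ A := by rw [hUA] at hx₀; exact hx₀.2
    have h1 : A.direction ≤ LinearMap.ker ((dcoord (hs.basis q.1.1) q.1.2.1).prod
        (dcoord (hs.basis q.1.1) q.1.2.2)) := by
      intro u hu
      have h2 : x₀ + u ∈ A := by
        rw [add_comm]; exact AffineSubspace.vadd_mem_of_mem_direction hu hx₀A
      have h3 := (hB q _).1 (hle h2)
      have h4 := (hB q _).1 (hle hx₀A)
      rw [coord_add, coord_add, h4.1, h4.2, zero_add, zero_add] at h3
      rw [LinearMap.mem_ker, LinearMap.prod_apply]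
      exact Prod.ext h3.1 h3.2
    have h2 := Submodule.finrank_mono h1
    have h3 := finrank_ker_coord_inf_le (hs.basis q.1.1) q.2
    omega
  have hne' : ((V ∩ U) ∩ (A : Set E3)).Nonempty := by rwa [inter_assoc, ← hUA]
  obtain ⟨x, hx, hxB⟩ := exists_mem_forall_notMem A B hBA (hV.inter hU) hne'
  have hxF : x ∈ M.face F := by rw [hUA]; exact ⟨hx.1.2, hx.2⟩
  refine ⟨x, ⟨hx.1.1, hxF⟩, ?_⟩
  have hfr := mem_facesOf.1 hF hxF
  obtain ⟨i, hi, hxi⟩ := hs.exists_simplex_of_mem_closure (frontier_subset_closure hfr)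
  have h0 := (mem_convexHull_iff_coord (hs.basis i)).1 hxi
  have hnot : x ∉ interior (convexHull ℝ (range (s i))) := fun h => by
    have := hi h
    rw [(M.isOpen_elem T).frontier_eq] at hfr
    exact hfr.2 this
  -- A boundary point of `T` cannot be interior to a simplex of `T`, so some coordinate is zero;
  -- genericity makes it the only one.
  have h1 : ¬ ∀ j, 0 < (hs.basis i).coord j x := fun h =>
    hnot ((mem_interior_iff_coord (hs.basis i)).2 h)
  push Not at h1
  obtain ⟨j, hj⟩ := h1
  have hj0 := le_antisymm hj (h0 j)
  refine ⟨i, hi, j, hj0, fun k hk => lt_of_le_of_ne (h0 k) fun h => ?_⟩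
  exact hxB ⟨(i, j, k), hk.symm⟩ ((hB _ _).2 ⟨hj0, h.symm⟩)

theorem open_face_subset {F : Fin M.nF} {i : Fin m} {j : Fin 4} {x : E3} (hx : x ∈ M.face F)
    (hj : (hs.basis i).coord j x = 0) (h : ∀ k, k ≠ j → 0 < (hs.basis i).coord k x) {y : E3}
    (hyj : (hs.basis i).coord j y = 0) (hy : ∀ k, k ≠ j → 0 < (hs.basis i).coord k y) :
    y ∈ M.face F := by
  have h1 := mem_intrinsicInterior_face (hs.basis i) hj h
  have h2 := mem_intrinsicInterior_face (hs.basis i) hyj hy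
  rcases hs.face i j F with h3 | h3
  · exact absurd hx (disjoint_left.1 h3 h1)
  · exact h3 h2

/-- Generic points are dense in the face, and the closed simplicial faces whose open part lies in it
form a finite closed union, which therefore contains the whole closure of the face. -/
theorem exists_simplicial_face {T : Fin M.nT} {F : Fin M.nF} (hF : F ∈ M.facesOf T) {x : E3}
    (hx : x ∈ closure (M.face F)) : ∃ i, interior (convexHull ℝ (range (s i))) ⊆ M.elem T ∧
      ∃ j, (∀ y, (hs.basis i).coord j y = 0 → (∀ k, k ≠ j → 0 < (hs.basis i).coord k y) →
        y ∈ M.face F) ∧ (hs.basis i).coord j x = 0 ∧ ∀ k, 0 ≤ (hs.basis i).coord k x := by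
  let I : Set (Fin m × Fin 4) := {q | interior (convexHull ℝ (range (s q.1))) ⊆ M.elem T ∧
    ∀ y, (hs.basis q.1).coord q.2 y = 0 → (∀ k, k ≠ q.2 → 0 < (hs.basis q.1).coord k y) →
        y ∈ M.face F}
  let K : Fin m × Fin 4 → Set E3 := fun q =>
    {y | (hs.basis q.1).coord q.2 y = 0} ∩ convexHull ℝ (range (s q.1))
  have hK : IsClosed (⋃ q ∈ I, K q) := by
    refine (Set.toFinite I).isClosed_biUnion fun q _ => ?_
    refine IsClosed.inter ?_ (isClosed_simplex (s q.1))
    exact isClosed_eq (AffineMap.continuous_of_finiteDimensional _) continuous_const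
  have hsub : M.face F ⊆ closure (⋃ q ∈ I, K q) := by
    intro y hy
    rw [mem_closure_iff]
    intro V hV hyV
    obtain ⟨z, hz, i, hi, j, hj, hk⟩ := hs.exists_generic hF hV ⟨y, hyV, hy⟩
    refine ⟨z, hz.1, mem_biUnion (x := (i, j)) ⟨hi, fun w hw hw' =>
      hs.open_face_subset hz.2 hj hk hw hw'⟩ ⟨hj, ?_⟩⟩
    refine (mem_convexHull_iff_coord (hs.basis i)).2 fun k => ?_
    by_cases h : k = j
    · rw [h, hj]
    · exact (hk k h).le
  have h2 := closure_minimal hsub isClosed_closure hx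
  rw [hK.closure_eq] at h2
  simp only [mem_iUnion] at h2
  obtain ⟨⟨i, j⟩, hI, hKx⟩ := h2
  exact ⟨i, hI.1, j, hI.2, hKx.1, (mem_convexHull_iff_coord (hs.basis i)).1 hKx.2⟩

/-- By the matching property `p` lies in the hull of the common vertices; being itself a vertex of
the simplex `l`, it must be one of them. -/
theorem mem_range_of_mem_simplex {i l : Fin m} {p : E3} (hl : p ∈ range (s l))
    (hi : p ∈ convexHull ℝ (range (s i))) : p ∈ range (s i) := by
  have h1 : p ∈ convexHull ℝ (range (s i) ∩ range (s l)) := by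
    rw [← hs.matching i l]
    exact ⟨hi, subset_convexHull ℝ _ hl⟩
  obtain ⟨a, rfl⟩ := hl
  have h2 : range (s i) ∩ range (s l) = s l '' (s l ⁻¹' range (s i)) := by
    rw [image_preimage_eq_inter_range]
  rw [h2] at h1
  exact mem_of_vertex_mem_convexHull (hs.basis l) h1

theorem notMem_openSegment {i : Fin m} {a c : Fin 4} {p : E3} (hp : ∃ l, p ∈ range (s l)) :
    p ∉ openSegment ℝ (s i a) (s i c) ∨ a = c := by
  by_cases hac : a = c
  · exact Or.inr hac
  refine Or.inl fun hpo => ?_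
  obtain ⟨l, hl⟩ := hp
  have hseg : p ∈ convexHull ℝ (s i '' {a, c}) := by
    rw [image_pair, convexHull_pair]; exact openSegment_subset_segment _ _ _ hpo
  have h1 := hs.mem_range_of_mem_simplex hl (convexHull_mono (image_subset_range _ _) hseg)
  obtain ⟨e, rfl⟩ := h1
  have he := mem_of_vertex_mem_convexHull (hs.basis i) hseg
  have hne : s i a ≠ s i c := fun h => hac ((hs.indep i).injective h)
  rcases he with rfl | rfl
  · exact hne (left_mem_openSegment_iff.1 hpo)
  · exact hne (right_mem_openSegment_iff.1 hpo)

end IsMatchingSubmesh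

/-- The two segments lie on one line and overlap. By connectedness `(a, c)` could leave `(p, q)`
only through `p` or `q`, which it avoids. -/
theorem openSegment_subset_of_notMem {p q a c x y : E3} (hxy : x ≠ y)
    (hx : x ∈ openSegment ℝ p q) (hy : y ∈ openSegment ℝ p q) (hxa : x ∈ segment ℝ a c)
    (hya : y ∈ segment ℝ a c) (hp : p ∉ openSegment ℝ a c) (hq : q ∉ openSegment ℝ a c) :
    openSegment ℝ a c ⊆ openSegment ℝ p q := by
  intro z hz
  rw [openSegment_eq_image_lineMap] at hx hy hz hp hq ⊢
  rw [segment_eq_image_lineMap] at hxa hya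
  obtain ⟨x', hx', hxe⟩ := hx
  obtain ⟨y', hy', hye⟩ := hy
  obtain ⟨x₁, hx₁, hxe₁⟩ := hxa
  obtain ⟨y₁, hy₁, hye₁⟩ := hya
  obtain ⟨t, ht, rfl⟩ := hz
  have hne1 : x₁ ≠ y₁ := by rintro rfl; exact hxy (hxe₁.symm.trans hye₁)
  have hd : x₁ - y₁ ≠ 0 := sub_ne_zero.2 hne1
  -- the affine change of parameters from `[a, c]` to the line `pq`
  set β := (x' - y') / (x₁ - y₁) with hβ
  have hne' : x' ≠ y' := by rintro rfl; exact hxy (hxe.symm.trans hye)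
  have hβ0 : β ≠ 0 := div_ne_zero (sub_ne_zero.2 hne') hd
  have hpar : ∀ r : ℝ, AffineMap.lineMap a c r = AffineMap.lineMap p q (x' + β * (r - x₁)) := by
    intro r
    have e1 : x' = x' + β * (x₁ - x₁) := by ring
    have e2 : y' = x' + β * (y₁ - x₁) := by rw [hβ]; field_simp; ring
    have e3 : (AffineMap.lineMap a c r : E3) = AffineMap.lineMap (AffineMap.lineMap a c x₁)
        (AffineMap.lineMap a c y₁) ((r - x₁) / (y₁ - x₁)) := by
      have h0 : y₁ - x₁ ≠ 0 := sub_ne_zero.2 hne1.symm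
      rw [← AffineMap.apply_lineMap (AffineMap.lineMap a c : ℝ →ᵃ[ℝ] E3)]
      congr 1
      rw [AffineMap.lineMap_apply_ring']; field_simp; ring
    have e4 : (AffineMap.lineMap p q (x' + β * (r - x₁)) : E3)
        = AffineMap.lineMap (AffineMap.lineMap p q x')
        (AffineMap.lineMap p q y') ((r - x₁) / (y₁ - x₁)) := by
      have h0 : y₁ - x₁ ≠ 0 := sub_ne_zero.2 hne1.symm
      rw [← AffineMap.apply_lineMap (AffineMap.lineMap p q : ℝ →ᵃ[ℝ] E3)]
      congr 1
      rw [AffineMap.lineMap_apply_ring']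
      conv_rhs => rw [e2]
      field_simp; ring
    rw [e3, e4, hxe₁, hye₁, hxe, hye]
  refine ⟨x' + β * (t - x₁), ?_, (hpar t).symm⟩
  set g : ℝ → ℝ := fun r => x' + β * (r - x₁) with hg
  have hord := (isPreconnected_Ioo.image (s := Ioo (0 : ℝ) 1) g
    (by rw [hg]; fun_prop)).ordConnected
  -- `x` and `y` may be end points of `[a, c]`. Their midpoint is interior to both segments and
  -- serves as starting point for the intermediate value argument.
  have hmid : (x₁ + y₁) / 2 ∈ Ioo (0 : ℝ) 1 := by
    rcases lt_or_gt_of_ne hne1 with h | h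
    · exact ⟨by linarith [hx₁.1], by linarith [hy₁.2]⟩
    · exact ⟨by linarith [hy₁.1], by linarith [hx₁.2]⟩
  have hgm : g ((x₁ + y₁) / 2) = (x' + y') / 2 := by
    simp only [hg]; rw [hβ]; field_simp; ring
  by_contra hcon
  rw [mem_Ioo, not_and_or, not_lt, not_lt] at hcon
  rcases hcon with h | h
  · obtain ⟨r, hr, hr0⟩ := hord.out ⟨t, ht, rfl⟩ ⟨_, hmid, rfl⟩
      (⟨h, by rw [hgm]; linarith [hx'.1, hy'.1]⟩ : (0 : ℝ) ∈ Icc (g t) (g ((x₁ + y₁) / 2)))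
    exact hp ⟨r, hr, by rw [hpar]; change AffineMap.lineMap p q (g r) = p; rw [hr0]; simp⟩
  · obtain ⟨r, hr, hr0⟩ := hord.out ⟨_, hmid, rfl⟩ ⟨t, ht, rfl⟩
      (⟨by rw [hgm]; linarith [hx'.2, hy'.2], h⟩ : (1 : ℝ) ∈ Icc (g ((x₁ + y₁) / 2)) (g t))
    exact hq ⟨r, hr, by rw [hpar]; change AffineMap.lineMap p q (g r) = q; rw [hr0]; simp⟩

theorem infinite_edge (E : Fin M.nE) : (M.edge E).Infinite := by
  rw [edge, openSegment_eq_image_lineMap]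
  exact (Ioo_infinite one_pos).image (AffineMap.lineMap_injective ℝ (M.src_ne_tgt E)).injOn

/-! ### Simplicial edges inside mesh edges, disjointness of simplices -/

namespace IsMatchingSubmesh
variable {m : ℕ} {s : Fin m → Fin 4 → E3} (hs : M.IsMatchingSubmesh s)
include hs

/-- A point of the mesh edge lies in a closed simplicial face but not in the open one, which is part
of `F`; so it lies on one of finitely many simplicial edges. By the pigeonhole principle two points
share such an edge, and no mesh vertex being inside it, it is contained in the mesh edge. -/
theorem exists_simplicial_edge {T : Fin M.nT} {F : Fin M.nF} (hF : F ∈ M.facesOf T)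
    {E : Fin M.nE} (hE : E ∈ M.edgesOf F) : ∃ i a c, a ≠ c ∧
      interior (convexHull ℝ (range (s i))) ⊆ M.elem T ∧
      openSegment ℝ (s i a) (s i c) ⊆ M.edge E := by
  have h1 : ∀ x : M.edge E, ∃ q : Fin m × Fin 4 × Fin 4, q.2.1 ≠ q.2.2 ∧
      interior (convexHull ℝ (range (s q.1))) ⊆ M.elem T ∧
      (x : E3) ∈ segment ℝ (s q.1 q.2.1) (s q.1 q.2.2) := by
    rintro ⟨x, hx⟩
    have hx' := mem_edgesOf.1 hE hx
    obtain ⟨i, hi, j, hj, hj0, h0⟩ := hs.exists_simplicial_face hF hx'.1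
    have h2 : ∃ k, k ≠ j ∧ (hs.basis i).coord k x = 0 := by
      by_contra! hcon
      exact hx'.2 (hj x hj0 fun k hk => lt_of_le_of_ne (h0 k) (hcon k hk).symm)
    obtain ⟨k, hkj, hk⟩ := h2
    obtain ⟨a, c, hac, hall⟩ : ∃ a c : Fin 4, a ≠ c ∧ ∀ e, e ∉ ({a, c} : Set (Fin 4)) →
        e = j ∨ e = k := by
      clear hj hj0 h0 hk
      simp only [mem_insert_iff, mem_singleton_iff]
      revert j k; decide
    refine ⟨(i, a, c), hac, hi, ?_⟩
    have h3 := mem_convexHull_image (hs.basis i) (S := {a, c}) h0 fun e he => by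
      rcases hall e he with rfl | rfl
      · exact hj0
      · exact hk
    rwa [image_pair, convexHull_pair] at h3
  choose f hf using h1
  have := (infinite_edge E).to_subtype
  obtain ⟨x, y, hxy, hfxy⟩ := Finite.exists_ne_map_eq_of_infinite f
  refine ⟨(f x).1, (f x).2.1, (f x).2.2, (hf x).1, (hf x).2.1, ?_⟩
  refine openSegment_subset_of_notMem (fun h => hxy (Subtype.ext h)) x.2 y.2 (hf x).2.2 ?_ ?_ ?_
  · rw [hfxy]; exact (hf y).2.2
  · exact (hs.notMem_openSegment (hs.vertex E).1).resolve_right (hf x).1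
  · exact (hs.notMem_openSegment (hs.vertex E).2).resolve_right (hf x).1

/-- The intersection is the hull of the common vertices. Some vertex of the first simplex is not
common, and its coordinate vanishes on that hull but is positive in the interior. -/
theorem disjoint_interior {i j : Fin m} (hij : i ≠ j) :
    Disjoint (interior (convexHull ℝ (range (s i)))) (interior (convexHull ℝ (range (s j)))) := by
  rw [disjoint_iff_inter_eq_empty, ← interior_inter, hs.matching i j]
  have hk : ∃ k, s i k ∉ range (s j) := by
    by_contra! hcon
    have hsub : range (s i) ⊆ range (s j) := by rintro _ ⟨k, rfl⟩; exact hcon k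
    refine hs.distinct i j hij (Set.eq_of_subset_of_ncard_le hsub ?_ (finite_range _))
    rw [← image_univ, ← image_univ, ncard_image_of_injective _ (hs.indep i).injective,
      ncard_image_of_injective _ (hs.indep j).injective]
  obtain ⟨k, hk⟩ := hk
  by_contra hne
  obtain ⟨x, hx⟩ := nonempty_iff_ne_empty.2 hne
  have h1 : x ∈ interior (convexHull ℝ (range (s i))) :=
    interior_mono (convexHull_mono inter_subset_left) hx
  have h2 := (mem_interior_iff_coord (hs.basis i)).1 h1 k
  have h3 : range (s i) ∩ range (s j) ⊆ hs.basis i '' {k}ᶜ := by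
    rintro _ ⟨⟨l, rfl⟩, hl⟩
    exact ⟨l, fun h => hk (by rw [mem_singleton_iff.1 h] at hl; exact hl), rfl⟩
  have h4 := coord_eq_zero_of_mem_affineSpan (hs.basis i)
    (affineSpan_mono ℝ h3 (convexHull_subset_affineSpan _ (interior_subset hx)))
  linarith

end IsMatchingSubmesh

/-! ### Diameters, inscribed balls and discs, and counting of neighbours -/

theorem isBounded_elem (T : Fin M.nT) : Bornology.IsBounded (M.elem T) :=
  (M.elem_polytope T).isBounded

theorem dist_le_hT {T : Fin M.nT} {x y : E3} (hx : x ∈ closure (M.elem T))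
    (hy : y ∈ closure (M.elem T)) : dist x y ≤ M.hT T := by
  rw [hT, ← Metric.diam_closure]
  exact Metric.dist_le_diam_of_mem (isBounded_elem T).closure hx hy

theorem face_subset_closure {T : Fin M.nT} {F : Fin M.nF} (hF : F ∈ M.facesOf T) :
    M.face F ⊆ closure (M.elem T) := (mem_facesOf.1 hF).trans frontier_subset_closure

theorem segment_subset_closure_face {F : Fin M.nF} {E : Fin M.nE} (hE : E ∈ M.edgesOf F) :
    segment ℝ (M.src E) (M.tgt E) ⊆ closure (M.face F) := by
  rw [← closure_openSegment]
  exact closure_minimal ((mem_edgesOf.1 hE).trans sdiff_subset) isClosed_closure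

theorem segment_subset_closure_elem {T : Fin M.nT} {E : Fin M.nE} (hE : E ∈ M.elemEdges T) :
    segment ℝ (M.src E) (M.tgt E) ⊆ closure (M.elem T) := by
  obtain ⟨F, hF, hE⟩ := mem_elemEdges.1 hE
  exact (segment_subset_closure_face hE).trans
    (closure_minimal (face_subset_closure hF) isClosed_closure)

theorem len_le_hT {T : Fin M.nT} {E : Fin M.nE} (hE : E ∈ M.elemEdges T) : M.len E ≤ M.hT T :=
  dist_le_hT (segment_subset_closure_elem hE (left_mem_segment ℝ _ _))
    (segment_subset_closure_elem hE (right_mem_segment ℝ _ _))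

theorem hF_le_hT {T : Fin M.nT} {F : Fin M.nF} (hF : F ∈ M.facesOf T) : M.hF F ≤ M.hT T := by
  rw [PolyMesh.hF, hT, ← Metric.diam_closure (s := M.elem T)]
  exact Metric.diam_mono (face_subset_closure hF) (isBounded_elem T).closure

theorem hE_eq_len (E : Fin M.nE) : M.hE E = M.len E := by
  rw [hE, edge, len, ← Metric.diam_closure, closure_openSegment, ← convexHull_pair,
    convexHull_diam, Metric.diam_pair]

theorem hF_nonneg (F : Fin M.nF) : 0 ≤ M.hF F := Metric.diam_nonneg

/-- The geometric consequences of regularity, with `κ = ρ²` and a bound `N` on the number of faces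
and edges of an element and of elements around an edge. -/
structure ShapeBound (M : PolyMesh Ω) (κ : ℝ) (N : ℕ) : Prop where
  hT_pos : ∀ T, 0 < M.hT T
  ball : ∀ T, ∃ x, Metric.ball x (κ * M.hT T) ⊆ M.elem T
  disc : ∀ T, ∀ F ∈ M.facesOf T, ∃ A : AffineSubspace ℝ E3, A.direction = (ℝ ∙ M.normal F)ᗮ ∧
    M.face F ⊆ A ∧ ∃ x ∈ A, Metric.ball x (κ * M.hT T) ∩ A ⊆ M.face F
  le_len : ∀ T, ∀ E ∈ M.elemEdges T, κ * M.hT T ≤ M.len E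
  card_faces : ∀ T, (M.facesOf T).card ≤ N
  card_edges : ∀ T, (M.elemEdges T).card ≤ N
  card_elems : ∀ (E : Fin M.nE) (S : Finset (Fin M.nT)), (∀ T ∈ S, E ∈ M.elemEdges T) → S.card ≤ N

/-- The factor `ρ ^ 2` combines inradius at least `ρ h_τ` with `h_τ ≥ ρ h_T`. A simplex of the
submesh lends its inscribed ball to the element, a disc to each mesh face above one of its faces,
and a length to each mesh edge containing one of its edges. -/
theorem IsRegular.exists_shapeBound {ρ : ℝ} (hρ : 0 < ρ) :
    ∃ N, ∀ (M : PolyMesh Ω), M.IsRegular ρ → ShapeBound M (ρ ^ 2) N := by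
  -- An element contains at most `1/(ρ²)³` simplices, each with 4 faces and 16 ordered pairs of
  -- vertices; the second term bounds the number of elements around an edge.
  obtain ⟨N, hN⟩ := exists_nat_ge (16 / (ρ ^ 2) ^ 3 + 1 / (ρ ^ 2 * ρ ^ 2) ^ 3)
  refine ⟨N, fun M hR => ?_⟩
  obtain ⟨m, s, hs, hball, hdiam⟩ := hR
  have hsimp : ∀ T, ∃ i, interior (convexHull ℝ (range (s i))) ⊆ M.elem T := fun T => by
    obtain ⟨x, hx⟩ := M.elem_nonempty T
    obtain ⟨i, hi, -⟩ := hs.exists_simplex_of_mem_closure (subset_closure hx)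
    exact ⟨i, hi⟩
  have hsub : ∀ T i, interior (convexHull ℝ (range (s i))) ⊆ M.elem T →
      convexHull ℝ (range (s i)) ⊆ closure (M.elem T) := fun T i hi => by
    rw [← hs.closure_interior i]; exact closure_mono hi
  have hpos : ∀ T, 0 < M.hT T := fun T => by
    obtain ⟨i, hi⟩ := hsimp T
    have h1 : dist (s i 0) (s i 1) ≤ M.hT T :=
      dist_le_hT (hsub T i hi (subset_convexHull ℝ _ (mem_range_self 0)))
        (hsub T i hi (subset_convexHull ℝ _ (mem_range_self 1)))
    exact (dist_pos.2 fun h => by simpa using (hs.indep i).injective h).trans_le h1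
  have hin : ∀ T i, interior (convexHull ℝ (range (s i))) ⊆ M.elem T →
      ∃ x, Metric.ball x (ρ ^ 2 * M.hT T) ⊆ convexHull ℝ (range (s i)) := fun T i hi => by
    obtain ⟨x, hx⟩ := hball i
    refine ⟨x, (Metric.ball_subset_ball ?_).trans hx⟩
    have := mul_le_mul_of_nonneg_left (hdiam i T hi) hρ.le
    calc _ = ρ * (ρ * M.hT T) := by ring
      _ ≤ _ := this
  have hball' : ∀ T, ∃ x, Metric.ball x (ρ ^ 2 * M.hT T) ⊆ M.elem T := fun T => by
    obtain ⟨i, hi⟩ := hsimp T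
    obtain ⟨x, hx⟩ := hin T i hi
    exact ⟨x, (interior_maximal hx Metric.isOpen_ball).trans hi⟩
  have hlen : ∀ T, ∀ E ∈ M.elemEdges T, ρ ^ 2 * M.hT T ≤ M.len E := fun T E hE => by
    obtain ⟨F, hF, hE⟩ := mem_elemEdges.1 hE
    obtain ⟨i, a, c, hac, hi, hsg⟩ := hs.exists_simplicial_edge hF hE
    obtain ⟨x, hx⟩ := hin T i hi
    refine (le_dist_vertex (hs.basis i) hx hac).trans ?_
    rw [← hE_eq_len, PolyMesh.hE, ← Metric.diam_closure]
    have hb : Bornology.IsBounded (M.edge E) := by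
      refine Bornology.IsBounded.subset ?_ (openSegment_subset_segment ℝ _ _)
      rw [← convexHull_pair]
      exact (isBounded_convexHull).2 (Set.toFinite _).isBounded
    have hsg' : segment ℝ (s i a) (s i c) ⊆ closure (M.edge E) := by
      rw [← closure_openSegment]; exact closure_mono hsg
    exact Metric.dist_le_diam_of_mem hb.closure (hsg' (left_mem_segment ℝ _ _))
      (hsg' (right_mem_segment ℝ _ _))
  classical
  let I : Fin M.nT → Finset (Fin m) := fun T =>
    Finset.univ.filter fun i => interior (convexHull ℝ (range (s i))) ⊆ M.elem T
  have hI : ∀ T i, i ∈ I T ↔ interior (convexHull ℝ (range (s i))) ⊆ M.elem T := by simp [I]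
  have hIcard : ∀ T, ((I T).card : ℝ) ≤ 1 / (ρ ^ 2) ^ 3 := fun T => by
    have h1 : ∀ i ∈ I T, ∃ x, Metric.ball x (ρ ^ 2 * M.hT T) ⊆ convexHull ℝ (range (s i)) :=
      fun i hi => hin T i ((hI T i).1 hi)
    choose! c hc using h1
    obtain ⟨x, hx⟩ := M.elem_nonempty T
    have h2 := card_mul_le_of_disjoint (I T) (fun i => interior (convexHull ℝ (range (s i)))) c
      (x := x) (r := ρ ^ 2 * M.hT T) (R := M.hT T) (mul_nonneg (sq_nonneg _) (hpos T).le) (hpos T).le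
      (fun i hi => interior_maximal (hc i hi) Metric.isOpen_ball)
      (fun i _ j _ hij => hs.disjoint_interior hij)
      (fun i hi y hy => Metric.mem_closedBall.2
        (dist_le_hT (subset_closure ((hI T i).1 hi hy)) (subset_closure hx)))
    rw [le_div_iff₀ (by positivity)]
    rw [mul_pow, ← mul_assoc] at h2
    have h3 : 0 < M.hT T ^ 3 := pow_pos (hpos T) 3
    nlinarith
  have hfrac : 0 < 1 / (ρ ^ 2 * ρ ^ 2) ^ 3 := by positivity
  have hfrac' : 0 < 1 / (ρ ^ 2) ^ 3 := by positivity
  have h16 : 16 / (ρ ^ 2) ^ 3 = 16 * (1 / (ρ ^ 2) ^ 3) := by ring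
  have hface : ∀ T, ∀ F ∈ M.facesOf T, ∃ i j, i ∈ I T ∧
      ∀ y, (hs.basis i).coord j y = 0 → (∀ k, k ≠ j → 0 < (hs.basis i).coord k y) →
        y ∈ M.face F := fun T F hF => by
    obtain ⟨x, hx⟩ := M.face_nonempty F
    obtain ⟨i, hi, j, hj, -⟩ := hs.exists_simplicial_face hF (subset_closure hx)
    exact ⟨i, j, (hI T i).2 hi, hj⟩
  refine ⟨hpos, hball', fun T F hF => ?_, hlen, fun T => ?_, fun T => ?_, fun E S hS => ?_⟩
  · obtain ⟨A, U, hd, hr, hU, hUA⟩ := M.exists_plane F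
    obtain ⟨i, j, hi, hj⟩ := hface T F hF
    obtain ⟨x, hx⟩ := hin T i ((hI T i).1 hi)
    have hr0 : 0 < ρ ^ 2 * M.hT T := mul_pos (by positivity) (hpos T)
    obtain ⟨y, hy⟩ := exists_disc_in_face (hs.basis i) hr0 hx j
    have hFA : M.face F ⊆ A := by rw [hUA]; exact inter_subset_right
    have hyA : y ∈ A := by
      have := hy 0 (map_zero _) (by simpa using hr0)
      rw [add_zero] at this
      exact hFA (hj y this.1 this.2)
    refine ⟨A, hd, hFA, y, hyA, fun z hz => ?_⟩
    have hu : z - y ∈ A.direction := A.vsub_mem_direction hz.2 hyA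
    have h1 := hy (z - y) (coord_linear_eq_zero (hs.basis i) hr
      (fun w hw hw' => hFA (hj w hw hw')) hu) (mem_ball_iff_norm.1 hz.1)
    rw [add_sub_cancel] at h1
    exact hj z h1.1 h1.2
  · have : Nonempty (Fin m) := ⟨(hsimp T).choose⟩
    choose! f g hf using hface T
    -- Each mesh face contains an open simplicial face; disjointness of the mesh faces makes the
    -- choice injective.
    have h1 : (M.facesOf T).card ≤ (I T ×ˢ (Finset.univ : Finset (Fin 4))).card := by
      refine Finset.card_le_card_of_injOn (fun F => (f F, g F)) (fun F hF => by
        simpa using (hf F hF).1) fun F hF F' hF' h => ?_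
      obtain ⟨h1, h2⟩ := Prod.mk.inj h
      by_contra hne
      obtain ⟨y, hy⟩ : ∃ y, (hs.basis (f F)).coord (g F) y = 0 ∧
          ∀ k, k ≠ g F → 0 < (hs.basis (f F)).coord k y := by
        obtain ⟨x, hx⟩ := hin T (f F) ((hI T _).1 (hf F hF).1)
        obtain ⟨y, hy⟩ := exists_disc_in_face (hs.basis (f F))
          (mul_pos (by positivity) (hpos T)) hx (g F)
        exact ⟨y + 0, hy 0 (map_zero _) (by
          simpa using mul_pos (show (0 : ℝ) < ρ ^ 2 by positivity) (hpos T))⟩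
      refine disjoint_left.1 (M.face_disjoint F F' hne) ((hf F hF).2 y hy.1 hy.2) ?_
      have h3 := (hf F' hF').2 y
      rw [← h1, ← h2] at h3
      exact h3 hy.1 hy.2
    rw [Finset.card_product, Finset.card_univ, Fintype.card_fin] at h1
    have h2 : ((M.facesOf T).card : ℝ) ≤ (I T).card * 4 := by exact_mod_cast h1
    have h3 : ((M.facesOf T).card : ℝ) ≤ N := by linarith [hIcard T]
    exact_mod_cast h3
  · have hedge : ∀ E ∈ M.elemEdges T, ∃ i a c, i ∈ I T ∧
        openSegment ℝ (s i a) (s i c) ⊆ M.edge E := fun E hE => by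
      obtain ⟨F, hF, hE⟩ := mem_elemEdges.1 hE
      obtain ⟨i, a, c, -, hi, hsg⟩ := hs.exists_simplicial_edge hF hE
      exact ⟨i, a, c, (hI T i).2 hi, hsg⟩
    have : Nonempty (Fin m) := ⟨(hsimp T).choose⟩
    choose! f g g' hf using hedge
    have h1 : (M.elemEdges T).card
        ≤ (I T ×ˢ (Finset.univ : Finset (Fin 4 × Fin 4))).card := by
      refine Finset.card_le_card_of_injOn (fun E => (f E, g E, g' E)) (fun E hE => by
        simpa using (hf E hE).1) fun E hE E' hE' h => ?_
      obtain ⟨h1, h2⟩ := Prod.mk.inj h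
      obtain ⟨h2, h3⟩ := Prod.mk.inj h2
      by_contra hne
      obtain ⟨y, hy⟩ : (openSegment ℝ (s (f E) (g E)) (s (f E) (g' E))).Nonempty :=
        ⟨_, midpoint_mem_openSegment _ _⟩
      refine disjoint_left.1 (M.edge_disjoint E E' hne) ((hf E hE).2 hy) ((hf E' hE').2 ?_)
      rw [← h1, ← h2, ← h3]; exact hy
    rw [Finset.card_product, Finset.card_univ, Fintype.card_prod, Fintype.card_fin] at h1
    have h2 : ((M.elemEdges T).card : ℝ) ≤ (I T).card * 16 := by exact_mod_cast h1
    have h3 : ((M.elemEdges T).card : ℝ) ≤ N := by linarith [hIcard T]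
    exact_mod_cast h3
  · choose c hc using hball'
    have hl := len_pos E
    -- Since `ρ² h_T ≤ |E| ≤ h_T`, an element around `E` contains a ball of radius `ρ² |E|` and lies
    -- at distance at most `|E|/ρ²` from an end point.
    have h2 := card_mul_le_of_disjoint S M.elem c (x := M.src E) (r := ρ ^ 2 * M.len E)
      (R := M.len E / ρ ^ 2) (by positivity) (by positivity)
      (fun T hT => (Metric.ball_subset_ball (mul_le_mul_of_nonneg_left (len_le_hT (hS T hT))
        (by positivity))).trans (hc T))
      (fun T _ T' _ h => M.elem_disjoint T T' h)
      (fun T hT y hy => Metric.mem_closedBall.2 ((dist_le_hT (subset_closure hy)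
        (segment_subset_closure_elem (hS T hT) (left_mem_segment ℝ _ _))).trans (by
          rw [le_div_iff₀ (by positivity), mul_comm]; exact hlen T E (hS T hT))))
    have h3 : (S.card : ℝ) ≤ 1 / (ρ ^ 2 * ρ ^ 2) ^ 3 := by
      rw [le_div_iff₀ (by positivity)]
      have h4 : 0 < M.len E ^ 3 := by positivity
      rw [div_pow, le_div_iff₀ (by positivity)] at h2
      refine le_of_mul_le_mul_right ?_ h4
      calc _ = (S.card : ℝ) * (ρ ^ 2 * M.len E) ^ 3 * (ρ ^ 2) ^ 3 := by ring
        _ ≤ _ := by rw [one_mul]; exact h2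
    have h5 : (S.card : ℝ) ≤ N := by linarith
    exact_mod_cast h5

end PolyMesh

/-! ### Vector products -/

/-- The vector product on Euclidean space. -/
noncomputable def cr (a b : E3) : E3 := WithLp.toLp 2 (a.ofLp ⨯₃ b.ofLp)

theorem inner_eq (a b : E3) : inner ℝ a b = a 0 * b 0 + a 1 * b 1 + a 2 * b 2 := by
  simp [PiLp.inner_apply, Fin.sum_univ_three, mul_comm]

theorem cr_zero (a b : E3) : cr a b 0 = a 1 * b 2 - a 2 * b 1 := by simp [cr, cross_apply]
theorem cr_one (a b : E3) : cr a b 1 = a 2 * b 0 - a 0 * b 2 := by simp [cr, cross_apply]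
theorem cr_two (a b : E3) : cr a b 2 = a 0 * b 1 - a 1 * b 0 := by simp [cr, cross_apply]

theorem inner_cr_left (a b : E3) : inner ℝ a (cr a b) = 0 := by
  simp only [inner_eq, cr_zero, cr_one, cr_two]; ring

theorem inner_cr_right (a b : E3) : inner ℝ b (cr a b) = 0 := by
  simp only [inner_eq, cr_zero, cr_one, cr_two]; ring

theorem inner_cr_self (a b : E3) :
    inner ℝ (cr a b) (cr a b) = (inner ℝ a a : ℝ) * inner ℝ b b - (inner ℝ a b : ℝ) ^ 2 := by
  simp only [inner_eq, cr_zero, cr_one, cr_two]; ring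

/-- Expansion of `v` in the frame `(a, b, a × b)`, multiplied by the Gram determinant of `a` and `b`
to avoid divisions. -/
theorem cr_decomposition (a b v : E3) :
    (inner ℝ (cr a b) v : ℝ) • cr a b = (inner ℝ (cr a b) (cr a b) : ℝ) • v
      - ((inner ℝ v a : ℝ) * inner ℝ b b - (inner ℝ v b : ℝ) * inner ℝ a b) • a
      - ((inner ℝ v b : ℝ) * inner ℝ a a - (inner ℝ v a : ℝ) * inner ℝ a b) • b := by
  ext i
  fin_cases i <;>
  simp only [inner_eq, cr_zero, cr_one, cr_two, PiLp.sub_apply, PiLp.smul_apply, smul_eq_mul,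
    Fin.zero_eta, Fin.mk_one, Fin.reduceFinMk] <;> ring

/-! ### Local structure of the boundary -/

theorem iff_of_isPreconnected {X : Type*} [PseudoMetricSpace X] {S : Set X} (hS : IsPreconnected S)
    {p : X → Prop}
    (h : ∀ y ∈ S, ∃ ε > 0, ∀ z ∈ S, dist z y < ε → (p z ↔ p y)) {y z : X} (hy : y ∈ S)
    (hz : z ∈ S) : p y ↔ p z := by
  have := isPreconnected_iff_preconnectedSpace.1 hS
  have hl : IsLocallyConstant fun w : S => p w := by
    rw [IsLocallyConstant.iff_eventually_eq]
    rintro ⟨w, hw⟩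
    obtain ⟨ε, hε, hw'⟩ := h w hw
    rw [Metric.eventually_nhds_iff]
    exact ⟨ε, hε, fun v hv => propext (hw' v v.2 hv)⟩
  exact iff_of_eq (hl.apply_eq_of_preconnectedSpace ⟨y, hy⟩ ⟨z, hz⟩)

/-- In the ball `B(x, r)`, the set `T` is the epigraph of `φ` in the direction `e`. -/
structure IsEpigraphAt (T : Set E3) (x e : E3) (φ : E3 → ℝ) (K : ℝ≥0) (r : ℝ) : Prop where
  norm_e : ‖e‖ = 1
  lip : LipschitzWith K φ
  pos : 0 < r
  mem_iff : ∀ y, dist y x < r → (y ∈ T ↔ φ (y - (inner ℝ e y : ℝ) • e) < (inner ℝ e y : ℝ))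

namespace IsEpigraphAt
variable {T : Set E3} {x e : E3} {φ : E3 → ℝ} {K : ℝ≥0} {r : ℝ} (h : IsEpigraphAt T x e φ K r)
include h

theorem inner_e : (inner ℝ e e : ℝ) = 1 := by
  rw [real_inner_self_eq_norm_sq, h.norm_e, one_pow]

theorem proj_add (y : E3) (s : ℝ) :
    (y + s • e) - (inner ℝ e (y + s • e) : ℝ) • e = y - (inner ℝ e y : ℝ) • e := by
  rw [inner_add_right, inner_smul_right, h.inner_e, mul_one, add_smul]; abel

theorem inner_add (y : E3) (s : ℝ) : (inner ℝ e (y + s • e) : ℝ) = inner ℝ e y + s := by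
  rw [inner_add_right, inner_smul_right, h.inner_e, mul_one]

/-- A strict inequality on either side is stable by continuity, so only the graph can be boundary;
from a point of the graph, any small motion along `e` enters `T`. -/
theorem mem_frontier_iff (hT : IsOpen T) {y : E3} (hy : dist y x < r) :
    y ∈ frontier T ↔ φ (y - (inner ℝ e y : ℝ) • e) = (inner ℝ e y : ℝ) := by
  have hφ : Continuous fun y : E3 => φ (y - (inner ℝ e y : ℝ) • e) :=
    h.lip.continuous.comp (by fun_prop)
  have hi : Continuous fun y : E3 => (inner ℝ e y : ℝ) := by fun_prop
  have hball : {y | dist y x < r} ∈ 𝓝 y := Metric.isOpen_ball.mem_nhds hy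
  rw [hT.frontier_eq]
  constructor
  · rintro ⟨h1, h2⟩
    refine le_antisymm ?_ (not_lt.1 fun hlt => h2 ((h.mem_iff y hy).2 hlt))
    by_contra! hlt
    have h3 : ∀ᶠ z in 𝓝 y, (inner ℝ e z : ℝ) < φ (z - (inner ℝ e z : ℝ) • e) :=
      hi.continuousAt.eventually_lt hφ.continuousAt hlt
    obtain ⟨z, hz, hz2, hz3⟩ := (mem_closure_iff_frequently.1 h1 |>.and_eventually
      (h3.and hball)).exists
    exact lt_asymm hz2 ((h.mem_iff z hz3).1 hz)
  · intro heq
    refine ⟨?_, fun hyT => (lt_irrefl _ (heq ▸ (h.mem_iff y hy).1 hyT))⟩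
    have hc : Tendsto (fun s : ℝ => y + s • e) (𝓝[>] 0) (𝓝 y) := by
      have : Tendsto (fun s : ℝ => y + s • e) (𝓝 0) (𝓝 (y + (0:ℝ) • e)) :=
        (by fun_prop : Continuous fun s : ℝ => y + s • e).tendsto 0
      rw [zero_smul, add_zero] at this
      exact this.mono_left nhdsWithin_le_nhds
    refine mem_closure_of_tendsto hc ?_
    filter_upwards [hc.eventually hball, self_mem_nhdsWithin] with s hs hs0
    rw [h.mem_iff _ hs, h.proj_add, h.inner_add, heq]
    exact lt_add_of_pos_right _ hs0

/-- Two boundary points on the same line of direction `e` coincide. -/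
theorem eq_zero_of_frontier (hT : IsOpen T) {y : E3} {s : ℝ} (hy : y ∈ frontier T)
    (hys : y + s • e ∈ frontier T) (h1 : dist y x < r) (h2 : dist (y + s • e) x < r) : s = 0 := by
  rw [h.mem_frontier_iff hT h1] at hy
  rw [h.mem_frontier_iff hT h2, h.proj_add, h.inner_add, hy] at hys
  linarith

end IsEpigraphAt

namespace PolyMesh
variable {Ω : Set E3} {M : PolyMesh Ω}

theorem exists_epigraph {T : Fin M.nT} {x : E3} (hx : x ∈ frontier (M.elem T)) :
    ∃ e φ K r, IsEpigraphAt (M.elem T) x e φ K r := by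
  rw [(M.isOpen_elem T).frontier_eq] at hx
  obtain ⟨e, -, he, φ, K, hφ, r, hr, h⟩ := (M.elem_polytope T).boundary_lipschitz x hx
  exact ⟨e, φ, K, r, he, hφ, hr, fun y hy => h y trivial hy⟩

theorem frontier_of_mem_closure_face {T : Fin M.nT} {F : Fin M.nF} (hF : F ∈ M.facesOf T) {x : E3}
    (hx : x ∈ closure (M.face F)) : x ∈ frontier (M.elem T) :=
  closure_minimal (mem_facesOf.1 hF) isClosed_frontier hx

theorem inner_normal (F : Fin M.nF) : (inner ℝ (M.normal F) (M.normal F) : ℝ) = 1 := by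
  rw [real_inner_self_eq_norm_sq, M.normal_unit, one_pow]

theorem inner_tangent (E : Fin M.nE) : (inner ℝ (M.tangent E) (M.tangent E) : ℝ) = 1 := by
  rw [real_inner_self_eq_norm_sq, tangent, norm_smul, norm_inv, dist_comm, dist_eq_norm, norm_norm,
    inv_mul_cancel₀, one_pow]
  rw [norm_ne_zero_iff, sub_ne_zero]
  exact (M.src_ne_tgt E).symm

theorem mem_direction_iff {F : Fin M.nF} {A : AffineSubspace ℝ E3}
    (hA : A.direction = (ℝ ∙ M.normal F)ᗮ) {u : E3} :
    u ∈ A.direction ↔ (inner ℝ (M.normal F) u : ℝ) = 0 := by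
  rw [hA, Submodule.mem_orthogonal_singleton_iff_inner_right]

theorem exists_ball_inter_subset {A : AffineSubspace ℝ E3} {X U : Set E3} (hU : IsOpen U)
    (hX : X = U ∩ A) {y : E3} (hy : y ∈ X) : ∃ ε > 0, ∀ z ∈ A, dist z y < ε → z ∈ X := by
  have hyU : y ∈ U := by rw [hX] at hy; exact hy.1
  obtain ⟨ε, hε, hb⟩ := Metric.isOpen_iff.1 hU y hyU
  exact ⟨ε, hε, fun z hz hd => by rw [hX]; exact ⟨hb hd, hz⟩⟩

/-! ### On which side of a face the element lies -/

section FaceSide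
variable {T : Fin M.nT} {F : Fin M.nF} (hF : F ∈ M.facesOf T) {x e : E3} {φ : E3 → ℝ} {K : ℝ≥0}
  {r : ℝ} (h : IsEpigraphAt (M.elem T) x e φ K r)
include hF h

/-- If `e` were tangent to the face, a small motion along `e` would remain in the face and give two
boundary points on one line of direction `e`. -/
theorem inner_epigraph_normal_ne_zero {y : E3} (hy : y ∈ M.face F) (hyx : dist y x < r) :
    (inner ℝ e (M.normal F) : ℝ) ≠ 0 := by
  intro h0
  obtain ⟨A, U, hd, -, hU, hUA⟩ := M.exists_plane F
  obtain ⟨ε, hε, hb⟩ := exists_ball_inter_subset hU hUA hy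
  have hyA : y ∈ A := by rw [hUA] at hy; exact hy.2
  have hed : e ∈ A.direction := (mem_direction_iff hd).2 (by rw [real_inner_comm]; exact h0)
  set s := min (ε / 2) ((r - dist y x) / 2) with hs
  have hs0 : 0 < s := lt_min (by linarith) (by linarith)
  have hds : dist (y + s • e) y = s := by
    rw [dist_eq_norm, add_sub_cancel_left, norm_smul, h.norm_e, mul_one, Real.norm_eq_abs,
      abs_of_pos hs0]
  have h1 : y + s • e ∈ M.face F := hb _
    (by rw [add_comm]; exact AffineSubspace.vadd_mem_of_mem_direction (A.direction.smul_mem s hed) hyA)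
    (by rw [hds]; exact (min_le_left _ _).trans_lt (by linarith))
  have h2 : dist (y + s • e) x < r := by
    have := dist_triangle (y + s • e) y x
    rw [hds] at this
    have := min_le_right (ε / 2) ((r - dist y x) / 2)
    linarith
  exact hs0.ne' (h.eq_zero_of_frontier (M.isOpen_elem T) (mem_facesOf.1 hF hy)
    (mem_facesOf.1 hF h1) hyx h2)

/-- Here `σ • n` has positive component `c` along `e`. From `z ± s σ n` the line of direction `e`
meets the plane of the face at distance `s / c`, at a point of the face, hence of the graph. One of
the two points is therefore above the graph and the other below, uniformly for `z` near `y`. -/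
theorem exists_side {y : E3} (hy : y ∈ M.face F) (hyx : dist y x < r) {σ : ℝ} (hσ : σ * σ = 1)
    (hpos : 0 < (inner ℝ e (σ • M.normal F) : ℝ)) :
    ∃ ε > 0, ∀ z ∈ M.face F, dist z y < ε → ∀ s, 0 < s → s < ε →
      z + s • σ • M.normal F ∈ M.elem T ∧ z - s • σ • M.normal F ∉ M.elem T := by
  obtain ⟨A, U, hd, -, hU, hUA⟩ := M.exists_plane F
  obtain ⟨ε, hε, hb⟩ := exists_ball_inter_subset hU hUA hy
  set c := (inner ℝ e (σ • M.normal F) : ℝ) with hc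
  have hnσ : ‖σ • M.normal F‖ = 1 := by
    rw [norm_smul, M.normal_unit, mul_one, Real.norm_eq_abs]
    have : |σ| * |σ| = 1 := by rw [← abs_mul, hσ, abs_one]
    nlinarith [abs_nonneg σ]
  set δ := min ε (r - dist y x) with hδ
  have hδ0 : 0 < δ := lt_min hε (by linarith)
  -- The foot on the plane is reached from `y` by three moves, of lengths `|z - y|`, `s` and `s /
  -- c`; this radius keeps their sum below `δ`.
  refine ⟨δ / (2 + 1 / c), by positivity, fun z hz hzy s hs0 hs => ?_⟩
  have hzA : z ∈ A := by rw [hUA] at hz; exact hz.2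
  have hs' : s * (2 + 1 / c) < δ := by rwa [lt_div_iff₀ (by positivity)] at hs
  have hzy' : dist z y * (2 + 1 / c) < δ := by rwa [lt_div_iff₀ (by positivity)] at hzy
  have h1c : 0 < 1 / c := by positivity
  -- Both sides at once: the point `z + θ s σ n` has signed height `θ s / c` above the graph.
  have key : ∀ θ : ℝ, θ * θ = 1 →
      φ ((z + (θ * s) • σ • M.normal F) - (inner ℝ e (z + (θ * s) • σ • M.normal F) : ℝ) • e)
        = (inner ℝ e (z + (θ * s) • σ • M.normal F) : ℝ) - θ * s / c ∧
      dist (z + (θ * s) • σ • M.normal F) x < r := by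
    intro θ hθ
    have hθa : |θ| = 1 := by
      have : |θ| * |θ| = 1 := by rw [← abs_mul, hθ, abs_one]
      nlinarith [abs_nonneg θ]
    set w := z + (θ * s) • σ • M.normal F with hw
    have hwz : dist w z = s := by
      rw [hw, dist_eq_norm, add_sub_cancel_left, norm_smul, hnσ, mul_one, Real.norm_eq_abs, abs_mul,
        hθa, one_mul, abs_of_pos hs0]
    have hww : dist (w + (-(θ * s / c)) • e) w = s / c := by
      rw [dist_eq_norm, add_sub_cancel_left, norm_smul, h.norm_e, mul_one, Real.norm_eq_abs, abs_neg,
        abs_div, abs_mul, hθa, one_mul, abs_of_pos hs0, abs_of_pos hpos]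
    have hsc : s / c = s * (1 / c) := by ring
    have hdy : dist (w + (-(θ * s / c)) • e) y < δ := by
      have h1 := dist_triangle4 (w + (-(θ * s / c)) • e) w z y
      rw [hww, hwz, hsc] at h1
      nlinarith [dist_nonneg (x := z) (y := y), mul_pos hs0 h1c]
    have hmem : w + (-(θ * s / c)) • e ∈ M.face F := by
      refine hb _ ?_ (hdy.trans_le (min_le_left _ _))
      have : w + (-(θ * s / c)) • e = ((θ * s) • σ • M.normal F + (-(θ * s / c)) • e) + z := by
        rw [hw]; abel
      rw [this]
      refine AffineSubspace.vadd_mem_of_mem_direction ((mem_direction_iff hd).2 ?_) hzA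
      rw [inner_add_right, inner_smul_right, inner_smul_right, inner_smul_right, inner_normal]
      have hcσ : c = σ * inner ℝ (M.normal F) e := by
        rw [hc, inner_smul_right, real_inner_comm]
      have hne : (inner ℝ (M.normal F) e : ℝ) = σ * c := by
        rw [hcσ, ← mul_assoc, hσ, one_mul]
      rw [hne]
      field_simp
      ring
    have hdx : dist (w + (-(θ * s / c)) • e) x < r := by
      have h1 := dist_triangle (w + (-(θ * s / c)) • e) y x
      have h2 := min_le_right ε (r - dist y x)
      linarith
    have h3 := (h.mem_frontier_iff (M.isOpen_elem T) hdx).1 (mem_facesOf.1 hF hmem)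
    rw [h.proj_add, h.inner_add] at h3
    refine ⟨by rw [h3]; ring, ?_⟩
    have h1 := dist_triangle4 w z y x
    rw [hwz] at h1
    have h2 := min_le_right ε (r - dist y x)
    have h4 : s + dist z y < δ := by
      nlinarith [dist_nonneg (x := z) (y := y), mul_pos hs0 h1c,
        mul_nonneg (dist_nonneg (x := z) (y := y)) h1c.le]
    linarith
  have hsc0 : 0 < s / c := by positivity
  obtain ⟨k1, k2⟩ := key 1 (by norm_num)
  obtain ⟨k3, k4⟩ := key (-1) (by norm_num)
  rw [one_mul] at k1 k2
  have hneg : z + (-1 * s) • σ • M.normal F = z - s • σ • M.normal F := by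
    rw [neg_one_mul, neg_smul, sub_eq_add_neg]
  rw [hneg] at k3 k4
  refine ⟨(h.mem_iff _ k2).2 (by rw [k1]; linarith), fun hmem => ?_⟩
  have := (h.mem_iff _ k4).1 hmem
  rw [k3] at this
  have h5 : -1 * s / c = -(s / c) := by ring
  rw [h5] at this
  linarith

omit h in
-- The side is locally constant on the face. The face being connected, the orientation, defined
-- through some point, can be read at any point.
theorem exists_side_iff {y : E3} (hy : y ∈ M.face F) : ∃ ε > 0, ∀ z ∈ M.face F, dist z y < ε →
    ((∀ᶠ s : ℝ in 𝓝[>] 0, z - s • M.normal F ∈ M.elem T) ↔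
      ∀ᶠ s : ℝ in 𝓝[>] 0, y - s • M.normal F ∈ M.elem T) := by
  obtain ⟨e, φ, K, r, h⟩ := exists_epigraph (mem_facesOf.1 hF hy)
  have hyy : dist y y < r := by rw [dist_self]; exact h.pos
  have hev : ∀ ε : ℝ, 0 < ε → ∀ᶠ s : ℝ in 𝓝[>] 0, 0 < s ∧ s < ε := fun ε hε =>
    Ioo_mem_nhdsGT hε
  rcases lt_or_gt_of_ne (inner_epigraph_normal_ne_zero hF h hy hyy) with h0 | h0
  · obtain ⟨ε, hε, hb⟩ := exists_side hF h hy hyy (σ := -1) (by norm_num)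
      (by rw [inner_smul_right]; linarith)
    have key : ∀ z ∈ M.face F, dist z y < ε →
        ∀ᶠ s : ℝ in 𝓝[>] 0, z - s • M.normal F ∈ M.elem T := fun z hz hzy => by
      filter_upwards [hev ε hε] with s hs
      have := (hb z hz hzy s hs.1 hs.2).1
      rwa [neg_one_smul, smul_neg, ← sub_eq_add_neg] at this
    exact ⟨ε, hε, fun z hz hzy => iff_of_true (key z hz hzy) (key y hy (by rwa [dist_self]))⟩
  · obtain ⟨ε, hε, hb⟩ := exists_side hF h hy hyy (σ := 1) (by norm_num)
      (by rw [inner_smul_right]; linarith)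
    have key : ∀ z ∈ M.face F, dist z y < ε →
        ¬ ∀ᶠ s : ℝ in 𝓝[>] 0, z - s • M.normal F ∈ M.elem T := fun z hz hzy hcon => by
      obtain ⟨s, hs, hs'⟩ := (hcon.and (hev ε hε)).exists
      have := (hb z hz hzy s hs'.1 hs'.2).2
      rw [one_smul] at this
      exact this hs
    exact ⟨ε, hε, fun z hz hzy => iff_of_false (key z hz hzy) (key y hy (by rwa [dist_self]))⟩

/-- The orientation of a face relative to an element, read on any epigraph representation. -/
theorem omegaTF_eq {y : E3} (hy : y ∈ M.face F) (hyx : dist y x < r) :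
    M.omegaTF T F = -SignType.sign (inner ℝ e (M.normal F) : ℝ) := by
  have hconn : IsPreconnected (M.face F) := by
    obtain ⟨A, -, hA⟩ := M.face_polytope F
    exact hA.simplyConnected.isPathConnected.isConnected.isPreconnected
  have hiff : ∀ z ∈ M.face F, (∀ᶠ s : ℝ in 𝓝[>] 0, z - s • M.normal F ∈ M.elem T) ↔
      ∀ᶠ s : ℝ in 𝓝[>] 0, y - s • M.normal F ∈ M.elem T := fun z hz =>
    iff_of_isPreconnected (p := fun z => ∀ᶠ s : ℝ in 𝓝[>] 0, z - s • M.normal F ∈ M.elem T) hconn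
      (fun y hy => exists_side_iff hF hy) hz hy
  have hex : (∃ z ∈ M.face F, ∀ᶠ s : ℝ in 𝓝[>] 0, z - s • M.normal F ∈ M.elem T) ↔
      ∀ᶠ s : ℝ in 𝓝[>] 0, y - s • M.normal F ∈ M.elem T :=
    ⟨fun ⟨z, hz, hzs⟩ => (hiff z hz).1 hzs, fun hys => ⟨y, hy, hys⟩⟩
  have hev : ∀ ε : ℝ, 0 < ε → ∀ᶠ s : ℝ in 𝓝[>] 0, 0 < s ∧ s < ε := fun ε hε =>
    Ioo_mem_nhdsGT hε
  rw [omegaTF]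
  rcases lt_or_gt_of_ne (inner_epigraph_normal_ne_zero hF h hy hyx) with h0 | h0
  · obtain ⟨ε, hε, hb⟩ := exists_side hF h hy hyx (σ := -1) (by norm_num)
      (by rw [inner_smul_right]; linarith)
    rw [if_pos, sign_neg h0]
    · simp
    · rw [hex]
      filter_upwards [hev ε hε] with s hs
      have := (hb y hy (by rwa [dist_self]) s hs.1 hs.2).1
      rwa [neg_one_smul, smul_neg, ← sub_eq_add_neg] at this
  · obtain ⟨ε, hε, hb⟩ := exists_side hF h hy hyx (σ := 1) (by norm_num)
      (by rw [inner_smul_right]; linarith)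
    rw [if_neg, sign_pos h0]
    · simp
    · rw [hex]
      intro hcon
      obtain ⟨s, hs, hs'⟩ := (hcon.and (hev ε hε)).exists
      have := (hb y hy (by rwa [dist_self]) s hs'.1 hs'.2).2
      rw [one_smul] at this
      exact this hs

end FaceSide
end PolyMesh

theorem eventually_mul_lt (c : ℝ) {ε : ℝ} (hε : 0 < ε) : ∀ᶠ s : ℝ in 𝓝[>] 0, s * c < ε := by
  have : Tendsto (fun s : ℝ => s * c) (𝓝 0) (𝓝 (0 * c)) :=
    (by fun_prop : Continuous fun s : ℝ => s * c).tendsto 0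
  rw [zero_mul] at this
  exact (this.mono_left nhdsWithin_le_nhds).eventually (gt_mem_nhds hε)

theorem eventually_pos_lt {ε : ℝ} (hε : 0 < ε) : ∀ᶠ s : ℝ in 𝓝[>] 0, 0 < s ∧ s < ε :=
  Ioo_mem_nhdsGT hε

theorem eq_one_or_of_mul_self {σ : ℝ} (h : σ * σ = 1) : σ = 1 ∨ σ = -1 := mul_self_eq_one_iff.1 h

/-! ### Faces near interior points of their edges -/

namespace PolyMesh
variable {Ω : Set E3} {M : PolyMesh Ω}

theorem normalFE_eq (F : Fin M.nF) (E : Fin M.nE) :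
    M.normalFE F E = cr (M.normal F) (M.tangent E) := rfl

theorem tgt_sub_src (E : Fin M.nE) : M.tgt E - M.src E = M.len E • M.tangent E := by
  rw [tangent, len, smul_inv_smul₀ (dist_ne_zero.2 (M.src_ne_tgt E))]

theorem exists_smul_tangent {E : Fin M.nE} {x y : E3} (hx : x ∈ segment ℝ (M.src E) (M.tgt E))
    (hy : y ∈ segment ℝ (M.src E) (M.tgt E)) : ∃ a : ℝ, y - x = a • M.tangent E := by
  rw [segment_eq_image_lineMap] at hx hy
  obtain ⟨a, -, rfl⟩ := hx
  obtain ⟨b, -, rfl⟩ := hy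
  refine ⟨(b - a) * M.len E, ?_⟩
  rw [mul_smul, ← tgt_sub_src, AffineMap.lineMap_apply_module', AffineMap.lineMap_apply_module',
    add_sub_add_right_eq_sub, ← sub_smul]

theorem edge_subset_segment (E : Fin M.nE) : M.edge E ⊆ segment ℝ (M.src E) (M.tgt E) :=
  openSegment_subset_segment _ _ _

theorem exists_add_smul_mem_edge {E : Fin M.nE} {x : E3} (hx : x ∈ M.edge E) :
    ∃ ε > 0, ∀ a : ℝ, |a| < ε → x + a • M.tangent E ∈ M.edge E := by
  rw [edge, openSegment_eq_image_lineMap] at *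
  obtain ⟨θ, hθ, rfl⟩ := hx
  have hl := len_pos E
  refine ⟨M.len E * min θ (1 - θ), mul_pos hl (lt_min hθ.1 (by linarith [hθ.2])), fun a ha => ?_⟩
  refine ⟨θ + a / M.len E, ?_, ?_⟩
  · have h1 : |a / M.len E| < min θ (1 - θ) := by
      rw [abs_div, abs_of_pos hl, div_lt_iff₀ hl, mul_comm]; exact ha
    obtain ⟨h2, h3⟩ := lt_min_iff.1 h1
    exact ⟨by linarith [(abs_lt.1 h2).1], by linarith [(abs_lt.1 h3).2]⟩
  · rw [AffineMap.lineMap_apply_module', AffineMap.lineMap_apply_module', tgt_sub_src, smul_smul,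
      smul_smul, add_mul, div_mul_cancel₀ _ hl.ne', add_smul]
    abel

theorem notMem_segment_of_ne {E E' : Fin M.nE} (h : E' ≠ E) {x : E3} (hx : x ∈ M.edge E) :
    x ∉ segment ℝ (M.src E') (M.tgt E') := by
  rw [← insert_endpoints_openSegment]
  rintro (rfl | rfl | h')
  · exact (M.vertex_notMem_edge E' E).1 hx
  · exact (M.vertex_notMem_edge E' E).2 hx
  · exact disjoint_left.1 (M.edge_disjoint E' E h) h' hx

theorem isClosed_edge_segment (E : Fin M.nE) : IsClosed (segment ℝ (M.src E) (M.tgt E)) := by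
  rw [← closure_openSegment]; exact isClosed_closure

/-- Near a point of one of its edges, the face `F` is a half disc: `σ n_FE` points into `F`. -/
structure IsHalfDisc (F : Fin M.nF) (E : Fin M.nE) (x : E3) (A : AffineSubspace ℝ E3) (σ ε : ℝ) :
    Prop where
  direction : A.direction = (ℝ ∙ M.normal F)ᗮ
  face_subset : M.face F ⊆ A
  mem_plane : x ∈ A
  normal_tangent : (inner ℝ (M.normal F) (M.tangent E) : ℝ) = 0
  sign : σ * σ = 1
  pos : 0 < ε
  mem_iff : ∀ y ∈ A, dist y x < ε → (y ∈ M.face F ↔ 0 < σ * inner ℝ (M.normalFE F E) (y - x))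

theorem plane_decomposition {F : Fin M.nF} {E : Fin M.nE}
    (hnt : (inner ℝ (M.normal F) (M.tangent E) : ℝ) = 0) {v : E3}
    (hv : (inner ℝ (M.normal F) v : ℝ) = 0) :
    v = (inner ℝ v (M.tangent E) : ℝ) • M.tangent E
      + (inner ℝ (M.normalFE F E) v : ℝ) • M.normalFE F E := by
  have h := cr_decomposition (M.normal F) (M.tangent E) v
  have hv' : (inner ℝ v (M.normal F) : ℝ) = 0 := by rw [real_inner_comm]; exact hv
  rw [inner_cr_self, inner_normal, inner_tangent, hnt] at h
  rw [normalFE_eq]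
  simp only [hv', mul_one, mul_zero, sub_zero, zero_smul, ne_eq, OfNat.ofNat_ne_zero,
    not_false_eq_true, zero_pow, one_smul] at h
  rw [h]; abel

theorem inner_normalFE_self {F : Fin M.nF} {E : Fin M.nE}
    (hnt : (inner ℝ (M.normal F) (M.tangent E) : ℝ) = 0) :
    (inner ℝ (M.normalFE F E) (M.normalFE F E) : ℝ) = 1 := by
  rw [normalFE_eq, inner_cr_self, inner_normal, inner_tangent, hnt]; norm_num

theorem norm_normalFE {F : Fin M.nF} {E : Fin M.nE}
    (hnt : (inner ℝ (M.normal F) (M.tangent E) : ℝ) = 0) : ‖M.normalFE F E‖ = 1 := by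
  have := inner_normalFE_self hnt
  rw [real_inner_self_eq_norm_sq] at this
  nlinarith [norm_nonneg (M.normalFE F E)]

/-- Away from the other edges, the relative boundary of the face is the line of `E`, so each of the
two open half discs is connected and free of boundary points, hence inside or outside the face. Both
outside is impossible because `x` is in the closure. Both inside is impossible because a Lipschitz
domain lies locally on one side of its boundary. -/
theorem exists_halfDisc {F : Fin M.nF} {E : Fin M.nE} (hE : E ∈ M.edgesOf F) {x : E3}
    (hx : x ∈ M.edge E) : ∃ A σ ε, IsHalfDisc (M := M) F E x A σ ε := by
  obtain ⟨A, hd, hA⟩ := M.face_polytope F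
  obtain ⟨U, hU, hUA⟩ := hA.relOpen
  have hFA : M.face F ⊆ A := by rw [hUA]; exact inter_subset_right
  have hcl : closure (M.face F) ⊆ A :=
    closure_minimal hFA (AffineSubspace.closed_of_finiteDimensional A)
  have hxF := mem_edgesOf.1 hE hx
  have hxA : x ∈ A := hcl hxF.1
  obtain ⟨ε₁, hε₁, hline⟩ := exists_add_smul_mem_edge hx
  have ht : M.tangent E ∈ A.direction := by
    have h1 : x + (ε₁ / 2) • M.tangent E ∈ A := hcl (mem_edgesOf.1 hE (hline (ε₁ / 2) (by
      rw [abs_of_pos (by linarith)]; linarith))).1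
    have h2 := A.vsub_mem_direction h1 hxA
    rw [vsub_eq_sub, add_sub_cancel_left] at h2
    have h3 := A.direction.smul_mem (ε₁ / 2)⁻¹ h2
    rwa [inv_smul_smul₀ (by linarith)] at h3
  have hnt := (mem_direction_iff hd).1 ht
  set m := M.normalFE F E with hm
  have hmA : m ∈ A.direction := (mem_direction_iff hd).2 (inner_cr_left _ _)
  have hmt : (inner ℝ m (M.tangent E) : ℝ) = 0 := by
    rw [real_inner_comm]; exact inner_cr_right _ _
  have hmm : (inner ℝ m m : ℝ) = 1 := inner_normalFE_self hnt
  have hmn : ‖m‖ = 1 := norm_normalFE hnt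
  -- a ball that avoids the other edges
  have hclosed : IsClosed (⋃ E' ∈ {E' | E' ≠ E}, segment ℝ (M.src E') (M.tgt E')) :=
    (Set.toFinite _).isClosed_biUnion fun E' _ => isClosed_edge_segment E'
  have hxn : x ∈ (⋃ E' ∈ {E' | E' ≠ E}, segment ℝ (M.src E') (M.tgt E'))ᶜ := by
    simp only [mem_compl_iff, mem_iUnion, not_exists]
    exact fun E' hE' => notMem_segment_of_ne hE' hx
  obtain ⟨ε₂, hε₂, hb⟩ := Metric.isOpen_iff.1 hclosed.isOpen_compl x hxn
  set ε := min ε₁ ε₂ with hε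
  have hε0 : 0 < ε := lt_min hε₁ hε₂
  have hbd : ∀ y ∈ A, dist y x < ε →
      (y ∈ closure (M.face F) \ M.face F ↔ (inner ℝ m (y - x) : ℝ) = 0) := by
    intro y hy hyx
    constructor
    · intro hyF
      rw [M.face_boundary F] at hyF
      simp only [mem_iUnion] at hyF
      obtain ⟨E', -, hyE'⟩ := hyF
      by_cases hEE : E' = E
      · subst hEE
        obtain ⟨a, ha⟩ := exists_smul_tangent (edge_subset_segment _ hx) hyE'
        rw [ha, inner_smul_right, hmt, mul_zero]
      · exact absurd (mem_biUnion (x := E') hEE hyE') (hb (hyx.trans_le (min_le_right _ _)))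
    · intro h0
      have hv := plane_decomposition hnt ((mem_direction_iff hd).1 (A.vsub_mem_direction hy hxA))
      rw [vsub_eq_sub, ← hm, h0, zero_smul, add_zero] at hv
      have hy' : y = x + (inner ℝ (y - x) (M.tangent E) : ℝ) • M.tangent E := by rw [← hv]; abel
      rw [hy']
      refine mem_edgesOf.1 hE (hline _ ?_)
      have h1 := abs_real_inner_le_norm (y - x) (M.tangent E)
      have h2 : ‖M.tangent E‖ = 1 := by
        have := inner_tangent E
        rw [real_inner_self_eq_norm_sq] at this
        nlinarith [norm_nonneg (M.tangent E)]
      rw [h2, mul_one, ← dist_eq_norm] at h1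
      exact h1.trans_lt (hyx.trans_le (min_le_left _ _))
  -- each open half disc is contained in the face or disjoint from it
  have hhalf : ∀ τ : ℝ, ∀ y z, y ∈ A → z ∈ A → dist y x < ε → dist z x < ε →
      0 < τ * inner ℝ m (y - x) → 0 < τ * inner ℝ m (z - x) → (y ∈ M.face F ↔ z ∈ M.face F) := by
    intro τ y z hy hz hyx hzx hyτ hzτ
    have hconv : Convex ℝ ((A : Set E3) ∩ Metric.ball x ε ∩ {w | 0 < τ * inner ℝ m (w - x)}) := by
      refine (A.convex.inter (convex_ball x ε)).inter ?_
      intro u hu v hv a b ha hb hab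
      have h1 : a • u + b • v - x = a • (u - x) + b • (v - x) := by
        rw [smul_sub, smul_sub, sub_add_sub_comm, ← add_smul, hab, one_smul]
      change 0 < τ * inner ℝ m (a • u + b • v - x)
      rw [h1, inner_add_right, inner_smul_right, inner_smul_right]
      have hu' : 0 < τ * inner ℝ m (u - x) := hu
      have hv' : 0 < τ * inner ℝ m (v - x) := hv
      have : τ * (a * inner ℝ m (u - x) + b * inner ℝ m (v - x))
        = a * (τ * inner ℝ m (u - x)) + b * (τ * inner ℝ m (v - x)) := by ring
      rw [this]
      rcases ha.eq_or_lt with rfl | ha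
      · rw [zero_add] at hab; subst hab; linarith
      · have := mul_pos ha hu'
        have := mul_nonneg hb hv'.le
        linarith
    refine iff_of_isPreconnected (p := fun w => w ∈ M.face F) hconv.isPreconnected ?_
      ⟨⟨hy, hyx⟩, hyτ⟩ ⟨⟨hz, hzx⟩, hzτ⟩
    rintro w ⟨⟨hwA, hwx⟩, hwτ⟩
    by_cases hwF : w ∈ M.face F
    · obtain ⟨δ, hδ, hδb⟩ := exists_ball_inter_subset hU hUA hwF
      exact ⟨δ, hδ, fun u hu huw => iff_of_true (hδb u hu.1.1 huw) hwF⟩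
    · have hwc : w ∈ (closure (M.face F))ᶜ := fun hc => by
        have := (hbd w hwA hwx).1 ⟨hc, hwF⟩
        have hwτ' : 0 < τ * inner ℝ m (w - x) := hwτ
        rw [this, mul_zero] at hwτ'
        exact lt_irrefl _ hwτ'
      obtain ⟨δ, hδ, hδb⟩ := Metric.isOpen_iff.1 isClosed_closure.isOpen_compl w hwc
      exact ⟨δ, hδ, fun u _ huw => iff_of_false (fun huF => hδb huw (subset_closure huF)) hwF⟩
  have hpt : ∀ τ : ℝ, τ * τ = 1 → (x + (ε / 2 * τ) • m ∈ A ∧ dist (x + (ε / 2 * τ) • m) x < ε ∧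
      0 < τ * inner ℝ m (x + (ε / 2 * τ) • m - x)) := by
    intro τ hτ
    refine ⟨?_, ?_, ?_⟩
    · rw [add_comm]; exact AffineSubspace.vadd_mem_of_mem_direction (A.direction.smul_mem _ hmA) hxA
    · rw [dist_eq_norm, add_sub_cancel_left, norm_smul, hmn, mul_one, Real.norm_eq_abs, abs_mul]
      have : |τ| = 1 := by rcases eq_one_or_of_mul_self hτ with rfl | rfl <;> simp
      rw [this, abs_of_pos (by linarith)]; linarith
    · rw [add_sub_cancel_left, inner_smul_right, hmm]
      have : τ * (ε / 2 * τ * 1) = ε / 2 * (τ * τ) := by ring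
      rw [this, hτ]; linarith
  have hone : (1 : ℝ) * 1 = 1 := by norm_num
  have hone' : (-1 : ℝ) * -1 = 1 := by norm_num
  have hpt1 := hpt 1 hone
  have hpt2 := hpt (-1) hone'
  have hnot : ∀ y ∈ A, dist y x < ε → (inner ℝ m (y - x) : ℝ) = 0 → y ∉ M.face F :=
    fun y hy hyx h0 => ((hbd y hy hyx).2 h0).2
  have hcase : ∀ τ : ℝ, τ * τ = 1 → x + (ε / 2 * τ) • m ∈ M.face F →
      x + (ε / 2 * -τ) • m ∉ M.face F → IsHalfDisc (M := M) F E x A τ ε := by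
    intro τ hτ h1 h2
    have h1' := hpt τ hτ
    have h2' := hpt (-τ) (by rw [neg_mul_neg]; exact hτ)
    refine ⟨hd, hFA, hxA, hnt, hτ, hε0, fun y hy hyx => ⟨fun hyF => ?_, fun hpos =>
      (hhalf τ y _ hy h1'.1 hyx h1'.2.1 hpos h1'.2.2).2 h1⟩⟩
    by_contra hle
    rcases (not_lt.1 hle).eq_or_lt with h0 | h0
    · have h3 : (inner ℝ m (y - x) : ℝ) = 0 := by
        rcases mul_eq_zero.1 h0 with h | h
        · rw [h] at hτ; norm_num at hτ
        · exact h
      exact hnot y hy hyx h3 hyF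
    · exact h2 ((hhalf (-τ) y _ hy h2'.1 hyx h2'.2.1 (by linarith) h2'.2.2).1 hyF)
  by_cases hp : x + (ε / 2 * 1) • m ∈ M.face F
  · by_cases hn : x + (ε / 2 * -1) • m ∈ M.face F
    · exfalso
      -- If both half discs are in the face, only points of the edge are missing from the disc. The
      -- epigraph property at `x` will contradict this.
      have hfull : ∀ y ∈ A, dist y x < ε → (inner ℝ m (y - x) : ℝ) ≠ 0 → y ∈ M.face F := by
        intro y hy hyx h0
        rcases lt_or_gt_of_ne h0 with h | h
        · exact (hhalf (-1) y _ hy hpt2.1 hyx hpt2.2.1 (by linarith) hpt2.2.2).2 hn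
        · exact (hhalf 1 y _ hy hpt1.1 hyx hpt1.2.1 (by linarith) hpt1.2.2).2 hp
      obtain ⟨e, heA, he, φ, K, hφ, r, hr, hLip⟩ := hA.boundary_lipschitz x hxF
      have hee : (inner ℝ e e : ℝ) = 1 := by rw [real_inner_self_eq_norm_sq, he, one_pow]
      have hmove : ∀ a b : ℝ, x + (a • m + b • e) ∈ A := fun a b => by
        rw [add_comm]
        exact AffineSubspace.vadd_mem_of_mem_direction (A.direction.add_mem
          (A.direction.smul_mem _ hmA) (A.direction.smul_mem _ heA)) hxA
      have hdist : ∀ a b : ℝ, dist (x + (a • m + b • e)) x ≤ |a| + |b| := fun a b => by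
        rw [dist_eq_norm, add_sub_cancel_left]
        refine (norm_add_le _ _).trans ?_
        rw [norm_smul, norm_smul, hmn, he, mul_one, mul_one, Real.norm_eq_abs, Real.norm_eq_abs]
      have hx0 : (inner ℝ e x : ℝ) ≤ φ (x - (inner ℝ e x : ℝ) • e) := by
        by_contra! hlt
        exact hxF.2 ((hLip x hxA (by rwa [dist_self])).2 hlt)
      set s := min ε r / 4 with hs
      have hs0 : 0 < s := by have := lt_min hε0 hr; positivity
      have hsε : 4 * s ≤ ε := by rw [hs]; linarith [min_le_left ε r]
      have hsr : 4 * s ≤ r := by rw [hs]; linarith [min_le_right ε r]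
      -- If `e` is transverse to the edge, then `x - s e` is in the face, hence above the graph, and
      -- `x` above it as well would be too: but `x` is not in the face.
      have hme : (inner ℝ m e : ℝ) = 0 := by
        by_contra hne
        have hd1 := hdist 0 (-s)
        rw [abs_zero, zero_add, abs_neg, abs_of_pos hs0] at hd1
        have h1 := hfull _ (hmove 0 (-s)) (by linarith) (by
          rw [add_sub_cancel_left, zero_smul, zero_add, inner_smul_right]
          exact mul_ne_zero (neg_ne_zero.2 hs0.ne') hne)
        have h2 := (hLip _ (hmove 0 (-s)) (by linarith)).1 h1
        have h3 : x + ((0:ℝ) • m + (-s) • e)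
            - (inner ℝ e (x + ((0:ℝ) • m + (-s) • e)) : ℝ) • e = x - (inner ℝ e x : ℝ) • e := by
          rw [zero_smul, zero_add, inner_add_right, inner_smul_right, hee, mul_one, add_smul]; abel
        rw [h3, zero_smul, zero_add, inner_add_right, inner_smul_right, hee] at h2
        linarith
      -- If `e` is parallel to the edge, the points `x + δ m - s e` are in the face for small `δ >
      -- 0`. As `δ` tends to 0, they put the graph below `x`, again a contradiction.
      have hlim : φ (x - (inner ℝ e x : ℝ) • e) ≤ (inner ℝ e x : ℝ) - s := by
        have htend : Tendsto (fun δ : ℝ => φ (x - (inner ℝ e x : ℝ) • e + δ • m)) (𝓝[>] 0)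
            (𝓝 (φ (x - (inner ℝ e x : ℝ) • e))) := by
          have hc : Continuous fun δ : ℝ => φ (x - (inner ℝ e x : ℝ) • e + δ • m) :=
            hφ.continuous.comp (by fun_prop)
          have := hc.tendsto 0
          rw [zero_smul, add_zero] at this
          exact this.mono_left nhdsWithin_le_nhds
        refine le_of_tendsto htend ?_
        filter_upwards [eventually_pos_lt hs0] with δ hδ
        have hd1 := hdist δ (-s)
        rw [abs_of_pos hδ.1, abs_neg, abs_of_pos hs0] at hd1
        have h1 := hfull _ (hmove δ (-s)) (by linarith [hδ.2]) (by
          rw [add_sub_cancel_left, inner_add_right, inner_smul_right, inner_smul_right, hme, hmm]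
          linarith [hδ.1])
        have h2 := (hLip _ (hmove δ (-s)) (by linarith [hδ.2])).1 h1
        have hem : (inner ℝ e m : ℝ) = 0 := by rw [real_inner_comm]; exact hme
        have h4 : (inner ℝ e (x + (δ • m + (-s) • e)) : ℝ) = inner ℝ e x - s := by
          rw [inner_add_right, inner_add_right, inner_smul_right, inner_smul_right, hee, hem]; ring
        have h3 : x + (δ • m + (-s) • e)
            - (inner ℝ e (x + (δ • m + (-s) • e)) : ℝ) • e = x - (inner ℝ e x : ℝ) • e + δ • m := by
          rw [h4, sub_smul, neg_smul]; abel
        rw [h3, h4] at h2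
        exact h2.le
      linarith
    · exact ⟨A, 1, ε, hcase 1 hone hp hn⟩
  · by_cases hn : x + (ε / 2 * -1) • m ∈ M.face F
    · exact ⟨A, -1, ε, hcase (-1) hone' hn (by rwa [neg_neg])⟩
    · exfalso
      obtain ⟨y, hyF, hyx⟩ := Metric.mem_closure_iff.1 hxF.1 ε hε0
      rw [dist_comm] at hyx
      have hy := hFA hyF
      rcases lt_trichotomy (inner ℝ m (y - x) : ℝ) 0 with h | h | h
      · exact hn ((hhalf (-1) y _ hy hpt2.1 hyx hpt2.2.1 (by linarith) hpt2.2.2).1 hyF)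
      · exact hnot y hy hyx h hyF
      · exact hp ((hhalf 1 y _ hy hpt1.1 hyx hpt1.2.1 (by linarith) hpt1.2.2).1 hyF)

theorem IsHalfDisc.eventually_iff {F : Fin M.nF} {E : Fin M.nE} {x : E3} {A : AffineSubspace ℝ E3}
    {σ ε : ℝ} (h : IsHalfDisc (M := M) F E x A σ ε) {y : E3} (hx : x ∈ M.edge E)
    (hy : y ∈ M.edge E) (hyx : dist y x < ε) :
    (∀ᶠ s : ℝ in 𝓝[>] 0, y - s • M.normalFE F E ∈ M.face F) ↔ σ = -1 := by
  obtain ⟨a, ha⟩ := exists_smul_tangent (edge_subset_segment _ hx) (edge_subset_segment _ hy)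
  have hmt : (inner ℝ (M.normalFE F E) (M.tangent E) : ℝ) = 0 := by
    rw [real_inner_comm]; exact inner_cr_right _ _
  have key : ∀ᶠ s : ℝ in 𝓝[>] 0, 0 < s ∧ (y - s • M.normalFE F E ∈ M.face F ↔ 0 < σ * -s) := by
    filter_upwards [eventually_pos_lt (sub_pos.2 hyx)] with s hs
    refine ⟨hs.1, ?_⟩
    have hdir : y - s • M.normalFE F E - x ∈ A.direction := by
      have : y - s • M.normalFE F E - x = a • M.tangent E - s • M.normalFE F E := by
        rw [← ha]; abel
      rw [this, mem_direction_iff h.direction, inner_sub_right, inner_smul_right, inner_smul_right,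
        h.normal_tangent, normalFE_eq, inner_cr_left]
      ring
    have hA : y - s • M.normalFE F E ∈ A := by
      have := AffineSubspace.vadd_mem_of_mem_direction hdir h.mem_plane
      rwa [vadd_eq_add, sub_add_cancel] at this
    have hd : dist (y - s • M.normalFE F E) x < ε := by
      have h1 := dist_triangle (y - s • M.normalFE F E) y x
      have h2 : dist (y - s • M.normalFE F E) y = s := by
        rw [dist_eq_norm, sub_sub_cancel_left, norm_neg, norm_smul, norm_normalFE h.normal_tangent,
          mul_one, Real.norm_eq_abs, abs_of_pos hs.1]
      linarith [hs.2]
    rw [h.mem_iff _ hA hd]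
    have : y - s • M.normalFE F E - x = a • M.tangent E - s • M.normalFE F E := by rw [← ha]; abel
    rw [this, inner_sub_right, inner_smul_right, inner_smul_right, hmt,
      inner_normalFE_self h.normal_tangent, mul_zero, mul_one, zero_sub]
  rcases eq_one_or_of_mul_self h.sign with rfl | rfl
  · refine iff_of_false (fun hcon => ?_) (by norm_num)
    obtain ⟨s, hs, hs'⟩ := (hcon.and key).exists
    have := hs'.2.1 hs
    linarith [hs'.1]
  · refine iff_of_true ?_ rfl
    filter_upwards [key] with s hs
    exact hs.2.2 (by linarith [hs.1])

theorem IsHalfDisc.omegaFE_eq {F : Fin M.nF} {E : Fin M.nE} {x : E3} {A : AffineSubspace ℝ E3}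
    {σ ε : ℝ} (h : IsHalfDisc (M := M) F E x A σ ε) (hE : E ∈ M.edgesOf F) (hx : x ∈ M.edge E) :
    M.omegaFE F E = -σ := by
  have hconn : IsPreconnected (M.edge E) := (convex_openSegment _ _).isPreconnected
  have hiff : ∀ y ∈ M.edge E, (∀ᶠ s : ℝ in 𝓝[>] 0, y - s • M.normalFE F E ∈ M.face F) ↔
      ∀ᶠ s : ℝ in 𝓝[>] 0, x - s • M.normalFE F E ∈ M.face F := fun y hy =>
    iff_of_isPreconnected (p := fun y => ∀ᶠ s : ℝ in 𝓝[>] 0, y - s • M.normalFE F E ∈ M.face F)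
      hconn (fun z hz => by
        obtain ⟨A', σ', ε', h'⟩ := exists_halfDisc hE hz
        refine ⟨ε', h'.pos, fun w hw hwz => ?_⟩
        rw [h'.eventually_iff hz hw hwz, h'.eventually_iff hz hz (by rw [dist_self]; exact h'.pos)])
      hy hx
  have hxi := h.eventually_iff hx hx (by rw [dist_self]; exact h.pos)
  rw [omegaFE]
  rcases eq_one_or_of_mul_self h.sign with rfl | rfl
  · rw [if_neg]
    rintro ⟨y, hy, hys⟩
    have := hxi.1 ((hiff y hy).1 hys)
    norm_num at this
  · rw [if_pos ⟨x, hx, hxi.2 rfl⟩, neg_neg]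

/-- The identity `(e × t) · (n × t) = (e · n)(t · t) - (e · t)(n · t)`. It relates the side of the
plane spanned by `e` and `t` on which the face lies to the sign of `e · n`. -/
theorem inner_cr_normalFE {F : Fin M.nF} {E : Fin M.nE}
    (hnt : (inner ℝ (M.normal F) (M.tangent E) : ℝ) = 0) (e : E3) :
    (inner ℝ (cr e (M.tangent E)) (M.normalFE F E) : ℝ) = inner ℝ e (M.normal F) := by
  have ht := inner_tangent E
  rw [normalFE_eq]
  simp only [inner_eq, cr_zero, cr_one, cr_two] at *
  linear_combination (e 0 * M.normal F 0 + e 1 * M.normal F 1 + e 2 * M.normal F 2) * ht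
    - (e 0 * M.tangent E 0 + e 1 * M.tangent E 1 + e 2 * M.tangent E 2) * hnt

/-! ### Opposite orientations of the two faces of an element along an edge -/

section Orientation
variable {E : Fin M.nE} {x : E3} {T : Fin M.nT} {e : E3} {φ : E3 → ℝ} {K : ℝ≥0} {r : ℝ}

theorem IsHalfDisc.add_smul_mem {F : Fin M.nF} {A : AffineSubspace ℝ E3} {σ ε : ℝ}
    (h : IsHalfDisc (M := M) F E x A σ ε) {a s : ℝ} (hs : 0 < s) (has : |a| + s < ε) :
    x + (a • M.tangent E + s • σ • M.normalFE F E) ∈ M.face F := by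
  have hmt : (inner ℝ (M.normalFE F E) (M.tangent E) : ℝ) = 0 := by
    rw [real_inner_comm]; exact inner_cr_right _ _
  have hdir : a • M.tangent E + s • σ • M.normalFE F E ∈ A.direction := by
    rw [mem_direction_iff h.direction, inner_add_right, inner_smul_right, inner_smul_right,
      inner_smul_right, h.normal_tangent, normalFE_eq, inner_cr_left]
    ring
  refine (h.mem_iff _ ?_ ?_).2 ?_
  · rw [add_comm]; exact AffineSubspace.vadd_mem_of_mem_direction hdir h.mem_plane
  · rw [dist_eq_norm, add_sub_cancel_left]
    refine (norm_add_le _ _).trans_lt ?_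
    have h1 : |σ| = 1 := by rcases eq_one_or_of_mul_self h.sign with h | h <;> rw [h] <;> simp
    have h2 : ‖M.tangent E‖ = 1 := by
      have := inner_tangent E
      rw [real_inner_self_eq_norm_sq] at this
      nlinarith [norm_nonneg (M.tangent E)]
    rw [norm_smul, norm_smul, norm_smul, h2, norm_normalFE h.normal_tangent, Real.norm_eq_abs,
      Real.norm_eq_abs, Real.norm_eq_abs, h1, abs_of_pos hs]
    linarith
  · rw [add_sub_cancel_left, inner_add_right, inner_smul_right, inner_smul_right, inner_smul_right,
      hmt, inner_normalFE_self h.normal_tangent]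
    have : σ * (a * 0 + s * (σ * 1)) = s * (σ * σ) := by ring
    rw [this, h.sign, mul_one]
    exact hs

theorem IsHalfDisc.nonneg_of_mem_closure {F : Fin M.nF} {A : AffineSubspace ℝ E3} {σ ε : ℝ}
    (h : IsHalfDisc (M := M) F E x A σ ε) {z : E3} (hz : z ∈ closure (M.face F))
    (hzx : dist z x < ε) : 0 ≤ σ * inner ℝ (M.normalFE F E) (z - x) := by
  by_contra! hneg
  have hc : Continuous fun w : E3 => σ * inner ℝ (M.normalFE F E) (w - x) := by fun_prop
  have h1 : ∀ᶠ w in 𝓝 z, σ * inner ℝ (M.normalFE F E) (w - x) < 0 :=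
    hc.continuousAt.eventually_lt continuousAt_const hneg
  have h2 : ∀ᶠ w in 𝓝 z, dist w x < ε := Metric.isOpen_ball.mem_nhds hzx
  obtain ⟨w, hw, hw1, hw2⟩ := (mem_closure_iff_frequently.1 hz |>.and_eventually (h1.and h2)).exists
  exact lt_asymm hw1 ((h.mem_iff w (h.face_subset hw) hw2).1 hw)

theorem IsHalfDisc.eventually_mem {F : Fin M.nF} {A : AffineSubspace ℝ E3} {σ ε : ℝ}
    (h : IsHalfDisc (M := M) F E x A σ ε) (a : ℝ) {b : ℝ} (hb : 0 < b) :
    ∀ᶠ s : ℝ in 𝓝[>] 0, x + s • (a • M.tangent E + b • σ • M.normalFE F E) ∈ M.face F := by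
  filter_upwards [eventually_mul_lt (|a| + b) h.pos, self_mem_nhdsWithin] with s hs hs0
  have hs0 : 0 < s := hs0
  rw [smul_add, smul_smul, smul_smul]
  refine h.add_smul_mem (mul_pos hs0 hb) ?_
  rw [abs_mul, abs_of_pos hs0]
  linarith

theorem eventually_dist_lt (x v : E3) {ε : ℝ} (hε : 0 < ε) :
    ∀ᶠ s : ℝ in 𝓝[>] 0, dist (x + s • v) x < ε := by
  filter_upwards [eventually_mul_lt ‖v‖ hε, self_mem_nhdsWithin] with s hs hs0
  have hs0 : 0 < s := hs0
  rwa [dist_eq_norm, add_sub_cancel_left, norm_smul, Real.norm_eq_abs, abs_of_pos hs0]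

variable (h : IsEpigraphAt (M.elem T) x e φ K r) (hx : x ∈ M.edge E)
include h hx

/-- The face orientation is minus the sign of `e · n`, the edge orientation is `-σ`. Their product
thus records on which side of the edge, seen along `e`, the face lies. -/
theorem IsHalfDisc.omega_mul {F : Fin M.nF} {A : AffineSubspace ℝ E3} {σ ε : ℝ}
    (hF : F ∈ M.facesOf T) (hE : E ∈ M.edgesOf F) (hd : IsHalfDisc (M := M) F E x A σ ε) :
    σ * (inner ℝ e (M.normal F) : ℝ) ≠ 0 ∧
    M.omegaTF T F * M.omegaFE F E = SignType.sign (σ * inner ℝ e (M.normal F)) := by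
  obtain ⟨s, hs, hs'⟩ := ((hd.eventually_mem 0 one_pos).and (eventually_dist_lt x
    ((0:ℝ) • M.tangent E + (1:ℝ) • σ • M.normalFE F E) h.pos)).exists
  have hne := inner_epigraph_normal_ne_zero hF h hs hs'
  rw [omegaTF_eq hF h hs hs', hd.omegaFE_eq hE hx]
  rcases eq_one_or_of_mul_self hd.sign with h1 | h1 <;> rw [h1]
  · simpa using hne
  · rw [neg_one_mul, Left.sign_neg]
    simpa using hne

omit hx in
-- Two faces on the same side have overlapping projections along `e`. The boundary being a graph,
-- they share a point there, and distinct faces are disjoint.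
theorem IsHalfDisc.eq_of_same_side {F F' : Fin M.nF} {A A' : AffineSubspace ℝ E3} {σ ε σ' ε' : ℝ}
    (hF : F ∈ M.facesOf T) (hF' : F' ∈ M.facesOf T)
    (hd : IsHalfDisc (M := M) F E x A σ ε) (hd' : IsHalfDisc (M := M) F' E x A' σ' ε')
    (hpos : 0 < (σ * inner ℝ e (M.normal F)) / (σ' * (inner ℝ e (M.normal F') : ℝ))) : F = F' := by
  set q := σ * (inner ℝ e (M.normal F) : ℝ) with hq
  set q' := σ' * (inner ℝ e (M.normal F') : ℝ) with hq'
  have hq0' : q' ≠ 0 := fun h0 => by rw [h0, div_zero] at hpos; exact lt_irrefl _ hpos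
  set t := M.tangent E
  set g := cr e t with hg
  -- The inward directions are scaled so that their difference has no component along `g = e × t`.
  -- It is then a combination of `e` and `t`, which places a point of `F` on the line of direction
  -- `e` through a point of `F'`.
  set v := σ • M.normalFE F E - (q / q') • σ' • M.normalFE F' E with hv
  have hgv : (inner ℝ g v : ℝ) = 0 := by
    rw [hv, inner_sub_right, inner_smul_right, inner_smul_right, inner_smul_right,
      inner_cr_normalFE hd.normal_tangent, inner_cr_normalFE hd'.normal_tangent, ← hq, ← hq',
      div_mul_cancel₀ _ hq0', sub_self]
  have hgg : (inner ℝ g g : ℝ) ≠ 0 := by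
    intro h0
    have h1 : g = 0 := inner_self_eq_zero.1 h0
    have h2 := inner_cr_normalFE hd'.normal_tangent e
    rw [← hg, h1, inner_zero_left] at h2
    exact hq0' (by rw [hq', ← h2, mul_zero])
  obtain ⟨β, α, hβ⟩ : ∃ β α : ℝ, v = β • e + α • t := by
    have h1 := cr_decomposition e t v
    rw [← hg, hgv, zero_smul, eq_comm, sub_sub, sub_eq_zero] at h1
    have h2 := inv_smul_smul₀ hgg v
    rw [h1, smul_add, smul_smul, smul_smul] at h2
    exact ⟨_, _, h2.symm⟩
  obtain ⟨s, ⟨⟨⟨hs1, hs2⟩, hs3⟩, hs4⟩, hs0⟩ := (((((hd.eventually_mem 0 one_pos).and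
    (hd'.eventually_mem α hpos)).and (eventually_dist_lt x
      ((0:ℝ) • M.tangent E + (1:ℝ) • σ • M.normalFE F E) h.pos)).and (eventually_dist_lt x
      (α • M.tangent E + (q / q') • σ' • M.normalFE F' E) h.pos)).and self_mem_nhdsWithin).exists
  have heq : x + s • ((0:ℝ) • M.tangent E + (1:ℝ) • σ • M.normalFE F E) =
      x + s • (α • M.tangent E + (q / q') • σ' • M.normalFE F' E) + (s * β) • e := by
    have h1 : σ • M.normalFE F E = β • e + α • t + (q / q') • σ' • M.normalFE F' E := by
      rw [← hβ, hv]; abel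
    rw [h1, mul_smul]
    module
  rw [heq] at hs1 hs3
  have hz := h.eq_zero_of_frontier (M.isOpen_elem T) (mem_facesOf.1 hF' hs2) (mem_facesOf.1 hF hs1)
    hs4 hs3
  rw [hz, zero_smul, add_zero] at hs1
  by_contra hne
  exact disjoint_left.1 (M.face_disjoint F F' hne) hs1 hs2

/-- The graph is followed from `x` in the direction `τ g`, transverse to the edge. Its points are on
the boundary of `T`, hence in closures of faces, and one of these faces is met arbitrarily close to
`x`. -/
theorem exists_face_on_side {F₀ : Fin M.nF} (hF₀ : F₀ ∈ M.facesOf T) (hE₀ : E ∈ M.edgesOf F₀)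
    {τ : ℝ} (hτ : τ * τ = 1) : ∃ F ∈ M.facesOf T, E ∈ M.edgesOf F ∧ ∃ A σ ε,
      IsHalfDisc (M := M) F E x A σ ε ∧ 0 < τ * (σ * inner ℝ e (M.normal F)) := by
  obtain ⟨A₀, σ₀, ε₀, hd₀⟩ := exists_halfDisc hE₀ hx
  have hxT : x ∈ frontier (M.elem T) :=
    frontier_of_mem_closure_face hF₀ (mem_edgesOf.1 hE₀ hx).1
  have hxx : dist x x < r := by rw [dist_self]; exact h.pos
  set t := M.tangent E with ht
  set g := cr e t with hg
  have hgg : 0 < (inner ℝ g g : ℝ) := by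
    refine real_inner_self_pos.2 fun h1 => ?_
    have h2 := inner_cr_normalFE hd₀.normal_tangent e
    rw [← ht, ← hg, h1, inner_zero_left] at h2
    exact (hd₀.omega_mul h hx hF₀ hE₀).1 (by rw [← h2, mul_zero])
  have heg : (inner ℝ e g : ℝ) = 0 := inner_cr_left _ _
  have hge : (inner ℝ g e : ℝ) = 0 := by rw [real_inner_comm]; exact heg
  have hgt : (inner ℝ g t : ℝ) = 0 := by rw [real_inner_comm]; exact inner_cr_right _ _
  set p := x - (inner ℝ e x : ℝ) • e with hp
  have hep : (inner ℝ e p : ℝ) = 0 := by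
    rw [hp, inner_sub_right, inner_smul_right, h.inner_e]; ring
  have hφx := (h.mem_frontier_iff (M.isOpen_elem T) hxx).1 hxT
  -- The boundary point above the displacement `s τ g` of the foot of `x`; it starts at `x` for `s =
  -- 0`.
  let z : ℝ → E3 := fun s => p + (s * τ) • g + φ (p + (s * τ) • g) • e
  have hzc : Continuous z := by
    have : Continuous fun s : ℝ => p + (s * τ) • g := by fun_prop
    exact this.add ((h.lip.continuous.comp this).smul continuous_const)
  have hz0 : z 0 = x := by
    simp only [z, zero_mul, zero_smul, add_zero]
    rw [hp, hφx]; abel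
  have hzt : Tendsto z (𝓝[>] 0) (𝓝 x) := by
    have := hzc.tendsto 0
    rw [hz0] at this
    exact this.mono_left nhdsWithin_le_nhds
  have hez : ∀ s, (inner ℝ e (z s) : ℝ) = φ (p + (s * τ) • g) := fun s => by
    simp only [z, inner_add_right, inner_smul_right, hep, heg, h.inner_e]; ring
  have hzT : ∀ᶠ s in 𝓝[>] 0, z s ∈ frontier (M.elem T) := by
    filter_upwards [hzt.eventually (Metric.isOpen_ball.mem_nhds hxx)] with s hs
    rw [h.mem_frontier_iff (M.isOpen_elem T) hs, hez]
    congr 1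
    simp only [z]; abel
  obtain ⟨F, hF, hfr⟩ : ∃ F ∈ M.facesOf T, ∃ᶠ s in 𝓝[>] (0:ℝ), z s ∈ closure (M.face F) := by
    by_contra! hcon
    have hall : ∀ F, ∀ᶠ s in 𝓝[>] (0:ℝ), F ∈ M.facesOf T → z s ∉ closure (M.face F) := fun F => by
      by_cases hF : F ∈ M.facesOf T
      · filter_upwards [hcon F hF] with s hs _ using hs
      · exact Eventually.of_forall fun s hs => absurd hs hF
    obtain ⟨s, hs, hsT⟩ := ((eventually_all.2 hall).and hzT).exists
    rw [M.elem_boundary T] at hsT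
    obtain ⟨F, hF, hsF⟩ := mem_iUnion₂.1 hsT
    exact hs F (mem_facesOf.2 hF) hsF
  have hxF : x ∈ closure (M.face F) := by
    by_contra hcon
    have := hzt.eventually (isClosed_closure.isOpen_compl.mem_nhds hcon)
    obtain ⟨s, hs, hs'⟩ := (hfr.and_eventually this).exists
    exact hs' hs
  -- If `x` were in `F`, the plane of `F` near `x` would contain the projections along `e` of nearby
  -- points of `F₀`; by the graph property these are the same points, so `F = F₀`, which does not
  -- contain its edge point `x`.
  have hxF' : x ∉ M.face F := by
    intro hxF
    obtain ⟨A, U, hdir, -, hU, hUA⟩ := M.exists_plane F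
    obtain ⟨δ, hδ, hb⟩ := exists_ball_inter_subset hU hUA hxF
    have hxA : x ∈ A := by rw [hUA] at hxF; exact hxF.2
    have hne : (inner ℝ (M.normal F) e : ℝ) ≠ 0 := by
      rw [real_inner_comm]; exact inner_epigraph_normal_ne_zero hF h hxF hxx
    set u := (0:ℝ) • M.tangent E + (1:ℝ) • σ₀ • M.normalFE F₀ E with hu
    set c := (inner ℝ (M.normal F) u : ℝ) / inner ℝ (M.normal F) e with hc
    obtain ⟨s, ⟨⟨⟨hs1, hs2⟩, hs3⟩, hs4⟩, hs0⟩ := (((((hd₀.eventually_mem 0 one_pos).and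
      (eventually_dist_lt x u h.pos)).and (eventually_dist_lt x (u - c • e) h.pos)).and
      (eventually_dist_lt x (u - c • e) hδ)).and self_mem_nhdsWithin).exists
    have hs5 : x + s • (u - c • e) ∈ M.face F := by
      refine hb _ ?_ hs4
      rw [add_comm]
      refine AffineSubspace.vadd_mem_of_mem_direction (A.direction.smul_mem _ ?_) hxA
      rw [mem_direction_iff hdir, inner_sub_right, inner_smul_right, hc, div_mul_cancel₀ _ hne,
        sub_self]
    have heq : x + s • u = x + s • (u - c • e) + (s * c) • e := by
      rw [smul_sub, smul_smul]; abel
    rw [← hu, heq] at hs1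
    rw [heq] at hs2
    have hz := h.eq_zero_of_frontier (M.isOpen_elem T) (mem_facesOf.1 hF hs5)
      (mem_facesOf.1 hF₀ hs1) hs3 hs2
    rw [hz, zero_smul, add_zero] at hs1
    have hFF : F = F₀ := by
      by_contra hne
      exact disjoint_left.1 (M.face_disjoint F F₀ hne) hs5 hs1
    subst hFF
    exact (mem_edgesOf.1 hE₀ hx).2 hxF
  have hE : E ∈ M.edgesOf F := by
    have h1 : x ∈ closure (M.face F) \ M.face F := ⟨hxF, hxF'⟩
    rw [M.face_boundary F] at h1
    obtain ⟨E', hE', hxE'⟩ := mem_iUnion₂.1 h1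
    have : E' = E := by
      by_contra hne
      exact notMem_segment_of_ne hne hx hxE'
    subst this
    exact mem_edgesOf.2 hE'
  obtain ⟨A, σ, ε, hd⟩ := exists_halfDisc hE hx
  refine ⟨F, hF, hE, A, σ, ε, hd, ?_⟩
  obtain ⟨s, hs, hsx, hs0⟩ := (hfr.and_eventually ((hzt.eventually
    (Metric.isOpen_ball.mem_nhds (by rw [Metric.mem_ball, dist_self]; exact hd.pos))).and
      self_mem_nhdsWithin)).exists
  have hs0 : 0 < s := hs0
  have hnn := hd.nonneg_of_mem_closure hs hsx
  have hzA : z s ∈ A :=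
    closure_minimal hd.face_subset (AffineSubspace.closed_of_finiteDimensional A) hs
  have hdec := plane_decomposition hd.normal_tangent
    ((mem_direction_iff hd.direction).1 (A.vsub_mem_direction hzA hd.mem_plane))
  rw [vsub_eq_sub] at hdec
  have h1 : (inner ℝ g (z s - x) : ℝ) = s * τ * inner ℝ g g := by
    have : z s - x = (s * τ) • g + (φ (p + (s * τ) • g) - (inner ℝ e x : ℝ)) • e := by
      simp only [z, sub_smul]; rw [hp]; abel
    rw [this, inner_add_right, inner_smul_right, inner_smul_right, hge]; ring
  have h2 : (inner ℝ g (z s - x) : ℝ) =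
      inner ℝ (M.normalFE F E) (z s - x) * inner ℝ e (M.normal F) := by
    rw [hdec, inner_add_right, inner_smul_right, inner_smul_right, ← ht, hgt,
      inner_cr_normalFE hd.normal_tangent, ← hdec]
    ring
  -- The component of `z s - x` along `g`, computed from the curve and from the half disc. The first
  -- factor is nonnegative because `z s` is in the closure of `F`, so the second is positive.
  have h3 : (σ * inner ℝ (M.normalFE F E) (z s - x)) * (τ * (σ * inner ℝ e (M.normal F)))
      = s * (inner ℝ g g : ℝ) := by
    calc _ = (σ * σ) * τ * (inner ℝ (M.normalFE F E) (z s - x) * inner ℝ e (M.normal F)) := by ring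
      _ = s * (τ * τ) * (inner ℝ g g : ℝ) := by rw [← h2, h1, hd.sign]; ring
      _ = _ := by rw [hτ, mul_one]
  exact pos_of_mul_pos_right (by rw [h3]; positivity) hnn

omit h hx in
/-- The two faces of an element that share an edge induce opposite orientations on it. -/
theorem sum_orientation (T : Fin M.nT) (E : Fin M.nE) :
    ∑ F ∈ (M.facesOf T).filter (fun F => E ∈ M.edgesOf F), M.omegaTF T F * M.omegaFE F E = 0 := by
  rcases ((M.facesOf T).filter (fun F => E ∈ M.edgesOf F)).eq_empty_or_nonempty with h0 | ⟨F₀, h0⟩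
  · rw [h0, Finset.sum_empty]
  obtain ⟨hF₀, hE₀⟩ := Finset.mem_filter.1 h0
  obtain ⟨x, hx⟩ : (M.edge E).Nonempty :=
    ⟨_, midpoint_mem_openSegment _ _⟩
  obtain ⟨e, φ, K, r, h⟩ := exists_epigraph
    (frontier_of_mem_closure_face hF₀ (mem_edgesOf.1 hE₀ hx).1)
  -- One face on each side, with orientation products `1` and `-1`; any further face would share a
  -- side with one of them.
  obtain ⟨F₁, hF₁, hE₁, A₁, σ₁, ε₁, hd₁, h₁⟩ := exists_face_on_side h hx hF₀ hE₀ (τ := 1)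
    (by norm_num)
  obtain ⟨F₂, hF₂, hE₂, A₂, σ₂, ε₂, hd₂, h₂⟩ := exists_face_on_side h hx hF₀ hE₀ (τ := -1)
    (by norm_num)
  have hs₁ := (hd₁.omega_mul h hx hF₁ hE₁).2
  have hs₂ := (hd₂.omega_mul h hx hF₂ hE₂).2
  rw [one_mul] at h₁
  rw [sign_pos h₁] at hs₁
  rw [sign_neg (by linarith)] at hs₂
  have hne : F₁ ≠ F₂ := by
    rintro rfl
    rw [hs₁] at hs₂
    norm_num at hs₂
  have heq : (M.facesOf T).filter (fun F => E ∈ M.edgesOf F) = {F₁, F₂} := by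
    ext F
    simp only [Finset.mem_filter, Finset.mem_insert, Finset.mem_singleton]
    constructor
    · rintro ⟨hF, hE⟩
      obtain ⟨A, σ, ε, hd⟩ := exists_halfDisc hE hx
      rcases lt_or_gt_of_ne (hd.omega_mul h hx hF hE).1 with h3 | h3
      · exact Or.inr (hd.eq_of_same_side h hF hF₂ hd₂ (div_pos_of_neg_of_neg h3 (by linarith)))
      · exact Or.inl (hd.eq_of_same_side h hF hF₁ hd₁ (div_pos h3 h₁))
    · rintro (rfl | rfl)
      exacts [⟨hF₁, hE₁⟩, ⟨hF₂, hE₂⟩]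
  rw [heq, Finset.sum_pair hne, hs₁, hs₂]
  norm_num

end Orientation

end PolyMesh

/-! ### Measures on faces and edges -/

/-- A nonnegative function that is constant in the directions orthogonal to the plane `x + V` is
controlled, in mean on a ball, by its restriction to the plane. -/
theorem exists_integral_ball_le : ∃ C : ℝ, 0 < C ∧ ∀ (V : Submodule ℝ E3) (x : E3) (f : E3 → ℝ),
    Module.finrank ℝ V = 2 → Continuous f → (∀ y, 0 ≤ f y) → (∀ y, ∀ w ∈ Vᗮ, f (y + w) = f y) →
    ∀ r > 0, ∫ y in Metric.ball x r, f y
      ≤ C * r * ∫ y in Metric.ball x r ∩ AffineSubspace.mk' x V, f y ∂μHE[2] := by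
  -- The constant is the length of the unit ball of a line, in the form in which ball volumes are
  -- known.
  refine ⟨√Real.pi ^ 1 / Real.Gamma ((1 : ℕ) / 2 + 1), ?_, fun V x f hV hf hnn hconst r hr => ?_⟩
  · have := Real.Gamma_pos_of_pos (s := ((1 : ℕ) : ℝ) / 2 + 1) (by positivity)
    have := Real.pi_pos
    positivity
  have hV' : Module.finrank ℝ Vᗮ = 1 := by
    have := V.finrank_add_finrank_orthogonal
    rw [hV, finrank_euclideanSpace_fin] at this
    omega
  have hvol : volume.real (Metric.ball (0 : Vᗮ) r)
      = √Real.pi ^ 1 / Real.Gamma ((1 : ℕ) / 2 + 1) * r := by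
    have : Nontrivial Vᗮ := Module.nontrivial_of_finrank_pos (R := ℝ) (by rw [hV']; norm_num)
    rw [Measure.real, InnerProductSpace.volume_ball, hV', ENNReal.toReal_mul, pow_one,
      ENNReal.toReal_ofReal hr.le, ENNReal.toReal_ofReal, mul_comm]
    have := Real.Gamma_pos_of_pos (s := ((1 : ℕ) : ℝ) / 2 + 1) (by positivity)
    positivity
  -- the integral over the plane
  have hg : Isometry fun u : V => (u : E3) + x :=
    (isometry_add_right x).comp isometry_subtype_coe
  have hrange : range (fun u : V => (u : E3) + x) = (AffineSubspace.mk' x V : Set E3) := by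
    ext y
    rw [SetLike.mem_coe, AffineSubspace.mem_mk', mem_range]
    exact ⟨fun ⟨u, hu⟩ => by rw [← hu]; simp, fun hy => ⟨⟨y - x, hy⟩, by simp⟩⟩
  have hpre : (fun u : V => (u : E3) + x) ⁻¹' Metric.ball x r = Metric.ball 0 r := by
    ext u; simp
  have hplane : ∫ y in Metric.ball x r ∩ AffineSubspace.mk' x V, f y ∂μHE[2]
      = ∫ u in Metric.ball (0 : V) r, f (u + x) := by
    rw [← hpre, ← InnerProductSpace.euclideanHausdorffMeasure_eq_volume, hV,
      ← hg.isClosedEmbedding.measurableEmbedding.setIntegral_map, hg.map_euclideanHausdorffMeasure,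
      hrange, Measure.restrict_restrict measurableSet_ball]
  have hmp := (V.measurePreserving_measurableEquivProd x).symm
  rw [InnerProductSpace.euclideanHausdorffMeasure_eq_volume] at hmp
  have hsymm : ∀ z : V × Vᗮ, f ((V.measurableEquivProd x).symm z) = f ((z.1 : E3) + x) * 1 := by
    intro z
    rw [Submodule.measurableEquivProd_symm_apply, vadd_eq_add, add_right_comm,
      hconst _ _ z.2.2, mul_one]
  rw [hplane, ← hmp.setIntegral_preimage_emb (V.measurableEquivProd x).symm.measurableEmbedding]
  simp only [hsymm]
  have hcont : Continuous fun z : V × Vᗮ => f ((z.1 : E3) + x) * 1 := by fun_prop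
  -- The ball is enclosed in the product of a disc and a normal segment of the same radius, to which
  -- Fubini's theorem applies.
  calc _ ≤ ∫ z in Metric.ball (0 : V) r ×ˢ Metric.ball (0 : Vᗮ) r, f ((z.1 : E3) + x) * 1 := by
        refine setIntegral_mono_set ?_ (ae_of_all _ fun z => by simpa using hnn _) ?_
        · refine IntegrableOn.mono_set (t := Metric.closedBall (0 : V) r ×ˢ
            Metric.closedBall (0 : Vᗮ) r) ?_
            (prod_mono Metric.ball_subset_closedBall Metric.ball_subset_closedBall)
          exact hcont.continuousOn.integrableOn_compact
            ((isCompact_closedBall _ _).prod (isCompact_closedBall _ _))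
        · refine LE.le.eventuallyLE ?_
          rintro ⟨u, w⟩ hz
          rw [mem_preimage, Submodule.measurableEquivProd_symm_apply, mem_ball_iff_norm,
            vadd_eq_add, add_sub_cancel_right] at hz
          have hsq : ‖(u : E3) + w‖ ^ 2 = ‖u‖ ^ 2 + ‖w‖ ^ 2 := by
            rw [sq, norm_add_sq_eq_norm_sq_add_norm_sq_real
              (V.inner_right_of_mem_orthogonal u.2 w.2), ← sq, ← sq]
            rfl
          have h1 := norm_nonneg ((u : E3) + w)
          refine ⟨mem_ball_zero_iff.2 ?_, mem_ball_zero_iff.2 ?_⟩ <;>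
            nlinarith [norm_nonneg u, norm_nonneg w]
    _ = (∫ u in Metric.ball (0 : V) r, f (u + x)) * ∫ w in Metric.ball (0 : Vᗮ) r, (1 : ℝ) :=
        setIntegral_prod_mul (fun u : V => f (u + x)) (fun _ : Vᗮ => (1 : ℝ)) _ _
    _ = _ := by
        rw [setIntegral_const, hvol, smul_eq_mul]; ring

theorem exists_measure_plane_le : ∃ C : ℝ, 0 < C ∧ ∀ (V : Submodule ℝ E3) (x : E3) (X : Set E3),
    Module.finrank ℝ V = 2 → ∀ r > 0, X ⊆ Metric.ball x r ∩ AffineSubspace.mk' x V →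
    (μHE[2] : Measure E3).real X ≤ C * r ^ 2 := by
  have hΓ := Real.Gamma_pos_of_pos (s := ((2 : ℕ) : ℝ) / 2 + 1) (by positivity)
  have hπ := Real.pi_pos
  refine ⟨√Real.pi ^ 2 / Real.Gamma ((2 : ℕ) / 2 + 1), by positivity, fun V x X hV r hr hX => ?_⟩
  have : Nontrivial V := Module.nontrivial_of_finrank_pos (R := ℝ) (by rw [hV]; norm_num)
  have hg : Isometry fun u : V => (u : E3) + x :=
    (isometry_add_right x).comp isometry_subtype_coe
  have hsub : X ⊆ (fun u : V => (u : E3) + x) '' Metric.ball 0 r := by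
    intro y hy
    have h2 := (hX hy).2
    rw [SetLike.mem_coe, AffineSubspace.mem_mk'] at h2
    refine ⟨⟨y - x, h2⟩, ?_, by simp⟩
    have := (hX hy).1
    rw [mem_ball_iff_norm] at this
    simpa using this
  have hle : (μHE[2] : Measure E3) X ≤ volume (Metric.ball (0 : V) r) := by
    refine (measure_mono hsub).trans_eq ?_
    rw [hg.euclideanHausdorffMeasure_image, ← InnerProductSpace.euclideanHausdorffMeasure_eq_volume,
      hV]
  calc _ ≤ (volume (Metric.ball (0 : V) r)).toReal :=
        ENNReal.toReal_mono measure_ball_lt_top.ne hle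
    _ = _ := by
      rw [InnerProductSpace.volume_ball, hV, ENNReal.toReal_mul, ENNReal.toReal_pow,
        ENNReal.toReal_ofReal hr.le, ENNReal.toReal_ofReal (by positivity), mul_comm]

/-! ### Convex hulls, sizes of measures and uniform polynomial inequalities -/

namespace PolyMesh
variable {Ω : Set E3} {M : PolyMesh Ω}

/-- The convex hull of the closure of an element. -/
def hull (M : PolyMesh Ω) (T : Fin M.nT) : Set E3 := convexHull ℝ (closure (M.elem T))

theorem closure_subset_hull (T : Fin M.nT) : closure (M.elem T) ⊆ M.hull T := subset_convexHull ℝ _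

/-- Taking the convex hull does not increase the diameter. Sup norms can thus be taken on a convex
set, where points are joined by segments, at no cost in the estimates. -/
theorem dist_le_of_mem_hull {T : Fin M.nT} {x y : E3} (hx : x ∈ M.hull T) (hy : y ∈ M.hull T) :
    dist x y ≤ M.hT T := by
  rw [hT, ← Metric.diam_closure, ← convexHull_diam]
  exact Metric.dist_le_diam_of_mem (isBounded_convexHull.2 (isBounded_elem T).closure) hx hy

theorem measure_edge_le (E : Fin M.nE) : (μHE[1] : Measure E3) (M.edge E) ≤ ENNReal.ofReal (M.len E)
    := by
  have ht : ‖M.tangent E‖ = 1 := by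
    have := inner_tangent E
    rw [real_inner_self_eq_norm_sq] at this
    nlinarith [norm_nonneg (M.tangent E)]
  have hf : Isometry fun s : ℝ => M.src E + s • M.tangent E := by
    refine Isometry.of_dist_eq fun a b => ?_
    rw [dist_add_left, dist_eq_norm, ← sub_smul, norm_smul, ht, mul_one, ← dist_eq_norm]
  have hsub : M.edge E ⊆ (fun s : ℝ => M.src E + s • M.tangent E) '' Icc 0 (M.len E) := by
    rw [edge, openSegment_eq_image_lineMap]
    rintro _ ⟨θ, hθ, rfl⟩
    have := len_pos E
    refine ⟨θ * M.len E, ⟨mul_nonneg hθ.1.le this.le, mul_le_of_le_one_left this.le hθ.2.le⟩, ?_⟩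
    rw [AffineMap.lineMap_apply_module', tgt_sub_src, smul_smul, add_comm]
  have hvol : (μHE[1] : Measure ℝ) = volume := by
    have := InnerProductSpace.euclideanHausdorffMeasure_eq_volume (V := ℝ)
    rwa [Module.finrank_self] at this
  refine (measure_mono hsub).trans_eq ?_
  rw [hf.euclideanHausdorffMeasure_image, hvol, Real.volume_Icc, sub_zero]

theorem isBounded_edge (E : Fin M.nE) : Bornology.IsBounded (M.edge E) := by
  refine Bornology.IsBounded.subset ?_ (edge_subset_segment E)
  rw [← convexHull_pair]
  exact isBounded_convexHull.2 (Set.toFinite _).isBounded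

theorem integrable_mE (E : Fin M.nE) : PolyIntegrable (M.mE E) := fun p =>
  integrable_of_bounded (isBounded_edge E)
    ((measure_edge_le E).trans_lt ENNReal.ofReal_lt_top) p

theorem ae_mT (T : Fin M.nT) : ∀ᵐ y ∂(M.mT T), y ∈ M.hull T := by
  filter_upwards [ae_restrict_mem (M.isOpen_elem T).measurableSet] with y hy using
    closure_subset_hull T (subset_closure hy)

theorem measurableSet_face (F : Fin M.nF) : MeasurableSet (M.face F) := by
  obtain ⟨A, U, -, -, hU, hUA⟩ := M.exists_plane F
  rw [hUA]
  exact hU.measurableSet.inter (AffineSubspace.closed_of_finiteDimensional A).measurableSet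

theorem ae_mF (F : Fin M.nF) : ∀ᵐ y ∂(M.mF F), y ∈ M.face F :=
  ae_restrict_mem (measurableSet_face F)

theorem ae_mE (E : Fin M.nE) : ∀ᵐ y ∂(M.mE E), y ∈ segment ℝ (M.src E) (M.tgt E) :=
  ae_restrict_of_ae_restrict_of_subset (edge_subset_segment E)
    (ae_restrict_mem (isClosed_edge_segment E).measurableSet)

theorem ae_mE_hull {T : Fin M.nT} {E : Fin M.nE} (hE : E ∈ M.elemEdges T) :
    ∀ᵐ y ∂(M.mE E), y ∈ M.hull T :=
  (ae_mE E).mono fun _ hy => closure_subset_hull T (segment_subset_closure_elem hE hy)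

theorem ae_mF_hull {T : Fin M.nT} {F : Fin M.nF} (hF : F ∈ M.facesOf T) :
    ∀ᵐ y ∂(M.mF F), y ∈ M.hull T :=
  (ae_mF F).mono fun _ hy => closure_subset_hull T (face_subset_closure hF hy)

theorem exists_mem_facesOf (F : Fin M.nF) : ∃ T, F ∈ M.facesOf T := by
  rcases M.face_adj F with ⟨T, _, _, h⟩ | ⟨T, h⟩ <;>
    exact ⟨T, mem_facesOf.2 (h.trans inter_subset_left)⟩

theorem mE_real_le (E : Fin M.nE) : (M.mE E).real univ ≤ M.len E := by
  rw [mE, Measure.real, Measure.restrict_apply_univ]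
  exact ENNReal.toReal_le_of_le_ofReal (len_pos E).le (measure_edge_le E)

instance isFiniteMeasure_mT (T : Fin M.nT) : IsFiniteMeasure (M.mT T) :=
  ⟨by rw [mT, Measure.restrict_apply_univ]; exact (isBounded_elem T).measure_lt_top⟩

instance isFiniteMeasure_mF (F : Fin M.nF) : IsFiniteMeasure (M.mF F) := by
  obtain ⟨A, -, hA⟩ := M.face_polytope F
  exact ⟨by rw [mF, Measure.restrict_apply_univ]; exact hA.measure_lt_top⟩

instance isFiniteMeasure_mE (E : Fin M.nE) : IsFiniteMeasure (M.mE E) :=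
  ⟨by rw [mE, Measure.restrict_apply_univ]
      exact (measure_edge_le E).trans_lt ENNReal.ofReal_lt_top⟩

theorem exists_volume_le : ∃ C : ℝ, 0 < C ∧ ∀ (M : PolyMesh Ω) (T : Fin M.nT), 0 < M.hT T →
    (M.mT T).real univ ≤ C * M.hT T ^ 3 := by
  have hΓ := Real.Gamma_pos_of_pos (s := ((3 : ℕ) : ℝ) / 2 + 1) (by positivity)
  have hπ := Real.pi_pos
  refine ⟨8 * (√Real.pi ^ 3 / Real.Gamma ((3 : ℕ) / 2 + 1)), by positivity, fun M T hT => ?_⟩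
  obtain ⟨x, hx⟩ := M.elem_nonempty T
  have hsub : M.elem T ⊆ Metric.ball x (2 * M.hT T) := fun y hy => by
    rw [Metric.mem_ball]
    have := dist_le_hT (subset_closure hy) (subset_closure hx)
    linarith
  rw [mT, Measure.real, Measure.restrict_apply_univ]
  calc _ ≤ (volume (Metric.ball x (2 * M.hT T))).toReal :=
        ENNReal.toReal_mono measure_ball_lt_top.ne (measure_mono hsub)
    _ = _ := by
      rw [InnerProductSpace.volume_ball, finrank_euclideanSpace_fin, ENNReal.toReal_mul,
        ENNReal.toReal_pow, ENNReal.toReal_ofReal (by positivity),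
        ENNReal.toReal_ofReal (by positivity)]
      ring

theorem exists_area_le : ∃ C : ℝ, 0 < C ∧ ∀ (M : PolyMesh Ω) (T : Fin M.nT), 0 < M.hT T →
    ∀ F ∈ M.facesOf T, (M.mF F).real univ ≤ C * M.hT T ^ 2 := by
  obtain ⟨C, hC, H⟩ := exists_measure_plane_le
  refine ⟨C * 4, by positivity, fun M T hT F hF => ?_⟩
  obtain ⟨x, hx⟩ := M.face_nonempty F
  obtain ⟨A, U, -, hr, -, hUA⟩ := M.exists_plane F
  have hA : M.face F ⊆ A := by rw [hUA]; exact inter_subset_right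
  have := H A.direction x (M.face F) hr (2 * M.hT T) (by positivity) fun y hy => by
    refine ⟨?_, ?_⟩
    · rw [Metric.mem_ball]
      have := dist_le_hT (face_subset_closure hF hy) (face_subset_closure hF hx)
      linarith
    · rw [AffineSubspace.mk'_eq (hA hx)]; exact hA hy
  rw [mF, measureReal_restrict_apply_univ]
  refine this.trans_eq ?_
  ring

/-- Polynomials on a face are represented constant along the normal, so their mean square on a ball
around the disc is at most a multiple of `h_T` times that on the disc. The estimate on balls loses
one power of `h_T` accordingly. -/
theorem exists_sup_face (ℓ : ℤ) {κ : ℝ} (hκ : 0 < κ) (N : ℕ) : ∃ C : ℝ, 0 < C ∧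
    ∀ M : PolyMesh Ω, ShapeBound M κ N → ∀ T, ∀ F ∈ M.facesOf T, ∀ p ∈ PF ℓ (M.normal F),
      ∀ y ∈ M.hull T, M.hT T ^ 2 * evalAt y p ^ 2 ≤ C * ipS (M.mF F) p p := by
  obtain ⟨C, hC, H⟩ := exists_sup_bound ℓ hκ
  obtain ⟨C', hC', H'⟩ := exists_integral_ball_le
  refine ⟨C * (C' * κ), by positivity, fun M hM T F hF p hp y hy => ?_⟩
  have hT := hM.hT_pos T
  obtain ⟨A, hd, hFA, x, hxA, hx⟩ := hM.disc T F hF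
  have hr : 0 < κ * M.hT T := by positivity
  have hxF : x ∈ M.face F := hx ⟨Metric.mem_ball_self hr, hxA⟩
  have hfin : Module.finrank ℝ A.direction = 2 := by
    obtain ⟨A', U, hd', hr', -⟩ := M.exists_plane F
    rw [hd, ← hd', hr']
  have h1 := (H x _ hT p hp.1 y (by
    rw [Metric.mem_closedBall]
    have := dist_le_of_mem_hull hy (closure_subset_hull T (face_subset_closure hF hxF))
    linarith)).1
  have h2 := H' A.direction x (fun y => evalAt y (p * p)) hfin (continuous_evalAt _)
    (fun y => by rw [evalAt_mul]; exact mul_self_nonneg _) (fun y w hw => by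
      rw [hd, Submodule.orthogonal_orthogonal, Submodule.mem_span_singleton] at hw
      obtain ⟨t, rfl⟩ := hw
      rw [evalAt_mul, evalAt_mul, evalAt_add_smul_of_dirDeriv hp.2]) _ hr
  rw [AffineSubspace.mk'_eq hxA] at h2
  have h3 : ∫ y in Metric.ball x (κ * M.hT T) ∩ A, evalAt y (p * p) ∂μHE[2] ≤ ipS (M.mF F) p p :=
    setIntegral_mono_set (M.integrable_mF F _)
      (ae_of_all _ fun y => by simpa [evalAt_mul] using mul_self_nonneg (evalAt y p))
      (LE.le.eventuallyLE hx)
  have h4 : M.hT T * (M.hT T ^ 2 * evalAt y p ^ 2)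
      ≤ M.hT T * (C * (C' * κ) * ipS (M.mF F) p p) := by
    calc _ = M.hT T ^ 3 * evalAt y p ^ 2 := by ring
      _ ≤ C * (C' * (κ * M.hT T) * ipS (M.mF F) p p) :=
        h1.trans (mul_le_mul_of_nonneg_left (h2.trans
          (mul_le_mul_of_nonneg_left h3 (by positivity))) hC.le)
      _ = _ := by ring
  exact le_of_mul_le_mul_left h4 hT

theorem exists_sup_elem (ℓ : ℤ) {κ : ℝ} (hκ : 0 < κ) (N : ℕ) : ∃ C : ℝ, 0 < C ∧
    ∀ M : PolyMesh Ω, ShapeBound M κ N → ∀ T, ∀ p ∈ P ℓ, ∀ y ∈ M.hull T,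
      M.hT T ^ 3 * evalAt y p ^ 2 ≤ C * ipS (M.mT T) p p ∧
      ∀ i, M.hT T ^ 5 * evalAt y (MvPolynomial.pderiv i p) ^ 2 ≤ C * ipS (M.mT T) p p := by
  obtain ⟨C, hC, H⟩ := exists_sup_bound ℓ hκ
  refine ⟨C, hC, fun M hM T p hp y hy => ?_⟩
  have hT := hM.hT_pos T
  obtain ⟨x, hx⟩ := hM.ball T
  have hxT : x ∈ M.elem T := hx (Metric.mem_ball_self (by positivity))
  have h1 := H x _ hT p hp y (by
    rw [Metric.mem_closedBall]
    have := dist_le_of_mem_hull hy (closure_subset_hull T (subset_closure hxT))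
    linarith)
  have h3 : ipS (volume.restrict (Metric.ball x (κ * M.hT T))) p p ≤ ipS (M.mT T) p p :=
    setIntegral_mono_set (M.integrable_mT T _)
      (ae_of_all _ fun y => by simpa [evalAt_mul] using mul_self_nonneg (evalAt y p))
      (LE.le.eventuallyLE hx)
  have h4 := mul_le_mul_of_nonneg_left h3 hC.le
  exact ⟨h1.1.trans h4, fun i => (h1.2 i).trans h4⟩

theorem exists_potential_elem (ℓ : ℤ) {κ : ℝ} (hκ : 0 < κ) (N : ℕ) : ∃ C : ℝ, 0 < C ∧
    ∀ M : PolyMesh Ω, ShapeBound M κ N → ∀ T, ∀ w ∈ VP ℓ, ∃ g ∈ Goly ℓ,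
      ∀ y ∈ M.hull T, ∀ i,
        M.hT T * evalAt y ((w - g) i) ^ 2 ≤ C * ipV (M.mT T) (curlL w) (curlL w) := by
  obtain ⟨C, hC, H⟩ := exists_potential_bound ℓ hκ
  refine ⟨C, hC, fun M hM T w hw => ?_⟩
  have hT := hM.hT_pos T
  obtain ⟨x, hx⟩ := hM.ball T
  have hxT : x ∈ M.elem T := hx (Metric.mem_ball_self (by positivity))
  obtain ⟨g, hg, h1⟩ := H x _ hT w hw
  refine ⟨g, hg, fun y hy i => (h1 y ?_ i).trans (mul_le_mul_of_nonneg_left ?_ hC.le)⟩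
  · rw [Metric.mem_closedBall]
    have := dist_le_of_mem_hull hy (closure_subset_hull T (subset_closure hxT))
    linarith
  · exact setIntegral_mono_set (M.integrable_mT T _)
      (ae_of_all _ fun y => evalAt_dotProduct_self_nonneg y _) (LE.le.eventuallyLE hx)

/-- Uniform estimates for polynomials of degree at most `k + 1` on a regular mesh. -/
structure MeshBound (M : PolyMesh Ω) (k : ℕ) (C : ℝ) : Prop where
  one_le : 1 ≤ C
  hT_pos : ∀ T, 0 < M.hT T
  volume_le : ∀ T, (M.mT T).real univ ≤ C * M.hT T ^ 3
  area_le : ∀ T, ∀ F ∈ M.facesOf T, (M.mF F).real univ ≤ C * M.hT T ^ 2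
  le_len : ∀ T, ∀ E ∈ M.elemEdges T, M.hT T ≤ C * M.len E
  sup_elem : ∀ T, ∀ p ∈ P ((k : ℤ) + 1), ∀ y ∈ M.hull T,
    M.hT T ^ 3 * evalAt y p ^ 2 ≤ C * ipS (M.mT T) p p ∧
      ∀ i, M.hT T ^ 5 * evalAt y (MvPolynomial.pderiv i p) ^ 2 ≤ C * ipS (M.mT T) p p
  sup_face : ∀ T, ∀ F ∈ M.facesOf T, ∀ p ∈ PF ((k : ℤ) + 1) (M.normal F),
    ∀ y ∈ M.hull T, M.hT T ^ 2 * evalAt y p ^ 2 ≤ C * ipS (M.mF F) p p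
  potential : ∀ ℓ : ℤ, (k : ℤ) ≤ ℓ → ℓ ≤ k + 1 → ∀ T, ∀ w ∈ VP ℓ, ∃ g ∈ Goly ℓ,
    ∀ y ∈ M.hull T, ∀ i,
      M.hT T * evalAt y ((w - g) i) ^ 2 ≤ C * ipV (M.mT T) (curlL w) (curlL w)
  card_faces : ∀ T, ((M.facesOf T).card : ℝ) ≤ C
  card_edges : ∀ T, ((M.elemEdges T).card : ℝ) ≤ C
  card_elems : ∀ (E : Fin M.nE) (S : Finset (Fin M.nT)), (∀ T ∈ S, E ∈ M.elemEdges T) →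
    (S.card : ℝ) ≤ C

theorem exists_meshBound (k : ℕ) {ρ : ℝ} (hρ : 0 < ρ) :
    ∃ C, ∀ M : PolyMesh Ω, M.IsRegular ρ → MeshBound M k C := by
  obtain ⟨N, hN⟩ := IsRegular.exists_shapeBound (Ω := Ω) hρ
  have hκ : 0 < ρ ^ 2 := by positivity
  obtain ⟨C₁, h₁, H₁⟩ := exists_volume_le (Ω := Ω)
  obtain ⟨C₂, h₂, H₂⟩ := exists_area_le (Ω := Ω)
  obtain ⟨C₃, h₃, H₃⟩ := exists_sup_elem (Ω := Ω) ((k : ℤ) + 1) hκ N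
  obtain ⟨C₄, h₄, H₄⟩ := exists_sup_face (Ω := Ω) ((k : ℤ) + 1) hκ N
  obtain ⟨C₅, h₅, H₅⟩ := exists_potential_elem (Ω := Ω) (k : ℤ) hκ N
  obtain ⟨C₆, h₆, H₆⟩ := exists_potential_elem (Ω := Ω) ((k : ℤ) + 1) hκ N
  have h₀ : 0 < (ρ ^ 2)⁻¹ := by positivity
  have hN0 : (0 : ℝ) ≤ N := N.cast_nonneg
  set C := 1 + C₁ + C₂ + C₃ + C₄ + C₅ + C₆ + (ρ ^ 2)⁻¹ + N with hC
  refine ⟨C, fun M hR => ?_⟩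
  have hM := hN M hR
  have hcard : (N : ℝ) ≤ C := by linarith
  exact {
    one_le := by linarith
    hT_pos := hM.hT_pos
    volume_le := fun T => (H₁ M T (hM.hT_pos T)).trans
      (mul_le_mul_of_nonneg_right (by linarith) (pow_nonneg (hM.hT_pos T).le _))
    area_le := fun T F hF => (H₂ M T (hM.hT_pos T) F hF).trans
      (mul_le_mul_of_nonneg_right (by linarith) (pow_nonneg (hM.hT_pos T).le _))
    le_len := fun T E hE => by
      have h1 := hM.le_len T E hE
      rw [mul_comm, ← le_div_iff₀ hκ, div_eq_inv_mul] at h1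
      exact h1.trans (mul_le_mul_of_nonneg_right (by linarith) (len_pos E).le)
    sup_elem := fun T p hp y hy => by
      have h1 := H₃ M hM T p hp y hy
      have h2 : C₃ * ipS (M.mT T) p p ≤ C * ipS (M.mT T) p p :=
        mul_le_mul_of_nonneg_right (by linarith) (ipS_self_nonneg _)
      exact ⟨h1.1.trans h2, fun i => (h1.2 i).trans h2⟩
    sup_face := fun T F hF p hp y hy => (H₄ M hM T F hF p hp y hy).trans
      (mul_le_mul_of_nonneg_right (by linarith) (ipS_self_nonneg _))
    potential := fun ℓ hℓ hℓ' T w hw => by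
      obtain rfl | rfl : ℓ = k ∨ ℓ = k + 1 := by omega
      · obtain ⟨g, hg, h⟩ := H₅ M hM T w hw
        exact ⟨g, hg, fun y hy i => (h y hy i).trans
          (mul_le_mul_of_nonneg_right (by linarith) (ipV_self_nonneg _))⟩
      · obtain ⟨g, hg, h⟩ := H₆ M hM T w hw
        exact ⟨g, hg, fun y hy i => (h y hy i).trans
          (mul_le_mul_of_nonneg_right (by linarith) (ipV_self_nonneg _))⟩
    card_faces := fun T => (Nat.cast_le.2 (hM.card_faces T)).trans hcard
    card_edges := fun T => (Nat.cast_le.2 (hM.card_edges T)).trans hcard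
    card_elems := fun E S hS => (Nat.cast_le.2 (hM.card_elems E S hS)).trans hcard }

end PolyMesh

/-! ### Polynomials on faces -/

theorem mem_PF_iff {ℓ : ℤ} {n : E3} {p : Poly3} : p ∈ PF ℓ n ↔ p ∈ P ℓ ∧ dirDeriv n p = 0 := Iff.rfl

theorem PF_mono {a b : ℤ} (h : a ≤ b) (n : E3) : PF a n ≤ PF b n := fun _ hp =>
  ⟨P_mono h hp.1, hp.2⟩

theorem C_mem_PF {ℓ : ℤ} (h : 0 ≤ ℓ) (n : E3) (c : ℝ) : (C c : Poly3) ∈ PF ℓ n :=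
  ⟨C_mem_P h c, by change dirDeriv n (C c) = 0; simp [dirDeriv_apply]⟩

theorem mem_VPF {ℓ : ℤ} {n : E3} {v : VPoly3} :
    v ∈ VPF ℓ n ↔ (∀ i, v i ∈ PF ℓ n) ∧ ∑ i, n i • v i = 0 := by
  rw [VPF, Submodule.mem_inf, Submodule.mem_pi, LinearMap.mem_ker]
  simp

theorem VPF_mono {a b : ℤ} (h : a ≤ b) (n : E3) : VPF a n ≤ VPF b n := fun _ hv =>
  mem_VPF.2 ⟨fun i => PF_mono h n ((mem_VPF.1 hv).1 i), (mem_VPF.1 hv).2⟩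

theorem VPF_le (ℓ : ℤ) (n : E3) : VPF ℓ n ≤ VP ℓ := fun _ hv =>
  mem_VP.2 fun i => ((mem_VPF.1 hv).1 i).1

instance finite_PF (ℓ : ℤ) (n : E3) : FiniteDimensional ℝ (PF ℓ n) :=
  finite_of_le (B := P ℓ) inf_le_left

instance finite_VPF (ℓ : ℤ) (n : E3) : FiniteDimensional ℝ (VPF ℓ n) := finite_of_le (VPF_le ℓ n)

theorem vrotL_apply (n : E3) (r : Poly3) : vrotL n r = gradL r ⨯₃ cst n := rfl

theorem cross_cst (v : VPoly3) (n : E3) : v ⨯₃ cst n =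
    ![n 2 • v 1 - n 1 • v 2, n 0 • v 2 - n 2 • v 0, n 1 • v 0 - n 0 • v 1] := by
  rw [cross_apply]
  simp [cst, smul_eq_C_mul, mul_comm]

theorem dirDeriv_pderiv (n : E3) (i : Fin 3) (p : Poly3) :
    dirDeriv n (pderiv i p) = pderiv i (dirDeriv n p) := by
  simp only [dirDeriv_apply, map_sum]
  exact Finset.sum_congr rfl fun j _ => by rw [Derivation.map_smul, pderiv_comm]

theorem pderiv_mem_PF {ℓ : ℤ} {n : E3} {p : Poly3} (hp : p ∈ PF (ℓ + 1) n) (i : Fin 3) :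
    pderiv i p ∈ PF ℓ n :=
  ⟨pderiv_mem_P hp.1 i, by
    change dirDeriv n (pderiv i p) = 0
    rw [dirDeriv_pderiv, (mem_PF_iff.1 hp).2, map_zero]⟩

theorem vrotL_mem_VPF {ℓ : ℤ} {n : E3} {r : Poly3} (hr : r ∈ PF (ℓ + 1) n) :
    vrotL n r ∈ VPF ℓ n := by
  have h := pderiv_mem_PF hr
  rw [vrotL_apply, cross_cst]
  refine mem_VPF.2 ⟨fun i => ?_, ?_⟩
  · fin_cases i <;>
      exact Submodule.sub_mem _ (Submodule.smul_mem _ _ (h _)) (Submodule.smul_mem _ _ (h _))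
  · simp only [Fin.sum_univ_three, Matrix.cons_val]
    module

theorem RolyF_le (ℓ : ℤ) (n : E3) : RolyF ℓ n ≤ VPF ℓ n := by
  rintro _ ⟨p, hp, rfl⟩; exact vrotL_mem_VPF hp

theorem vrotL_C (n : E3) (c : ℝ) : vrotL n (C c) = 0 := by
  rw [vrotL_apply, cross_cst]
  ext i : 1
  fin_cases i <;> simp [gradL_apply]

/-- Composition with the orthogonal projection on the plane through `x`. It keeps values and
tangential derivatives on the plane, so a polynomial on an element can be used as test function on a
face. -/
theorem exists_plane_restriction {ℓ : ℤ} {n : E3} (hn : (inner ℝ n n : ℝ) = 1) (x : E3) {p : Poly3}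
    (hp : p ∈ P ℓ) : ∃ q ∈ PF ℓ n, ∀ y, (inner ℝ n y : ℝ) = inner ℝ n x → evalAt y q = evalAt y p ∧
      ∀ i, evalAt y (vrotL n q i) = evalAt y (vrotL n p i) := by
  set f : Fin 3 → Poly3 := fun i => X i - n i • (∑ j, n j • X j - C (inner ℝ n x : ℝ)) with hf
  have hn' : n 0 * n 0 + n 1 * n 1 + n 2 * n 2 = 1 := by rw [← inner_eq]; exact hn
  have hf1 : ∀ i, f i ∈ P 1 := fun i => Submodule.sub_mem _ (X_mem_P le_rfl i)
    (Submodule.smul_mem _ _ (Submodule.sub_mem _ (Submodule.sum_mem _ fun j _ =>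
      Submodule.smul_mem _ _ (X_mem_P le_rfl j)) (C_mem_P (by norm_num) _)))
  have hd : ∀ i, pderiv i (subst f p)
      = subst f (pderiv i p) - n i • ∑ j, n j • subst f (pderiv j p) := by
    intro i
    have hdf : ∀ j, pderiv i (f j) = C ((if i = j then 1 else 0) - n j * n i) := by
      intro j
      fin_cases i <;> fin_cases j <;>
        simp [hf, Fin.sum_univ_three, pderiv_X, smul_eq_C_mul]
    rw [pderiv_subst]
    simp only [hdf]
    fin_cases i <;> simp [Fin.sum_univ_three, smul_eq_C_mul] <;> ring
  refine ⟨subst f p, ⟨subst_mem_P hf1 hp, ?_⟩, fun y hy => ?_⟩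
  · change dirDeriv n _ = 0
    rw [dirDeriv_apply]
    simp only [hd, smul_sub, Finset.sum_sub_distrib, smul_smul, ← Finset.sum_smul]
    rw [Fin.sum_univ_three (fun i => n i * n i), hn', one_smul, sub_self]
  · have hfy : (WithLp.toLp 2 fun i => evalAt y (f i) : E3) = y := by
      ext i
      simp only [hf, evalAt_sub, evalAt_X, evalAt_smul, evalAt_sum, evalAt_C]
      rw [Fin.sum_univ_three, ← inner_eq, hy]
      ring
    have he : ∀ r, evalAt y (subst f r) = evalAt y r := fun r => by rw [evalAt_subst, hfy]
    refine ⟨he p, fun i => ?_⟩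
    rw [vrotL_apply, vrotL_apply, cross_cst, cross_cst]
    fin_cases i <;>
    · simp only [gradL_apply, hd, Fin.zero_eta, Fin.mk_one, Fin.reduceFinMk, Matrix.cons_val,
        evalAt_sub, evalAt_smul, he]
      ring

/-! ### Sup-norm calculus -/

/-- The components of `v` are bounded by `B` on `X`. -/
def FieldBound (X : Set E3) (v : VPoly3) (B : ℝ) : Prop := ∀ y ∈ X, ∀ i, |evalAt y (v i)| ≤ B

theorem FieldBound.mono {X : Set E3} {v : VPoly3} {A B : ℝ} (h : FieldBound X v A) (hAB : A ≤ B) :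
    FieldBound X v B := fun y hy i => (h y hy i).trans hAB

theorem FieldBound.add {X : Set E3} {v w : VPoly3} {A B : ℝ} (hv : FieldBound X v A)
    (hw : FieldBound X w B) : FieldBound X (v + w) (A + B) := fun y hy i => by
  rw [Pi.add_apply, evalAt_add]
  exact (abs_add_le _ _).trans (add_le_add (hv y hy i) (hw y hy i))

theorem FieldBound.sub {X : Set E3} {v w : VPoly3} {A B : ℝ} (hv : FieldBound X v A)
    (hw : FieldBound X w B) : FieldBound X (v - w) (A + B) := fun y hy i => by
  rw [Pi.sub_apply, evalAt_sub]
  exact (abs_sub _ _).trans (add_le_add (hv y hy i) (hw y hy i))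

theorem abs_apply_le_one {n : E3} (hn : ‖n‖ = 1) (i : Fin 3) : |n i| ≤ 1 := by
  rw [← hn, ← Real.norm_eq_abs]; exact PiLp.norm_apply_le n i

theorem abs_mul_sub_mul_le {a b c d A B : ℝ} (ha : |a| ≤ A) (hc : |c| ≤ A) (hb : |b| ≤ B)
    (hd : |d| ≤ B) : |a * b - c * d| ≤ 2 * (A * B) := by
  refine (abs_sub _ _).trans ?_
  rw [abs_mul, abs_mul]
  have h1 := mul_le_mul ha hb (abs_nonneg _) ((abs_nonneg _).trans ha)
  have h2 := mul_le_mul hc hd (abs_nonneg _) ((abs_nonneg _).trans hc)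
  linarith

theorem FieldBound.cross {X : Set E3} {v : VPoly3} {B : ℝ} (hv : FieldBound X v B) {n : E3}
    (hn : ‖n‖ = 1) : FieldBound X (v ⨯₃ cst n) (2 * B) := fun y hy i => by
  have h1 := abs_apply_le_one hn
  have h2 := hv y hy
  rw [cross_cst, ← one_mul B]
  fin_cases i <;>
  · simp only [Fin.zero_eta, Fin.mk_one, Fin.reduceFinMk, Matrix.cons_val, evalAt_sub, evalAt_smul]
    exact abs_mul_sub_mul_le (h1 _) (h1 _) (h2 _) (h2 _)

variable {μ : Measure E3} [IsFiniteMeasure μ]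

theorem abs_ipS_le_of_bound {X : Set E3} (hX : ∀ᵐ y ∂μ, y ∈ X) {p q : Poly3} {A B : ℝ}
    (hp : ∀ y ∈ X, |evalAt y p| ≤ A) (hq : ∀ y ∈ X, |evalAt y q| ≤ B) :
    |ipS μ p q| ≤ A * B * μ.real univ := by
  rw [← Real.norm_eq_abs]
  refine norm_integral_le_of_norm_le_const (hX.mono fun y hy => ?_)
  rw [Real.norm_eq_abs, evalAt_mul, abs_mul]
  exact mul_le_mul (hp y hy) (hq y hy) (abs_nonneg _) ((abs_nonneg _).trans (hp y hy))

theorem abs_ipV_le_of_bound {X : Set E3} (hX : ∀ᵐ y ∂μ, y ∈ X) {v w : VPoly3} {A B : ℝ}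
    (hv : FieldBound X v A) (hw : FieldBound X w B) :
    |ipV μ v w| ≤ 3 * (A * B) * μ.real univ := by
  rw [← Real.norm_eq_abs]
  refine norm_integral_le_of_norm_le_const (hX.mono fun y hy => ?_)
  have h : ∀ i, |evalAt y (v i) * evalAt y (w i)| ≤ A * B := fun i => by
    rw [abs_mul]
    exact mul_le_mul (hv y hy i) (hw y hy i) (abs_nonneg _) ((abs_nonneg _).trans (hv y hy i))
  rw [Real.norm_eq_abs, evalAt_dotProduct]
  refine (Finset.abs_sum_le_sum_abs _ _).trans ((Finset.sum_le_sum fun i _ => h i).trans_eq ?_)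
  simp

theorem abs_sum_mul_le {ι : Type*} {s : Finset ι} {f ω : ι → ℝ} {B C : ℝ} (hω : ∀ i, |ω i| = 1)
    (hf : ∀ i ∈ s, |f i| ≤ B) (hs : (s.card : ℝ) ≤ C) (hB : 0 ≤ B) :
    |∑ i ∈ s, ω i * f i| ≤ C * B := by
  refine (Finset.abs_sum_le_sum_abs _ _).trans ?_
  refine (Finset.sum_le_sum (g := fun _ => B) fun i hi => ?_).trans ?_
  · rw [abs_mul, hω, one_mul]; exact hf i hi
  · rw [Finset.sum_const, nsmul_eq_mul]
    exact mul_le_mul_of_nonneg_right hs hB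

/-- A polynomial that is constant in the direction `n` varies little if its rotated gradient on the
planes of normal `n` is small. -/
theorem abs_evalAt_sub_le {X : Set E3} (hX : Convex ℝ X) {n : E3} (hn : ‖n‖ = 1) {q : Poly3}
    (hq : dirDeriv n q = 0) {G : ℝ} (hG : FieldBound X (vrotL n q) G) {x y : E3} (hx : x ∈ X)
    (hy : y ∈ X) : |evalAt y q - evalAt x q| ≤ 6 * G * dist y x := by
  have hseg : ∀ t ∈ Icc (0 : ℝ) 1, x + t • (y - x) ∈ X := fun t ht =>
    hX.add_smul_sub_mem hx hy ht
  obtain ⟨t, ht, hslope⟩ := exists_hasDerivAt_eq_slope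
    (fun t : ℝ => evalAt (x + t • (y - x)) q)
    (fun t => evalAt (x + t • (y - x)) (dirDeriv (y - x) q)) zero_lt_one
    ((continuous_evalAt q).comp (by fun_prop)).continuousOn
    (fun t _ => hasDerivAt_evalAt_line x (y - x) q t)
  simp only [one_smul, zero_smul, add_zero, add_sub_cancel, sub_zero, div_one] at hslope
  rw [← hslope]
  set z := x + t • (y - x) with hz
  set w := y - x with hw
  have hzX : z ∈ X := hseg t ⟨ht.1.le, ht.2.le⟩
  have h0 : n 0 * evalAt z (pderiv 0 q) + n 1 * evalAt z (pderiv 1 q)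
      + n 2 * evalAt z (pderiv 2 q) = 0 := by
    have := congrArg (evalAt z) hq
    rwa [dirDeriv_apply, evalAt_sum, Fin.sum_univ_three, evalAt_smul, evalAt_smul, evalAt_smul,
      evalAt_zero] at this
  have hn' : n 0 * n 0 + n 1 * n 1 + n 2 * n 2 = 1 := by
    rw [← inner_eq, real_inner_self_eq_norm_sq, hn, one_pow]
  have hr := hG z hzX
  rw [vrotL_apply, cross_cst] at hr
  have hr0 := hr 0
  have hr1 := hr 1
  have hr2 := hr 2
  simp only [Matrix.cons_val, evalAt_sub, evalAt_smul, gradL_apply] at hr0 hr1 hr2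
  have hw' : ∀ i, |w i| ≤ dist y x := fun i => by
    rw [dist_eq_norm, ← Real.norm_eq_abs]; exact PiLp.norm_apply_le w i
  have h1 := abs_apply_le_one hn
  -- For a unit vector `n`, `∇q · w = (∇q × n) · (w × n) + (n · ∇q)(n · w)`, and the last term is
  -- zero. Each of the three products left is at most `2 G |y - x|`, whence the factor 6.
  have key : evalAt z (dirDeriv w q) =
      (n 2 * evalAt z (pderiv 1 q) - n 1 * evalAt z (pderiv 2 q)) * (n 2 * w 1 - n 1 * w 2)
      + (n 0 * evalAt z (pderiv 2 q) - n 2 * evalAt z (pderiv 0 q)) * (n 0 * w 2 - n 2 * w 0)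
      + (n 1 * evalAt z (pderiv 0 q) - n 0 * evalAt z (pderiv 1 q)) * (n 1 * w 0 - n 0 * w 1) := by
    rw [dirDeriv_apply, evalAt_sum, Fin.sum_univ_three, evalAt_smul, evalAt_smul, evalAt_smul]
    linear_combination (-(w 0 * evalAt z (pderiv 0 q) + w 1 * evalAt z (pderiv 1 q)
      + w 2 * evalAt z (pderiv 2 q))) * hn' + (n 0 * w 0 + n 1 * w 1 + n 2 * w 2) * h0
  have hb : ∀ i j, |n i * w j - n j * w i| ≤ 2 * (1 * dist y x) := fun i j =>
    abs_mul_sub_mul_le (h1 i) (h1 j) (hw' j) (hw' i)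
  have hG0 : 0 ≤ G := (abs_nonneg _).trans hr0
  have hprod : ∀ a b : ℝ, |a| ≤ G → |b| ≤ 2 * (1 * dist y x) → |a * b| ≤ 2 * G * dist y x :=
    fun a b ha hb => by
      rw [abs_mul]
      refine (mul_le_mul ha hb (abs_nonneg _) hG0).trans_eq ?_
      ring
  rw [key]
  have e0 := hprod _ _ hr0 (hb 2 1)
  have e1 := hprod _ _ hr1 (hb 0 2)
  have e2 := hprod _ _ hr2 (hb 1 0)
  have e3 := abs_add_three (_ : ℝ) _ _ |>.trans (add_le_add (add_le_add e0 e1) e2)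
  exact e3.trans_eq (by ring)

theorem convex_hull {Ω : Set E3} (M : PolyMesh Ω) (T : Fin M.nT) : Convex ℝ (M.hull T) :=
  convex_convexHull ℝ _

/-- If the square of `G` is controlled by `I` and `I` by `a G`, then `G` is controlled by `a`. -/
theorem le_of_sq_le_of_le {C a h I : ℝ} (hC : 0 ≤ C) (ha : 0 ≤ a) (hh : 0 < h)
    (hI : 0 ≤ I) (hle : I ≤ a * √(C * I / h) * h) : √(C * I / h) ≤ C * a := by
  set G := √(C * I / h) with hG
  have hG0 : 0 ≤ G := Real.sqrt_nonneg _
  have hsq : G * G = C * I / h := Real.mul_self_sqrt (by positivity)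
  have h1 : G * G ≤ C * a * G := by
    rw [hsq, div_le_iff₀ hh]
    calc C * I ≤ C * (a * G * h) := mul_le_mul_of_nonneg_left hle hC
      _ = _ := by ring
  rcases hG0.eq_or_lt with h0 | h0
  · rw [← h0]; positivity
  · exact le_of_mul_le_mul_right h1 h0

namespace PolyMesh
variable {Ω : Set E3} {M : PolyMesh Ω}

theorem ipS_apply_le_ipV {ν : Measure E3} (hν : PolyIntegrable ν) (v : VPoly3) (i : Fin 3) :
    ipS ν (v i) (v i) ≤ ipV ν v v := by
  rw [ipV_eq_sum hν]
  exact Finset.single_le_sum (f := fun i => ipS ν (v i) (v i)) (fun i _ => ipS_self_nonneg _)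
    (Finset.mem_univ i)

theorem abs_omegaTF (T : Fin M.nT) (F : Fin M.nF) : |M.omegaTF T F| = 1 := by
  rw [omegaTF]; split_ifs <;> simp

theorem abs_omegaFE (F : Fin M.nF) (E : Fin M.nE) : |M.omegaFE F E| = 1 := by
  rw [omegaFE]; split_ifs <;> simp

/-! ### Sup-norm stability of projections, curls and potentials -/

namespace MeshBound
variable {k : ℕ} {C : ℝ} (hM : MeshBound M k C)
include hM

theorem pos : 0 < C := zero_lt_one.trans_le hM.one_le

/-- The self-testing principle: it suffices to bound the energy of `g` linearly in an arbitrary sup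
bound `G` of `g`. The bound `G` given by the energy itself then satisfies `G ^ 2 ≤ C a G`. -/
theorem fieldBound_face {T : Fin M.nT} {F : Fin M.nF} (hF : F ∈ M.facesOf T) {g : VPoly3}
    (hg : g ∈ VPF ((k : ℤ) + 1) (M.normal F)) {a : ℝ} (ha : 0 ≤ a)
    (h : ∀ G, 0 ≤ G → FieldBound (M.hull T) g G → ipV (M.mF F) g g ≤ a * G * M.hT T ^ 2) :
    FieldBound (M.hull T) g (C * a) := by
  have hT := hM.hT_pos T
  have hb : FieldBound (M.hull T) g √(C * ipV (M.mF F) g g / M.hT T ^ 2) := fun y hy i => by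
    refine Real.abs_le_sqrt ?_
    rw [le_div_iff₀ (by positivity), mul_comm]
    exact (hM.sup_face T F hF _ ((mem_VPF.1 hg).1 i) y hy).trans (mul_le_mul_of_nonneg_left
      (ipS_apply_le_ipV (M.integrable_mF F) g i) hM.pos.le)
  exact hb.mono (le_of_sq_le_of_le hM.pos.le ha (by positivity) (ipV_self_nonneg _)
    (h _ (Real.sqrt_nonneg _) hb))

theorem fieldBound_elem {T : Fin M.nT} {g : VPoly3} (hg : g ∈ VP ((k : ℤ) + 1)) {a : ℝ}
    (ha : 0 ≤ a)
    (h : ∀ G, 0 ≤ G → FieldBound (M.hull T) g G → ipV (M.mT T) g g ≤ a * G * M.hT T ^ 3) :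
    FieldBound (M.hull T) g (C * a) := by
  have hT := hM.hT_pos T
  have hb : FieldBound (M.hull T) g √(C * ipV (M.mT T) g g / M.hT T ^ 3) := fun y hy i => by
    refine Real.abs_le_sqrt ?_
    rw [le_div_iff₀ (by positivity), mul_comm]
    exact ((hM.sup_elem T _ (mem_VP.1 hg i) y hy).1).trans (mul_le_mul_of_nonneg_left
      (ipS_apply_le_ipV (M.integrable_mT T) g i) hM.pos.le)
  exact hb.mono (le_of_sq_le_of_le hM.pos.le ha (by positivity) (ipV_self_nonneg _)
    (h _ (Real.sqrt_nonneg _) hb))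

theorem abs_ipV_elem_le {T : Fin M.nT} {v w : VPoly3} {A B : ℝ} (hA : 0 ≤ A) (hB : 0 ≤ B)
    (hv : FieldBound (M.hull T) v A) (hw : FieldBound (M.hull T) w B) :
    |ipV (M.mT T) v w| ≤ 3 * C * A * B * M.hT T ^ 3 := by
  refine (abs_ipV_le_of_bound (ae_mT T) hv hw).trans ?_
  have := mul_le_mul_of_nonneg_left (hM.volume_le T) (by positivity : 0 ≤ 3 * (A * B))
  linarith

theorem abs_ipV_face_le {T : Fin M.nT} {F : Fin M.nF} (hF : F ∈ M.facesOf T) {v w : VPoly3}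
    {A B : ℝ} (hA : 0 ≤ A) (hB : 0 ≤ B)
    (hv : FieldBound (M.hull T) v A) (hw : FieldBound (M.hull T) w B) :
    |ipV (M.mF F) v w| ≤ 3 * C * A * B * M.hT T ^ 2 := by
  refine (abs_ipV_le_of_bound (ae_mF_hull hF) hv hw).trans ?_
  have := mul_le_mul_of_nonneg_left (hM.area_le T F hF) (by positivity : 0 ≤ 3 * (A * B))
  linarith

theorem abs_ipS_face_le {T : Fin M.nT} {F : Fin M.nF} (hF : F ∈ M.facesOf T) {p q : Poly3}
    {A B : ℝ} (hA : 0 ≤ A) (hB : 0 ≤ B) (hp : ∀ y ∈ M.hull T, |evalAt y p| ≤ A)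
    (hq : ∀ y ∈ M.hull T, |evalAt y q| ≤ B) : |ipS (M.mF F) p q| ≤ C * A * B * M.hT T ^ 2 := by
  refine (abs_ipS_le_of_bound (ae_mF_hull hF) hp hq).trans ?_
  have := mul_le_mul_of_nonneg_left (hM.area_le T F hF) (by positivity : 0 ≤ A * B)
  linarith

omit hM in
theorem abs_ipS_edge_le {T : Fin M.nT} {E : Fin M.nE} (hE : E ∈ M.elemEdges T) {p q : Poly3}
    {A B : ℝ} (hA : 0 ≤ A) (hB : 0 ≤ B) (hp : ∀ y ∈ M.hull T, |evalAt y p| ≤ A)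
    (hq : ∀ y ∈ M.hull T, |evalAt y q| ≤ B) : |ipS (M.mE E) p q| ≤ A * B * M.hT T :=
  (abs_ipS_le_of_bound (ae_mE_hull hE) hp hq).trans
    (mul_le_mul_of_nonneg_left ((mE_real_le E).trans (len_le_hT hE)) (by positivity))

/-- Sup-norm stability of `L²` projections. Only the energy identity is assumed, so that it also
applies to the components of an orthogonal decomposition. -/
theorem fieldBound_face_proj {T : Fin M.nT} {F : Fin M.nF} (hF : F ∈ M.facesOf T) {g v : VPoly3}
    (hg : g ∈ VPF ((k : ℤ) + 1) (M.normal F)) {A : ℝ} (hA : 0 ≤ A)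
    (hv : FieldBound (M.hull T) v A) (h : ipV (M.mF F) g g = ipV (M.mF F) v g) :
    FieldBound (M.hull T) g (3 * C ^ 2 * A) := by
  have hC := hM.pos
  refine (hM.fieldBound_face hF hg (a := 3 * C * A) (by positivity) fun G hG hb => ?_).mono
    (by linarith)
  rw [h]
  exact (le_abs_self _).trans (hM.abs_ipV_face_le hF hA hG hv hb)

theorem fieldBound_elem_proj {T : Fin M.nT} {g v : VPoly3} (hg : g ∈ VP ((k : ℤ) + 1)) {A : ℝ}
    (hA : 0 ≤ A) (hv : FieldBound (M.hull T) v A) (h : ipV (M.mT T) g g = ipV (M.mT T) v g) :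
    FieldBound (M.hull T) g (3 * C ^ 2 * A) := by
  have hC := hM.pos
  refine (hM.fieldBound_elem hg (a := 3 * C * A) (by positivity) fun G hG hb => ?_).mono
    (by linarith)
  rw [h]
  exact (le_abs_self _).trans (hM.abs_ipV_elem_le hA hG hv hb)

/-- An inverse inequality: one derivative costs `1 / h_T`. -/
theorem fieldBound_curlL {T : Fin M.nT} {v : VPoly3} (hv : v ∈ VP ((k : ℤ) + 1)) {G : ℝ}
    (hG : 0 ≤ G) (hb : FieldBound (M.hull T) v G) :
    FieldBound (M.hull T) (curlL v) (2 * (C * (G / M.hT T))) := by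
  have hT := hM.hT_pos T
  have hC := hM.pos
  intro y hy
  have hd : ∀ i j, |evalAt y (pderiv i (v j))| ≤ C * (G / M.hT T) := fun i j => by
    refine abs_le_of_sq_le_sq ?_ (by positivity)
    have h1 := (hM.sup_elem T _ (mem_VP.1 hv j) y hy).2 i
    have h2 := (le_abs_self _).trans (abs_ipS_le_of_bound (ae_mT T) (fun y hy => hb y hy j)
      (fun y hy => hb y hy j))
    have h3 := mul_le_mul_of_nonneg_left (hM.volume_le T) (by positivity : 0 ≤ G * G)
    have h4 : M.hT T ^ 5 * evalAt y (pderiv i (v j)) ^ 2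
        ≤ M.hT T ^ 5 * (C * (G / M.hT T)) ^ 2 := by
      refine h1.trans ((mul_le_mul_of_nonneg_left (h2.trans h3) hC.le).trans_eq ?_)
      field_simp
    exact le_of_mul_le_mul_left h4 (by positivity)
  have hs : ∀ i j i' j', |evalAt y (pderiv i (v j) - pderiv i' (v j'))| ≤ 2 * (C * (G / M.hT T)) :=
    fun i j i' j' => by
      rw [evalAt_sub]
      refine (abs_sub _ _).trans ?_
      linarith [hd i j, hd i' j']
  intro i
  rw [curlL_apply]
  fin_cases i <;> exact hs _ _ _ _

/-- The field `w` differs by a gradient `g` from a field controlled by its curl. As `w` is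
orthogonal to gradients, its energy equals its product with `w - g`, and the stability of
projections applies. -/
theorem fieldBound_of_curlL {T : Fin M.nT} {ℓ : ℤ} (hℓ : (k : ℤ) ≤ ℓ) (hℓ' : ℓ ≤ k + 1)
    {w : VPoly3} (hw : w ∈ M.GolyPerp ℓ T) {G : ℝ} (hG : 0 ≤ G)
    (hb : FieldBound (M.hull T) (curlL w) G) :
    FieldBound (M.hull T) w (6 * C ^ 3 * M.hT T * G) := by
  have hT := hM.hT_pos T
  have hC := hM.pos
  obtain ⟨g, hg, h⟩ := hM.potential ℓ hℓ hℓ' T w hw.1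
  have hdiff : FieldBound (M.hull T) (w - g) (2 * C * M.hT T * G) := fun y hy i => by
    refine abs_le_of_sq_le_sq ?_ (by positivity)
    have h1 := h y hy i
    have h2 := mul_le_mul_of_nonneg_left
      ((le_abs_self _).trans (hM.abs_ipV_elem_le hG hG hb hb)) hC.le
    have h3 : C * (3 * C * G * G * M.hT T ^ 3) ≤ M.hT T * (2 * C * M.hT T * G) ^ 2 := by
      have : 0 ≤ C ^ 2 * G ^ 2 * M.hT T ^ 3 := by positivity
      nlinarith
    exact le_of_mul_le_mul_left (h1.trans (h2.trans h3)) hT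
  have hself : ipV (M.mT T) w w = ipV (M.mT T) (w - g) w := by
    have h1 := LinearMap.map_sub₂ (bilV (M.integrable_mT T)) w g w
    have h2 : ipV (M.mT T) g w = 0 := by rw [ipV_comm]; exact hw.2 g hg
    change ipV (M.mT T) (w - g) w = ipV (M.mT T) w w - ipV (M.mT T) g w at h1
    rw [h1, h2, sub_zero]
  refine (hM.fieldBound_elem_proj (VP_mono hℓ' hw.1) (by positivity) hdiff hself).mono ?_
  exact le_of_eq (by ring)

/-- The sup estimate on faces applied to the constant 1. -/
theorem area_pos (F : Fin M.nF) : 0 < (M.mF F).real univ := by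
  obtain ⟨T, hF⟩ := exists_mem_facesOf F
  have hT := hM.hT_pos T
  obtain ⟨x, hx⟩ := M.face_nonempty F
  have h1 := hM.sup_face T F hF (MvPolynomial.C 1) (C_mem_PF (by positivity) _ _) x
    (closure_subset_hull T (face_subset_closure hF hx))
  have h2 : ipS (M.mF F) (MvPolynomial.C 1) (MvPolynomial.C 1) = (M.mF F).real univ := by
    unfold ipS; simp
  rw [h2, evalAt_C] at h1
  have h3 : 0 < M.hT T ^ 2 * 1 ^ 2 := by positivity
  exact pos_of_mul_pos_right (h3.trans_le h1) hM.pos.le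

/-- A Poincaré inequality on the face: `q(y)` is the mean over `x` in `F` of `q(y) - q(x)`, which
the rotated gradient controls. -/
theorem abs_evalAt_le_of_mean_zero {T : Fin M.nT} {F : Fin M.nF} (hF : F ∈ M.facesOf T)
    {q : Poly3} (hq : dirDeriv (M.normal F) q = 0) (hmean : ∫ x, evalAt x q ∂(M.mF F) = 0) {G : ℝ}
    (hG : FieldBound (M.hull T) (vrotL (M.normal F) q) G) {y : E3} (hy : y ∈ M.hull T) :
    |evalAt y q| ≤ 6 * G * M.hT T := by
  have hG0 : 0 ≤ G := (abs_nonneg _).trans (hG y hy 0)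
  have hpos := hM.area_pos F
  have h1 : ∫ x, (evalAt y q - evalAt x q) ∂(M.mF F) = (M.mF F).real univ * evalAt y q := by
    rw [integral_sub (integrable_const _) (M.integrable_mF F q), hmean, integral_const, sub_zero,
      smul_eq_mul]
  have h2 : ‖∫ x, (evalAt y q - evalAt x q) ∂(M.mF F)‖ ≤ 6 * G * M.hT T * (M.mF F).real univ := by
    refine norm_integral_le_of_norm_le_const ((ae_mF_hull hF).mono fun x hx => ?_)
    rw [Real.norm_eq_abs]
    exact (abs_evalAt_sub_le (convex_hull M T) (M.normal_unit F) hq hG hx hy).trans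
      (mul_le_mul_of_nonneg_left (dist_le_of_mem_hull hy hx) (by positivity))
  rw [h1, Real.norm_eq_abs, abs_mul, abs_of_pos hpos, mul_comm] at h2
  exact le_of_mul_le_mul_right h2 hpos

/-- Self-testing with `a = 0`: zero energy forces a zero sup norm, and the hull contains a ball. -/
theorem definite_elem (T : Fin M.nT) {v : VPoly3} (hv : v ∈ VP ((k : ℤ) + 1))
    (h : ipV (M.mT T) v v = 0) : v = 0 := by
  have hb := hM.fieldBound_elem hv le_rfl (T := T) (fun G _ _ => by rw [h]; simp)
  rw [mul_zero] at hb
  obtain ⟨x, hx⟩ := M.elem_nonempty T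
  obtain ⟨ε, hε, hball⟩ := Metric.isOpen_iff.1 (M.isOpen_elem T) x hx
  funext i
  exact eq_zero_of_evalAt_ball hε fun y hy => abs_nonpos_iff.1
    (hb y (closure_subset_hull T (subset_closure (hball hy))) i)

theorem definite_face (F : Fin M.nF) {v : VPoly3} (hv : v ∈ VPF ((k : ℤ) + 1) (M.normal F))
    (h : ipV (M.mF F) v v = 0) : v = 0 := by
  obtain ⟨T, hF⟩ := exists_mem_facesOf F
  have hb := hM.fieldBound_face hF hv le_rfl (fun G _ _ => by rw [h]; simp)
  rw [mul_zero] at hb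
  obtain ⟨x, hx⟩ := M.elem_nonempty T
  obtain ⟨ε, hε, hball⟩ := Metric.isOpen_iff.1 (M.isOpen_elem T) x hx
  funext i
  exact eq_zero_of_evalAt_ball hε fun y hy => abs_nonpos_iff.1
    (hb y (closure_subset_hull T (subset_closure (hball hy))) i)

theorem definite_face_scalar (F : Fin M.nF) {p : Poly3}
    (hp : p ∈ PF ((k : ℤ) + 1) (M.normal F)) (h : ipS (M.mF F) p p = 0) : p = 0 := by
  obtain ⟨T, hF⟩ := exists_mem_facesOf F
  obtain ⟨x, hx⟩ := M.elem_nonempty T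
  obtain ⟨ε, hε, hball⟩ := Metric.isOpen_iff.1 (M.isOpen_elem T) x hx
  refine eq_zero_of_evalAt_ball (x := x) hε fun y hy => ?_
  have h1 := hM.sup_face T F hF p hp y (closure_subset_hull T (subset_closure (hball hy)))
  rw [h, mul_zero] at h1
  have hT := hM.hT_pos T
  exact pow_eq_zero_iff two_ne_zero |>.1
    (le_antisymm (nonpos_of_mul_nonpos_right h1 (by positivity)) (sq_nonneg _))

end MeshBound
end PolyMesh

/-! ### Variational characterisations of the reconstructions -/

section Bilinear
variable {μ : Measure E3} (hμ : PolyIntegrable μ)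
include hμ

theorem ipS_add_left (p q r : Poly3) : ipS μ (p + q) r = ipS μ p r + ipS μ q r :=
  LinearMap.map_add₂ (bilS hμ) p q r
theorem ipS_sub_left (p q r : Poly3) : ipS μ (p - q) r = ipS μ p r - ipS μ q r :=
  LinearMap.map_sub₂ (bilS hμ) p q r
theorem ipS_sub_right (p q r : Poly3) : ipS μ p (q - r) = ipS μ p q - ipS μ p r :=
  map_sub (bilS hμ p) q r
theorem ipV_add_left (p q r : VPoly3) : ipV μ (p + q) r = ipV μ p r + ipV μ q r :=
  LinearMap.map_add₂ (bilV hμ) p q r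
theorem ipV_sub_left (p q r : VPoly3) : ipV μ (p - q) r = ipV μ p r - ipV μ q r :=
  LinearMap.map_sub₂ (bilV hμ) p q r
theorem ipV_add_right (p q r : VPoly3) : ipV μ p (q + r) = ipV μ p q + ipV μ p r :=
  map_add (bilV hμ p) q r

theorem projOn_spec {W : Submodule ℝ VPoly3} [FiniteDimensional ℝ W]
    (hpos : ∀ w ∈ W, ipV μ w w = 0 → w = 0) (f : VPoly3) :
    ∀ w ∈ W, ipV μ (projOn μ W f) w = ipV μ f w := by
  obtain ⟨g, hg, h⟩ := exists_riesz (bilV hμ) W hpos (bilV hμ f)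
  exact Classical.epsilon_spec (p := fun g : W => ∀ w ∈ W, ipV μ g w = ipV μ f w) ⟨⟨g, hg⟩, h⟩

theorem projOn_eq_zero {W : Submodule ℝ VPoly3} [FiniteDimensional ℝ W]
    (hpos : ∀ w ∈ W, ipV μ w w = 0 → w = 0) {f : VPoly3} (hf : ∀ w ∈ W, ipV μ f w = 0) :
    projOn μ W f = 0 := by
  refine Subtype.ext (hpos _ (projOn μ W f).2 ?_)
  rw [projOn_spec hμ hpos f _ (projOn μ W f).2, hf _ (projOn μ W f).2]

end Bilinear

theorem ipS_zero_left (μ : Measure E3) (p : Poly3) : ipS μ 0 p = 0 := by simp [ipS]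
theorem ipV_zero_left (μ : Measure E3) (p : VPoly3) : ipV μ 0 p = 0 := by simp [ipV]

/-- The linear map `v ↦ v × n`. -/
noncomputable def crossL (n : E3) : VPoly3 →ₗ[ℝ] VPoly3 :=
  ((crossProduct (R := Poly3)).flip (cst n)).restrictScalars ℝ

namespace PolyMesh
variable {Ω : Set E3} {M : PolyMesh Ω} {k : ℕ}

theorem compRF_add (υ ζ : M.Xcurl k) (F : Fin M.nF) :
    M.compRF (υ + ζ) F = M.compRF υ F + M.compRF ζ F := rfl
theorem compRFperp_add (υ ζ : M.Xcurl k) (F : Fin M.nF) :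
    M.compRFperp (υ + ζ) F = M.compRFperp υ F + M.compRFperp ζ F := rfl
theorem compRT_add (υ ζ : M.Xcurl k) (T : Fin M.nT) :
    M.compRT (υ + ζ) T = M.compRT υ T + M.compRT ζ T := rfl
theorem compE_add (υ ζ : M.Xcurl k) (E : Fin M.nE) :
    M.compE (υ + ζ) E = M.compE υ E + M.compE ζ E := rfl

/-- The edge part of the face operators. -/
noncomputable def edgeL (υ : M.Xcurl k) (F : Fin M.nF) : Poly3 →ₗ[ℝ] ℝ :=
  ∑ E ∈ M.edgesOf F, M.omegaFE F E • bilS (integrable_mE E) (M.compE υ E)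

theorem edgeL_apply (υ : M.Xcurl k) (F : Fin M.nF) (q : Poly3) :
    edgeL υ F q = ∑ E ∈ M.edgesOf F, M.omegaFE F E * ipS (M.mE E) (M.compE υ E) q := by
  rw [edgeL, LinearMap.sum_apply]; rfl

theorem edgeL_add (υ ζ : M.Xcurl k) (F : Fin M.nF) (q : Poly3) :
    edgeL (υ + ζ) F q = edgeL υ F q + edgeL ζ F q := by
  rw [edgeL_apply, edgeL_apply, edgeL_apply, ← Finset.sum_add_distrib]
  refine Finset.sum_congr rfl fun E _ => ?_
  rw [compE_add, ipS_add_left (integrable_mE E), mul_add]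

/-- The face part of the element operators. -/
noncomputable def faceL (υ : M.Xcurl k) (T : Fin M.nT) : VPoly3 →ₗ[ℝ] ℝ :=
  ∑ F ∈ M.facesOf T, M.omegaTF T F • (bilV (M.integrable_mF F) (M.gammaT υ F)).comp
    (crossL (M.normal F))

theorem faceL_apply (υ : M.Xcurl k) (T : Fin M.nT) (τ : VPoly3) :
    faceL υ T τ = ∑ F ∈ M.facesOf T, M.omegaTF T F *
      ipV (M.mF F) (M.gammaT υ F) (τ ⨯₃ cst (M.normal F)) := by
  rw [faceL, LinearMap.sum_apply]; rfl

/-! ### Solvability of the local problems and the equations they satisfy -/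

namespace MeshBound
variable {C : ℝ} (hM : MeshBound M k C)
include hM

theorem exists_sub_mean_zero (F : Fin M.nF) (r : Poly3) :
    ∃ c : ℝ, ∫ x, evalAt x (r - MvPolynomial.C c) ∂(M.mF F) = 0 := by
  have hpos := hM.area_pos F
  refine ⟨(∫ x, evalAt x r ∂(M.mF F)) / (M.mF F).real univ, ?_⟩
  simp only [evalAt_sub, evalAt_C]
  rw [integral_sub (M.integrable_mF F r) (integrable_const _), integral_const, smul_eq_mul,
    mul_div_cancel₀ _ hpos.ne', sub_self]

theorem eq_zero_of_vrotL_eq_zero (F : Fin M.nF) {r : Poly3} {ℓ : ℤ} (hr : r ∈ PF ℓ (M.normal F))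
    (hmean : ∫ x, evalAt x r ∂(M.mF F) = 0) (h : vrotL (M.normal F) r = 0) : r = 0 := by
  obtain ⟨T, hF⟩ := exists_mem_facesOf F
  obtain ⟨x, hx⟩ := M.elem_nonempty T
  obtain ⟨ε, hε, hball⟩ := Metric.isOpen_iff.1 (M.isOpen_elem T) x hx
  refine eq_zero_of_evalAt_ball (x := x) hε fun y hy => ?_
  have := hM.abs_evalAt_le_of_mean_zero hF hr.2 hmean (G := 0) (fun y _ i => by simp [h])
    (closure_subset_hull T (subset_closure (hball hy)))
  rw [mul_zero, zero_mul] at this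
  exact abs_nonpos_iff.1 this

/-- The discrete Neumann problem. The form is definite only modulo constants, so it is solved on
functions of zero mean; as `L` vanishes on constants, the equation extends to all test functions. -/
theorem exists_rot_riesz (F : Fin M.nF) {ℓ : ℤ} (hℓ : 0 ≤ ℓ) (hℓ' : ℓ ≤ k + 1)
    (L : Poly3 →ₗ[ℝ] ℝ) (hL : ∀ c, L (MvPolynomial.C c) = 0) :
    ∃ r₀ ∈ PF ℓ (M.normal F), ∫ x, evalAt x r₀ ∂(M.mF F) = 0 ∧ ∀ r ∈ PF ℓ (M.normal F),
      ipV (M.mF F) (vrotL (M.normal F) r₀) (vrotL (M.normal F) r) = L r := by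
  set n := M.normal F
  let W : Submodule ℝ Poly3 := PF ℓ n ⊓ LinearMap.ker (bilS (M.integrable_mF F) 1)
  have hW : ∀ r, r ∈ W ↔ r ∈ PF ℓ n ∧ ∫ x, evalAt x r ∂(M.mF F) = 0 := fun r => by
    rw [Submodule.mem_inf, LinearMap.mem_ker]
    change _ ∧ ∫ x, evalAt x (1 * r) ∂(M.mF F) = 0 ↔ _
    rw [one_mul]
  have : FiniteDimensional ℝ W := finite_of_le (B := PF ℓ n) inf_le_left
  let b : LinearMap.BilinForm ℝ Poly3 := (bilV (M.integrable_mF F)).compl₁₂ (vrotL n) (vrotL n)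
  have hmem : ∀ {r}, r ∈ PF ℓ n → vrotL n r ∈ VPF ((k : ℤ) + 1) n := fun {r} hr =>
    VPF_mono (by omega : ℓ - 1 ≤ k + 1) n (vrotL_mem_VPF (by rwa [sub_add_cancel]))
  obtain ⟨r₀, hr₀, h⟩ := exists_riesz b W (fun r hr h0 => by
    obtain ⟨hr1, hr2⟩ := (hW r).1 hr
    exact hM.eq_zero_of_vrotL_eq_zero F hr1 hr2 (hM.definite_face F (hmem hr1) h0)) L
  obtain ⟨h1, h2⟩ := (hW r₀).1 hr₀
  refine ⟨r₀, h1, h2, fun r hr => ?_⟩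
  obtain ⟨c, hc⟩ := hM.exists_sub_mean_zero F r
  have h3 := h _ ((hW _).2 ⟨Submodule.sub_mem _ hr (C_mem_PF hℓ n c), hc⟩)
  change ipV (M.mF F) (vrotL n r₀) (vrotL n (r - MvPolynomial.C c)) = _ at h3
  rwa [map_sub, map_sub, hL, vrotL_C, sub_zero, sub_zero] at h3

theorem exists_face_decomposition (F : Fin M.nF) {v : VPoly3} (hv : v ∈ VPF k (M.normal F)) :
    ∃ r ∈ PF ((k : ℤ) + 1) (M.normal F), ∫ x, evalAt x r ∂(M.mF F) = 0 ∧
      ∃ τ ∈ M.RolyFPerp k F, v = vrotL (M.normal F) r + τ ∧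
        ipV (M.mF F) (vrotL (M.normal F) r) (vrotL (M.normal F) r)
          = ipV (M.mF F) v (vrotL (M.normal F) r) := by
  set n := M.normal F
  have := finite_of_le (RolyF_le k n)
  obtain ⟨g, ⟨r, hr, rfl⟩, h⟩ := exists_perpIn_decomposition (M.integrable_mF F) (RolyF_le k n)
    (fun w hw h0 => hM.definite_face F (VPF_mono (by omega) n (RolyF_le k n hw)) h0) hv
  obtain ⟨c, hc⟩ := hM.exists_sub_mean_zero F r
  have hrot : vrotL n (r - MvPolynomial.C c) = vrotL n r := by rw [map_sub, vrotL_C, sub_zero]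
  refine ⟨_, Submodule.sub_mem _ hr (C_mem_PF (by positivity) n c), hc, _, h, ?_, ?_⟩
  · rw [hrot]; abel
  · rw [hrot]
    have h1 := h.2 (vrotL n r) ⟨r, hr, rfl⟩
    rw [ipV_sub_left (M.integrable_mF F)] at h1
    linarith

/-- Curls and gradients being independent, the field under the curl can be made orthogonal to
gradients without changing its curl. The energy identity is what the stability of projections needs.
-/
theorem exists_elem_decomposition (T : Fin M.nT) {v : VPoly3} (hv : v ∈ VP k) :
    ∃ w ∈ M.GolyPerp ((k : ℤ) + 1) T, ∃ τ ∈ M.RolyPerp k T, v = curlL w + τ ∧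
      ipV (M.mT T) (curlL w) (curlL w) = ipV (M.mT T) v (curlL w) := by
  have := finite_of_le (Roly_le k)
  have := finite_of_le (Goly_le ((k : ℤ) + 1))
  obtain ⟨_, ⟨w, hw, rfl⟩, h⟩ := exists_perpIn_decomposition (M.integrable_mT T) (Roly_le k)
    (fun w hw h0 => hM.definite_elem T (VP_mono (by omega) (Roly_le k hw)) h0) hv
  obtain ⟨g, hg, h'⟩ := exists_perpIn_decomposition (M.integrable_mT T) (Goly_le ((k : ℤ) + 1))
    (fun w hw h0 => hM.definite_elem T (Goly_le _ hw) h0) hw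
  have hcurl : curlL (w - g) = curlL w := by
    obtain ⟨p, -, rfl⟩ := hg
    rw [map_sub, curlL_gradL, sub_zero]
  refine ⟨w - g, h', _, h, ?_, ?_⟩
  · rw [hcurl]; abel
  · rw [hcurl]
    have h1 := h.2 (curlL w) ⟨w, hw, rfl⟩
    rw [ipV_sub_left (M.integrable_mT T)] at h1
    linarith

/-- The curl is injective on the orthogonal complement of the gradients, so the curl-curl form is
definite there. -/
theorem exists_curl_riesz (T : Fin M.nT) {ℓ : ℤ} (hℓ : ℓ ≤ k + 1) (L : VPoly3 →ₗ[ℝ] ℝ) :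
    ∃ w₀ ∈ M.GolyPerp ℓ T, ∀ w ∈ M.GolyPerp ℓ T,
      ipV (M.mT T) (curlL w₀) (curlL w) = L w := by
  have : FiniteDimensional ℝ (M.GolyPerp ℓ T) := finite_of_le (B := VP ℓ) (perpIn_le _ _ _)
  have hVP : VP ℓ ≤ VP ((k : ℤ) + 1) := VP_mono hℓ
  let b : LinearMap.BilinForm ℝ VPoly3 := (bilV (M.integrable_mT T)).compl₁₂ curlL curlL
  exact exists_riesz b (M.GolyPerp ℓ T) (fun w hw h0 => by
    have h1 : curlL w = 0 := hM.definite_elem T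
      (VP_mono (by omega : ℓ - 1 ≤ k + 1) (curlL_mem_VP (by rw [sub_add_cancel]; exact hw.1))) h0
    exact eq_zero_of_mem_perpIn (fun w hw h0 => hM.definite_elem T (hVP (Goly_le _ hw)) h0) hw
      (mem_Goly_of_curlL_eq_zero hw.1 h1)) L

theorem faceCurl_spec (υ : M.Xcurl k) (F : Fin M.nF) : ∀ q ∈ PF k (M.normal F),
    ipS (M.mF F) (M.faceCurl υ F) q
      = ipV (M.mF F) (M.compRF υ F) (vrotL (M.normal F) q) - edgeL υ F q := by
  obtain ⟨g, hg, h⟩ := exists_riesz (bilS (M.integrable_mF F)) (PF k (M.normal F))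
    (fun w hw h0 => hM.definite_face_scalar F (PF_mono (by omega) _ hw) h0)
    ((bilV (M.integrable_mF F) (M.compRF υ F)).comp (vrotL (M.normal F)) - edgeL υ F)
  simp only [edgeL_apply]
  refine Classical.epsilon_spec (p := fun c : PF k (M.normal F) => ∀ q ∈ PF k (M.normal F),
    ipS (M.mF F) c q = ipV (M.mF F) (M.compRF υ F) (vrotL (M.normal F) q)
      - ∑ E ∈ M.edgesOf F, M.omegaFE F E * ipS (M.mE E) (M.compE υ E) q)
    ⟨⟨g, hg⟩, fun q hq => (h q hq).trans ?_⟩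
  rw [LinearMap.sub_apply, edgeL_apply]; rfl

theorem faceCurl_eq {υ : M.Xcurl k} {F : Fin M.nF} {c : Poly3} (hc : c ∈ PF k (M.normal F))
    (h : ∀ q ∈ PF k (M.normal F), ipS (M.mF F) c q
      = ipV (M.mF F) (M.compRF υ F) (vrotL (M.normal F) q) - edgeL υ F q) :
    (M.faceCurl υ F : Poly3) = c := by
  have hd : (M.faceCurl υ F : Poly3) - c ∈ PF k (M.normal F) :=
    Submodule.sub_mem _ (M.faceCurl υ F).2 hc
  refine sub_eq_zero.1 (hM.definite_face_scalar F (PF_mono (by omega) _ hd) ?_)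
  rw [ipS_sub_left (M.integrable_mF F), hM.faceCurl_spec υ F _ hd, h _ hd, sub_self]

theorem faceCurl_add (υ ζ : M.Xcurl k) (F : Fin M.nF) :
    (M.faceCurl (υ + ζ) F : Poly3) = M.faceCurl υ F + M.faceCurl ζ F :=
  hM.faceCurl_eq (Submodule.add_mem _ (M.faceCurl υ F).2 (M.faceCurl ζ F).2) fun q hq => by
    rw [ipS_add_left (M.integrable_mF F), hM.faceCurl_spec υ F q hq, hM.faceCurl_spec ζ F q hq,
      compRF_add, ipV_add_left (M.integrable_mF F), edgeL_add]
    ring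

/-- The discrete Stokes formula on a face, from the test function `q = c`, whose rotated gradient is
zero. It is the compatibility condition behind both the tangential potential and the correction. -/
theorem faceCurl_add_edgeL_C (υ : M.Xcurl k) (F : Fin M.nF) (c : ℝ) :
    ipS (M.mF F) (M.faceCurl υ F) (MvPolynomial.C c) + edgeL υ F (MvPolynomial.C c) = 0 := by
  rw [hM.faceCurl_spec υ F _ (C_mem_PF (by positivity) _ c), vrotL_C, ipV_comm, ipV_zero_left]
  ring

/-- The defining equation is for `r` of zero mean. It holds for every `r`, since both sides vanish
on constants by the discrete Stokes formula. -/
theorem gammaT_spec (υ : M.Xcurl k) (F : Fin M.nF) : ∀ r ∈ PF ((k : ℤ) + 1) (M.normal F),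
    ∀ τ ∈ M.RolyFPerp k F, ipV (M.mF F) (M.gammaT υ F) (vrotL (M.normal F) r + τ)
      = ipS (M.mF F) (M.faceCurl υ F) r + edgeL υ F r + ipV (M.mF F) (M.compRFperp υ F) τ := by
  set n := M.normal F
  let L : Poly3 →ₗ[ℝ] ℝ := bilS (M.integrable_mF F) (M.faceCurl υ F) + edgeL υ F
  obtain ⟨r₀, hr₀, -, h⟩ := hM.exists_rot_riesz F (by positivity) le_rfl L
    (hM.faceCurl_add_edgeL_C υ F)
  have hrot : vrotL n r₀ ∈ RolyF k n := ⟨r₀, hr₀, rfl⟩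
  have hg : vrotL n r₀ + M.compRFperp υ F ∈ VPF k n :=
    Submodule.add_mem _ (RolyF_le k n hrot) (υ.2.1 F).2.2.1
  have hex : ∀ r ∈ PF ((k : ℤ) + 1) n, ∀ τ ∈ M.RolyFPerp k F,
      ipV (M.mF F) (vrotL n r₀ + M.compRFperp υ F) (vrotL n r + τ)
        = ipS (M.mF F) (M.faceCurl υ F) r + edgeL υ F r
          + ipV (M.mF F) (M.compRFperp υ F) τ := by
    intro r hr τ hτ
    have hi := M.integrable_mF F
    have h1 : ipV (M.mF F) (vrotL n r₀) τ = 0 := by rw [ipV_comm]; exact hτ.2 _ hrot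
    have h2 : ipV (M.mF F) (M.compRFperp υ F) (vrotL n r) = 0 :=
      (υ.2.1 F).2.2.2 _ ⟨r, hr, rfl⟩
    rw [ipV_add_left hi, ipV_add_right hi, ipV_add_right hi, h1, h2, h r hr]
    change ipS (M.mF F) (M.faceCurl υ F) r + edgeL υ F r + 0 + _ = _
    ring
  have hspec := Classical.epsilon_spec (p := fun g : VPF k n =>
    ∀ r ∈ PF ((k : ℤ) + 1) n, ∫ x, evalAt x r ∂(M.mF F) = 0 → ∀ τ ∈ M.RolyFPerp k F,
      ipV (M.mF F) g (vrotL n r + τ) =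
        ipS (M.mF F) (M.faceCurl υ F) r
          + ∑ E ∈ M.edgesOf F, M.omegaFE F E * ipS (M.mE E) (M.compE υ E) r
          + ipV (M.mF F) (M.compRFperp υ F) τ)
    ⟨⟨_, hg⟩, fun r hr _ τ hτ => by rw [← edgeL_apply]; exact hex r hr τ hτ⟩
  intro r hr τ hτ
  obtain ⟨c, hc⟩ := hM.exists_sub_mean_zero F r
  have h1 := hspec _ (Submodule.sub_mem _ hr (C_mem_PF (by positivity) n c)) hc τ hτ
  rw [← edgeL_apply, map_sub, vrotL_C, sub_zero, map_sub, ipS_sub_right (M.integrable_mF F)] at h1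
  have h2 := hM.faceCurl_add_edgeL_C υ F c
  refine h1.trans ?_
  linarith

theorem gammaT_add (υ ζ : M.Xcurl k) (F : Fin M.nF) :
    (M.gammaT (υ + ζ) F : VPoly3) = M.gammaT υ F + M.gammaT ζ F := by
  have hi := M.integrable_mF F
  have hd : (M.gammaT (υ + ζ) F : VPoly3) - (M.gammaT υ F + M.gammaT ζ F) ∈ VPF k (M.normal F) :=
    Submodule.sub_mem _ (M.gammaT (υ + ζ) F).2
      (Submodule.add_mem _ (M.gammaT υ F).2 (M.gammaT ζ F).2)
  obtain ⟨r, hr, -, τ, hτ, heq, -⟩ := hM.exists_face_decomposition F hd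
  refine sub_eq_zero.1 (hM.definite_face F (VPF_mono (by omega) _ hd) ?_)
  nth_rewrite 2 [heq]
  rw [ipV_sub_left hi, ipV_add_left hi, hM.gammaT_spec _ F r hr τ hτ, hM.gammaT_spec _ F r hr τ hτ,
    hM.gammaT_spec _ F r hr τ hτ, hM.faceCurl_add, ipS_add_left hi, edgeL_add, compRFperp_add,
    ipV_add_left hi]
  ring

theorem faceL_add (υ ζ : M.Xcurl k) (T : Fin M.nT) (v : VPoly3) :
    faceL (υ + ζ) T v = faceL υ T v + faceL ζ T v := by
  rw [faceL_apply, faceL_apply, faceL_apply, ← Finset.sum_add_distrib]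
  refine Finset.sum_congr rfl fun F _ => ?_
  rw [hM.gammaT_add, ipV_add_left (M.integrable_mF F), mul_add]

theorem elemCurl_spec (υ : M.Xcurl k) (T : Fin M.nT) : ∀ τ ∈ VP k,
    ipV (M.mT T) (M.elemCurl υ T) τ = ipV (M.mT T) (M.compRT υ T) (curlL τ) + faceL υ T τ := by
  obtain ⟨g, hg, h⟩ := exists_riesz (bilV (M.integrable_mT T)) (VP k)
    (fun w hw h0 => hM.definite_elem T (VP_mono (by omega) hw) h0)
    ((bilV (M.integrable_mT T) (M.compRT υ T)).comp curlL + faceL υ T)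
  simp only [faceL_apply]
  refine Classical.epsilon_spec (p := fun c : VP k => ∀ τ ∈ VP k,
    ipV (M.mT T) c τ = ipV (M.mT T) (M.compRT υ T) (curlL τ)
      + ∑ F ∈ M.facesOf T, M.omegaTF T F *
          ipV (M.mF F) (M.gammaT υ F) (τ ⨯₃ cst (M.normal F)))
    ⟨⟨g, hg⟩, fun q hq => (h q hq).trans ?_⟩
  rw [LinearMap.add_apply, faceL_apply]; rfl

theorem potHat_spec (υ : M.Xcurl k) (T : Fin M.nT) : ∀ v ∈ M.GolyPerp ((k : ℤ) + 1) T,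
    ∀ τ ∈ M.RolyPerp k T, ipV (M.mT T) (M.potHat υ T) (curlL v + τ)
      = ipV (M.mT T) (M.elemCurl υ T) v - faceL υ T v + ipV (M.mT T) (M.compRTperp υ T) τ := by
  obtain ⟨w₀, hw₀, h⟩ := hM.exists_curl_riesz T le_rfl
    (bilV (M.integrable_mT T) (M.elemCurl υ T) - faceL υ T)
  have hi := M.integrable_mT T
  have hcurl : curlL w₀ ∈ Roly k := ⟨w₀, hw₀.1, rfl⟩
  simp only [faceL_apply]
  refine Classical.epsilon_spec (p := fun p : VP k =>
    ∀ v ∈ M.GolyPerp ((k : ℤ) + 1) T, ∀ τ ∈ M.RolyPerp k T,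
      ipV (M.mT T) p (curlL v + τ) =
        ipV (M.mT T) (M.elemCurl υ T) v
          - ∑ F ∈ M.facesOf T, M.omegaTF T F *
              ipV (M.mF F) (M.gammaT υ F) (v ⨯₃ cst (M.normal F))
          + ipV (M.mT T) (M.compRTperp υ T) τ)
    ⟨⟨curlL w₀ + M.compRTperp υ T, Submodule.add_mem _ (Roly_le k hcurl) (υ.1 T).2.2.1⟩,
      fun v hv τ hτ => ?_⟩
  have h1 : ipV (M.mT T) (curlL w₀) τ = 0 := by rw [ipV_comm]; exact hτ.2 _ hcurl
  have h2 : ipV (M.mT T) (M.compRTperp υ T) (curlL v) = 0 := (υ.1 T).2.2.2 _ ⟨v, hv.1, rfl⟩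
  rw [ipV_add_left hi, ipV_add_right hi, ipV_add_right hi, h1, h2, h v hv, LinearMap.sub_apply,
    faceL_apply]
  change ipV (M.mT T) (M.elemCurl υ T) v - _ + 0 + _ = _
  ring

end MeshBound
end PolyMesh

/-! ### Construction of the correction -/

theorem C_mem_PE {ℓ : ℤ} (hℓ : 0 ≤ ℓ) (t : E3) (c : ℝ) : (MvPolynomial.C c : Poly3) ∈ PE ℓ t := by
  refine ⟨C_mem_P hℓ c, ?_⟩
  simp only [SetLike.mem_coe, Submodule.mem_iInf, LinearMap.mem_ker]
  exact fun w _ => by simp [dirDeriv_apply]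

theorem ipS_congr_ae {μ : Measure E3} {X : Set E3} (hX : ∀ᵐ y ∂μ, y ∈ X) (p : Poly3) {q r : Poly3}
    (h : ∀ y ∈ X, evalAt y q = evalAt y r) : ipS μ p q = ipS μ p r :=
  integral_congr_ae (hX.mono fun y hy => by simp only [evalAt_mul, h y hy])

theorem ipV_congr_ae {μ : Measure E3} {X : Set E3} (hX : ∀ᵐ y ∂μ, y ∈ X) (p : VPoly3)
    {q r : VPoly3} (h : ∀ y ∈ X, ∀ i, evalAt y (q i) = evalAt y (r i)) :
    ipV μ p q = ipV μ p r :=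
  integral_congr_ae (hX.mono fun y hy => by simp only [evalAt_dotProduct, h y hy])

namespace PolyMesh
variable {Ω : Set E3} {M : PolyMesh Ω} {k : ℕ}

theorem inner_normal_eq_of_mem_closure {F : Fin M.nF} {x y : E3} (hx : x ∈ M.face F)
    (hy : y ∈ closure (M.face F)) : (inner ℝ (M.normal F) y : ℝ) = inner ℝ (M.normal F) x := by
  obtain ⟨A, U, hd, -, -, hUA⟩ := M.exists_plane F
  have hA : M.face F ⊆ A := by rw [hUA]; exact inter_subset_right
  have hyA := closure_minimal hA (AffineSubspace.closed_of_finiteDimensional A) hy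
  have h := (mem_direction_iff hd).1 (A.vsub_mem_direction hyA (hA hx))
  rwa [vsub_eq_sub, inner_sub_right, sub_eq_zero] at h

theorem mE_mul_edgeAvg (υ : M.Xcurl k) (E : Fin M.nE) (c : ℝ) :
    ipS (M.mE E) (MvPolynomial.C (M.edgeAvg υ E)) (MvPolynomial.C c)
      = ipS (M.mE E) (M.compE υ E) (MvPolynomial.C c) := by
  unfold ipS
  simp only [evalAt_mul, evalAt_C]
  rw [integral_mul_const, integral_mul_const, integral_const, edgeAvg, measure_smul_average]

theorem edgeL_C_of_compE_eq {υ ζ : M.Xcurl k}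
    (h : ∀ E, M.compE ζ E = MvPolynomial.C (-M.edgeAvg υ E)) (F : Fin M.nF) (c : ℝ) :
    edgeL ζ F (MvPolynomial.C c) = -edgeL υ F (MvPolynomial.C c) := by
  rw [edgeL_apply, edgeL_apply, ← Finset.sum_neg_distrib]
  refine Finset.sum_congr rfl fun E _ => ?_
  have h1 := mE_mul_edgeAvg υ E c
  have h2 : ipS (M.mE E) (MvPolynomial.C (-M.edgeAvg υ E)) (MvPolynomial.C c)
      = -ipS (M.mE E) (MvPolynomial.C (M.edgeAvg υ E)) (MvPolynomial.C c) := by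
    unfold ipS
    simp only [evalAt_mul, evalAt_C, neg_mul]
    exact integral_neg _
  rw [h, h2, h1, mul_neg]

/-- The correction `ζ` of `υ`: opposite edge averages on the edges, and face and element
components of rotational type which cancel the remaining part of the discrete curl. -/
structure IsCorrection (υ ζ : M.Xcurl k) : Prop where
  compE_eq : ∀ E, M.compE ζ E = MvPolynomial.C (-M.edgeAvg υ E)
  compRFperp_eq : ∀ F, M.compRFperp ζ F = 0
  compRTperp_eq : ∀ T, M.compRTperp ζ T = 0
  compRF_eq : ∀ F, ∃ q ∈ PF k (M.normal F), ∫ x, evalAt x q ∂(M.mF F) = 0 ∧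
    M.compRF ζ F = vrotL (M.normal F) q
  compRF_spec : ∀ F, ∀ q ∈ PF k (M.normal F), ipV (M.mF F) (M.compRF ζ F) (vrotL (M.normal F) q)
    = edgeL ζ F q - ipS (M.mF F) (M.faceCurl υ F) q
  compRT_eq : ∀ T, ∃ w ∈ M.GolyPerp k T, M.compRT ζ T = curlL w
  compRT_spec : ∀ T, ∀ w ∈ M.GolyPerp k T, ipV (M.mT T) (M.compRT ζ T) (curlL w)
    = -ipV (M.mT T) (M.elemCurl υ T) w - faceL ζ T w

/-- The face terms of an element curl do not see gradients if the face curls vanish. -/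
theorem MeshBound.faceL_gradL_eq_zero {C : ℝ} (hM : MeshBound M k C) {υ : M.Xcurl k}
    (h : ∀ F, (M.faceCurl υ F : Poly3) = 0) (T : Fin M.nT) {q : Poly3} (hq : q ∈ P k) :
    faceL υ T (gradL q) = 0 := by
  -- On the plane of `F`, `∇q × n` is the rotated gradient of the planar restriction `q'`. With zero
  -- face curl, the equation of the tangential potential leaves only the edge terms, in which `q'`
  -- is again `q`.
  have hF : ∀ F, ipV (M.mF F) (M.gammaT υ F) (gradL q ⨯₃ cst (M.normal F)) = edgeL υ F q := by
    intro F
    obtain ⟨x, hx⟩ := M.face_nonempty F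
    obtain ⟨q', hq', hqq⟩ := exists_plane_restriction (inner_normal F) x hq
    have h1 := hM.gammaT_spec υ F q' (PF_mono (by omega) _ hq') 0 (Submodule.zero_mem _)
    rw [add_zero, h, ipS_zero_left, ipV_comm _ (0 : VPoly3), ipV_zero_left, zero_add, add_zero] at h1
    rw [← vrotL_apply, ← ipV_congr_ae (ae_mF F) _ fun y hy =>
      (hqq y (inner_normal_eq_of_mem_closure hx (subset_closure hy))).2, h1, edgeL_apply,
      edgeL_apply]
    refine Finset.sum_congr rfl fun E hE => ?_
    rw [ipS_congr_ae (ae_mE E) _ fun y hy => (hqq y (inner_normal_eq_of_mem_closure hx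
      (segment_subset_closure_face hE hy))).1]
  rw [faceL_apply]
  simp only [hF, edgeL_apply, Finset.mul_sum]
  -- Summing over edges first, the integral on `E` is the same for all faces and factors out of a
  -- sum of orientations equal to zero.
  rw [Finset.sum_comm' (t' := Finset.univ)
    (s' := fun E => (M.facesOf T).filter fun F => E ∈ M.edgesOf F) (by simp)]
  refine Finset.sum_eq_zero fun E _ => ?_
  simp only [← mul_assoc]
  rw [← Finset.sum_mul, sum_orientation, zero_mul]

/-- The problems are triangular: the face problem sees only the edge components of `ζ`, and the
element problem only its tangential potentials, which depend on faces and edges. Hence the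
provisional `ζ₀` and `ζ₁`, completed by zeros. -/
theorem MeshBound.exists_correction {C : ℝ} (hM : MeshBound M k C) (υ : M.Xcurl k) :
    ∃ ζ : M.Xcurl k, IsCorrection υ ζ := by
  let ζE : ∀ E : Fin M.nE, PE k (M.tangent E) := fun E =>
    ⟨MvPolynomial.C (-M.edgeAvg υ E), C_mem_PE (by positivity) _ _⟩
  let ζ₀ : M.Xcurl k := (0, 0, ζE)
  have hF : ∀ F, ∃ q ∈ PF k (M.normal F), ∫ x, evalAt x q ∂(M.mF F) = 0 ∧
      ∀ r ∈ PF k (M.normal F), ipV (M.mF F) (vrotL (M.normal F) q) (vrotL (M.normal F) r)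
        = (edgeL ζ₀ F - bilS (M.integrable_mF F) (M.faceCurl υ F)) r := by
    intro F
    refine hM.exists_rot_riesz F (by positivity) (by omega) _ fun c => ?_
    have h1 := hM.faceCurl_add_edgeL_C υ F c
    -- Opposite edge averages make the right-hand side of the face problem vanish on constants.
    have h2 := edgeL_C_of_compE_eq (υ := υ) (ζ := ζ₀) (fun E => rfl) F c
    rw [LinearMap.sub_apply, h2]
    change - _ - ipS (M.mF F) (M.faceCurl υ F) (MvPolynomial.C c) = 0
    linarith
  choose q hq hq0 hqs using hF
  let ζF : ∀ F : Fin M.nF, RolyF ((k : ℤ) - 1) (M.normal F) × M.RolyFPerp k F := fun F =>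
    (⟨vrotL (M.normal F) (q F), q F, by rw [sub_add_cancel]; exact hq F, rfl⟩, 0)
  let ζ₁ : M.Xcurl k := (0, ζF, ζE)
  have hT : ∀ T, ∃ w ∈ M.GolyPerp k T, ∀ v ∈ M.GolyPerp k T,
      ipV (M.mT T) (curlL w) (curlL v)
        = (-bilV (M.integrable_mT T) (M.elemCurl υ T) - faceL ζ₁ T) v := fun T =>
    hM.exists_curl_riesz T (by omega) _
  choose w hw hws using hT
  let ζT : ∀ T : Fin M.nT, Roly ((k : ℤ) - 1) × M.RolyPerp k T := fun T =>
    (⟨curlL (w T), w T, by rw [sub_add_cancel]; exact (hw T).1, rfl⟩, 0)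
  exact ⟨(ζT, ζF, ζE), {
    compE_eq := fun E => rfl
    compRFperp_eq := fun F => rfl
    compRTperp_eq := fun T => rfl
    compRF_eq := fun F => ⟨q F, hq F, hq0 F, rfl⟩
    compRF_spec := fun F r hr => hqs F r hr
    compRT_eq := fun T => ⟨w T, hw T, rfl⟩
    compRT_spec := fun T v hv => hws T v hv }⟩

namespace IsCorrection
variable {C : ℝ} (hM : MeshBound M k C) {υ ζ : M.Xcurl k} (h : IsCorrection υ ζ)
include hM h

theorem faceCurl_add_eq_zero (F : Fin M.nF) : (M.faceCurl (υ + ζ) F : Poly3) = 0 := by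
  refine hM.faceCurl_eq (Submodule.zero_mem _) fun q hq => ?_
  rw [ipS_zero_left, compRF_add, ipV_add_left (M.integrable_mF F), edgeL_add, h.compRF_spec F q hq,
    hM.faceCurl_spec υ F q hq]
  ring

/-- The `G^{k-1}` component vanishes because the face terms ignore gradients once the face curls are
zero; the `G^k(T)^⊥` component vanishes by the choice of the element component of `ζ`. -/
theorem discCurl_add_eq_zero : M.discCurl (υ + ζ) = 0 := by
  have hF := h.faceCurl_add_eq_zero hM
  have hpos : ∀ T, ∀ w ∈ VP k, ipV (M.mT T) w w = 0 → w = 0 := fun T w hw h0 =>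
    hM.definite_elem T (VP_mono (by omega) hw) h0
  have hG : Goly ((k : ℤ) - 1) ≤ VP k := (Goly_le _).trans (VP_mono (by omega))
  have := finite_of_le hG
  refine Prod.ext (funext fun T => Prod.ext ?_ ?_) (funext fun F => Subtype.ext (hF F))
  · refine projOn_eq_zero (M.integrable_mT T) (fun w hw => hpos T w (hG hw)) ?_
    rintro _ ⟨q, hq, rfl⟩
    rw [sub_add_cancel] at hq
    rw [hM.elemCurl_spec _ T _ (hG ⟨q, by rwa [sub_add_cancel], rfl⟩), curlL_gradL,
      hM.faceL_gradL_eq_zero hF T hq, ipV_comm, ipV_zero_left, add_zero]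
  · have hP : M.GolyPerp k T ≤ VP k := perpIn_le _ _ _
    have := finite_of_le hP
    refine projOn_eq_zero (M.integrable_mT T) (fun w hw => hpos T w (hP hw)) fun w hw => ?_
    have h1 := hM.elemCurl_spec υ T w (hP hw)
    rw [hM.elemCurl_spec _ T _ (hP hw), compRT_add, ipV_add_left (M.integrable_mT T),
      h.compRT_spec T w hw, hM.faceL_add, h1]
    ring

end IsCorrection
end PolyMesh

/-! ### Local bounds for the correction -/

namespace PolyMesh
variable {Ω : Set E3} {M : PolyMesh Ω} {k : ℕ}

theorem edgesOf_subset_elemEdges {T : Fin M.nT} {F : Fin M.nF} (hF : F ∈ M.facesOf T) :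
    M.edgesOf F ⊆ M.elemEdges T := fun _ hE => mem_elemEdges.2 ⟨F, hF, hE⟩

theorem len_le_hF {F : Fin M.nF} {E : Fin M.nE} (hE : E ∈ M.edgesOf F) : M.len E ≤ M.hF F := by
  obtain ⟨T, hT⟩ := exists_mem_facesOf F
  have hb : Bornology.IsBounded (closure (M.face F)) :=
    (isBounded_elem T).closure.subset (closure_minimal (face_subset_closure hT) isClosed_closure)
  rw [hF, ← Metric.diam_closure]
  exact Metric.dist_le_diam_of_mem hb (segment_subset_closure_face hE (left_mem_segment ℝ _ _))
    (segment_subset_closure_face hE (right_mem_segment ℝ _ _))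

theorem exists_mem_edgesOf (F : Fin M.nF) : ∃ E, E ∈ M.edgesOf F := by
  obtain ⟨A, -, hA⟩ := M.face_polytope F
  obtain ⟨x, hx⟩ := hA.boundary_connected.nonempty
  rw [M.face_boundary F] at hx
  obtain ⟨E, hE, -⟩ := mem_iUnion₂.1 hx
  exact ⟨E, mem_edgesOf.2 hE⟩

/-! ### Sup bounds for the reconstructions in terms of the components -/

namespace MeshBound
variable {C : ℝ} (hM : MeshBound M k C) {T : Fin M.nT}
include hM

theorem abs_faceL_le {υ : M.Xcurl k} {B : ℝ} (hB : 0 ≤ B)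
    (hγ : ∀ F ∈ M.facesOf T, FieldBound (M.hull T) (M.gammaT υ F) B) {v : VPoly3} {Q : ℝ}
    (hQ : 0 ≤ Q) (hv : FieldBound (M.hull T) v Q) :
    |faceL υ T v| ≤ 6 * C ^ 2 * B * Q * M.hT T ^ 2 := by
  have hT := hM.hT_pos T
  have hC := hM.pos
  rw [faceL_apply]
  refine (abs_sum_mul_le (B := 3 * C * B * (2 * Q) * M.hT T ^ 2) (abs_omegaTF T)
    (fun F hF => hM.abs_ipV_face_le hF hB (by positivity) (hγ F hF)
      (hv.cross (M.normal_unit F))) (hM.card_faces T) (by positivity)).trans_eq ?_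
  ring

theorem fieldBound_elemCurl {υ : M.Xcurl k} {A B : ℝ} (hA : 0 ≤ A) (hB : 0 ≤ B)
    (hR : FieldBound (M.hull T) (M.compRT υ T) A)
    (hγ : ∀ F ∈ M.facesOf T, FieldBound (M.hull T) (M.gammaT υ F) B) :
    FieldBound (M.hull T) (M.elemCurl υ T) (6 * C ^ 3 * (A + B) / M.hT T) := by
  have hT := hM.hT_pos T
  have hC := hM.pos
  have hc := (M.elemCurl υ T).2
  have hc' := VP_mono (by omega : (k : ℤ) ≤ k + 1) hc
  refine (hM.fieldBound_elem hc' (a := 6 * C ^ 2 * (A + B) / M.hT T) (by positivity)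
    fun G hG hb => ?_).mono (le_of_eq (by ring))
  rw [hM.elemCurl_spec υ T _ hc]
  have h1 := (le_abs_self _).trans (hM.abs_ipV_elem_le hA (by positivity) hR
    (hM.fieldBound_curlL hc' hG hb))
  have h2 := (le_abs_self _).trans (hM.abs_faceL_le hB hγ hG hb)
  refine (add_le_add h1 h2).trans_eq ?_
  field_simp
  ring

/-- The potential is tested with itself, split as `curl v + τ`. The part `τ` only sees the
complementary element component, which is zero, and `v` is bounded by `h_T` times its curl, which
absorbs the `1 / h_T` of the element curl. -/
theorem fieldBound_potHat {υ : M.Xcurl k} {D B : ℝ} (hD : 0 ≤ D) (hB : 0 ≤ B)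
    (hperp : M.compRTperp υ T = 0)
    (hc : FieldBound (M.hull T) (M.elemCurl υ T) (D / M.hT T))
    (hγ : ∀ F ∈ M.facesOf T, FieldBound (M.hull T) (M.gammaT υ F) B) :
    FieldBound (M.hull T) (M.potHat υ T) (54 * C ^ 7 * D + 108 * C ^ 8 * B) := by
  have hT := hM.hT_pos T
  have hC := hM.pos
  have hp := (M.potHat υ T).2
  refine (hM.fieldBound_elem (VP_mono (by omega) hp) (a := 54 * C ^ 6 * D + 108 * C ^ 7 * B)
    (by positivity) fun G hG hb => ?_).mono (le_of_eq (by ring))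
  obtain ⟨v, hv, τ, hτ, heq, hself⟩ := hM.exists_elem_decomposition T hp
  have hcv : FieldBound (M.hull T) (curlL v) (3 * C ^ 2 * G) :=
    hM.fieldBound_elem_proj (VP_mono (by omega) (curlL_mem_VP hv.1)) hG hb hself
  have hvb := hM.fieldBound_of_curlL (by omega) le_rfl hv (by positivity) hcv
  nth_rewrite 2 [heq]
  rw [hM.potHat_spec υ T v hv τ hτ, hperp, ipV_zero_left, add_zero]
  have h1 := (le_abs_self _).trans (hM.abs_ipV_elem_le (by positivity) (by positivity) hc hvb)
  have h2 := (neg_le_abs _).trans (hM.abs_faceL_le hB hγ (by positivity) hvb)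
  rw [sub_eq_add_neg]
  refine (add_le_add h1 h2).trans_eq ?_
  field_simp
  ring

theorem fieldBound_pot {υ : M.Xcurl k} {P A : ℝ} (hP : 0 ≤ P)
    (hR : FieldBound (M.hull T) (M.compRT υ T) A)
    (hp : FieldBound (M.hull T) (M.potHat υ T) P) :
    FieldBound (M.hull T) (M.pot υ T) (P + 3 * C ^ 2 * P + A) := by
  have hle : Roly ((k : ℤ) - 1) ≤ VP ((k : ℤ) + 1) := (Roly_le _).trans (VP_mono (by omega))
  have := finite_of_le hle
  refine (hp.sub (hM.fieldBound_elem_proj (hle (projOn _ _ _).2) hP hp ?_)).add hR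
  exact projOn_spec (M.integrable_mT T) (fun w hw h0 => hM.definite_elem T (hle hw) h0) _ _
    (projOn _ _ _).2

theorem fieldBound_face_projOn {F : Fin M.nF} (hF : F ∈ M.facesOf T) {W : Submodule ℝ VPoly3}
    (hW : W ≤ VPF ((k : ℤ) + 1) (M.normal F)) {v : VPoly3} {Q : ℝ} (hQ : 0 ≤ Q)
    (hv : FieldBound (M.hull T) v Q) :
    FieldBound (M.hull T) (projOn (M.mF F) W v) (3 * C ^ 2 * Q) := by
  have := finite_of_le hW
  exact hM.fieldBound_face_proj hF (hW (projOn _ _ _).2) hQ hv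
    (projOn_spec (M.integrable_mF F) (fun w hw h0 => hM.definite_face F (hW hw) h0) _ _
      (projOn _ _ _).2)

end MeshBound

/-- The data from which the correction is built are bounded by `δ` on the element `T`. -/
structure IsLocalBound (υ : M.Xcurl k) (T : Fin M.nT) (δ : ℝ) : Prop where
  nonneg : 0 ≤ δ
  faceCurl_le : ∀ F ∈ M.facesOf T, ∀ y ∈ M.hull T, |evalAt y (M.faceCurl υ F)| ≤ δ / M.hT T
  edgeAvg_le : ∀ E ∈ M.elemEdges T, |M.edgeAvg υ E| ≤ δ
  exists_field : ∃ u, FieldBound (M.hull T) u (δ / M.hT T) ∧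
    ∀ w ∈ M.GolyPerp k T, ipV (M.mT T) (M.elemCurl υ T) w = ipV (M.mT T) u w

namespace IsCorrection
variable {C : ℝ} (hM : MeshBound M k C) {υ ζ : M.Xcurl k} (h : IsCorrection υ ζ) {T : Fin M.nT}
  {δ : ℝ} (hδ : IsLocalBound υ T δ)
include hM h hδ

theorem abs_edgeL_le {F : Fin M.nF} (hF : F ∈ M.facesOf T) {q : Poly3} {Q : ℝ} (hQ : 0 ≤ Q)
    (hq : ∀ y ∈ M.hull T, |evalAt y q| ≤ Q) : |edgeL ζ F q| ≤ C * (δ * Q * M.hT T) := by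
  have hT := hM.hT_pos T
  have := hδ.nonneg
  rw [edgeL_apply]
  refine abs_sum_mul_le (abs_omegaFE F) (fun E hE => ?_) ((Nat.cast_le.2
    (Finset.card_le_card (edgesOf_subset_elemEdges hF))).trans (hM.card_edges T)) (by positivity)
  refine MeshBound.abs_ipS_edge_le (edgesOf_subset_elemEdges hF hE) hδ.nonneg hQ
    (fun y _ => ?_) hq
  rw [h.compE_eq, evalAt_C, abs_neg]
  exact hδ.edgeAvg_le E (edgesOf_subset_elemEdges hF hE)

theorem fieldBound_compRF {F : Fin M.nF} (hF : F ∈ M.facesOf T) :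
    FieldBound (M.hull T) (M.compRF ζ F) (12 * C ^ 2 * δ) := by
  have hT := hM.hT_pos T
  have hC := hM.pos
  have := hδ.nonneg
  have hmem : M.compRF ζ F ∈ VPF ((k : ℤ) + 1) (M.normal F) :=
    VPF_mono (by omega) _ (RolyF_le _ _ (ζ.2.1 F).1.2)
  refine (hM.fieldBound_face hF hmem (a := 12 * C * δ) (by positivity) fun G hG hb => ?_).mono
    (le_of_eq (by ring))
  obtain ⟨q, hq, hq0, heq⟩ := h.compRF_eq F
  rw [heq] at hb
  have hqb : ∀ y ∈ M.hull T, |evalAt y q| ≤ 6 * G * M.hT T := fun y hy =>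
    hM.abs_evalAt_le_of_mean_zero hF hq.2 hq0 hb hy
  nth_rewrite 2 [heq]
  rw [h.compRF_spec F q hq]
  have h1 := (le_abs_self _).trans (h.abs_edgeL_le hM hδ hF (by positivity) hqb)
  have h2 := (neg_le_abs _).trans (hM.abs_ipS_face_le hF (by positivity) (by positivity)
    (hδ.faceCurl_le F hF) hqb)
  rw [sub_eq_add_neg]
  refine (add_le_add h1 h2).trans_eq ?_
  field_simp
  ring

theorem fieldBound_gammaT {F : Fin M.nF} (hF : F ∈ M.facesOf T) :
    FieldBound (M.hull T) (M.gammaT ζ F) (36 * C ^ 4 * δ) := by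
  have hT := hM.hT_pos T
  have hC := hM.pos
  have := hδ.nonneg
  have hmem := (M.gammaT ζ F).2
  refine (hM.fieldBound_face hF (VPF_mono (by omega) _ hmem) (a := 36 * C ^ 3 * δ) (by positivity)
    fun G hG hb => ?_).mono (le_of_eq (by ring))
  obtain ⟨r, hr, hr0, τ, hτ, heq, hself⟩ := hM.exists_face_decomposition F hmem
  have hrot : FieldBound (M.hull T) (vrotL (M.normal F) r) (3 * C ^ 2 * G) :=
    hM.fieldBound_face_proj hF (VPF_mono (by omega) _ (vrotL_mem_VPF hr)) hG hb hself
  have hrb : ∀ y ∈ M.hull T, |evalAt y r| ≤ 6 * (3 * C ^ 2 * G) * M.hT T := fun y hy =>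
    hM.abs_evalAt_le_of_mean_zero hF hr.2 hr0 hrot hy
  -- The face curl of `ζ` needs no estimate of its own: it is opposite to that of `υ`.
  have hcurl : (M.faceCurl ζ F : Poly3) = -(M.faceCurl υ F : Poly3) := by
    have h1 := h.faceCurl_add_eq_zero hM F
    rw [hM.faceCurl_add] at h1
    exact (neg_eq_of_add_eq_zero_right h1).symm
  have hcb : ∀ y ∈ M.hull T, |evalAt y (M.faceCurl ζ F)| ≤ δ / M.hT T := fun y hy => by
    rw [hcurl, evalAt_neg, abs_neg]; exact hδ.faceCurl_le F hF y hy
  nth_rewrite 2 [heq]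
  rw [hM.gammaT_spec ζ F r hr τ hτ, h.compRFperp_eq, ipV_zero_left, add_zero]
  have h1 := (le_abs_self _).trans (hM.abs_ipS_face_le hF (by positivity) (by positivity) hcb hrb)
  have h2 := (le_abs_self _).trans (h.abs_edgeL_le hM hδ hF (by positivity) hrb)
  refine (add_le_add h1 h2).trans_eq ?_
  field_simp
  ring

theorem fieldBound_compRT :
    FieldBound (M.hull T) (M.compRT ζ T) ((18 * C ^ 5 + 1296 * C ^ 10) * δ) := by
  have hT := hM.hT_pos T
  have hC := hM.pos
  have := hδ.nonneg
  have hmem : M.compRT ζ T ∈ VP ((k : ℤ) + 1) := VP_mono (by omega) (Roly_le _ (ζ.1 T).1.2)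
  refine (hM.fieldBound_elem hmem (a := (18 * C ^ 4 + 1296 * C ^ 9) * δ) (by positivity)
    fun G hG hb => ?_).mono (le_of_eq (by ring))
  obtain ⟨w, hw, heq⟩ := h.compRT_eq T
  rw [heq] at hb
  have hwb := hM.fieldBound_of_curlL le_rfl (by omega) hw hG hb
  -- The full element curl of `υ` is not controlled by the data, but tests in `G^k(T)^⊥` do not
  -- distinguish it from the bounded field `u`.
  obtain ⟨u, hu, hu'⟩ := hδ.exists_field
  nth_rewrite 2 [heq]
  rw [h.compRT_spec T w hw, hu' w hw]
  have h1 := (neg_le_abs _).trans (hM.abs_ipV_elem_le (by positivity) (by positivity) hu hwb)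
  have h2 := (neg_le_abs _).trans (hM.abs_faceL_le (by positivity)
    (fun F hF => h.fieldBound_gammaT hM hδ hF) (by positivity) hwb)
  rw [sub_eq_add_neg]
  refine (add_le_add h1 h2).trans_eq ?_
  field_simp
  ring

end IsCorrection

theorem exists_local_bound (k : ℕ) {C : ℝ} (hC : 0 < C) : ∃ K : ℝ, 0 < K ∧
    ∀ (M : PolyMesh Ω), MeshBound M k C → ∀ υ ζ : M.Xcurl k, IsCorrection υ ζ → ∀ T δ,
      IsLocalBound υ T δ →
      ipV (M.mT T) (M.pot ζ T) (M.pot ζ T) + M.stab ζ ζ T ≤ K * (δ ^ 2 * M.hT T ^ 3) := by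
  -- In units of `δ`, the bounds of the element component, tangential potentials, element curl
  -- (times `h_T`), unprojected potential and potential of `ζ`, in order of dependence.
  obtain ⟨A, hA⟩ : ∃ A, A = 18 * C ^ 5 + 1296 * C ^ 10 := ⟨_, rfl⟩
  obtain ⟨B, hB⟩ : ∃ B, B = 36 * C ^ 4 := ⟨_, rfl⟩
  obtain ⟨D, hD⟩ : ∃ D, D = 6 * C ^ 3 * (A + B) := ⟨_, rfl⟩
  obtain ⟨P, hP⟩ : ∃ P, P = 54 * C ^ 7 * D + 108 * C ^ 8 * B := ⟨_, rfl⟩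
  obtain ⟨Q, hQ⟩ : ∃ Q, Q = P + 3 * C ^ 2 * P + A := ⟨_, rfl⟩
  have hA0 : 0 < A := by rw [hA]; positivity
  have hB0 : 0 < B := by rw [hB]; positivity
  have hD0 : 0 < D := by rw [hD]; positivity
  have hP0 : 0 < P := by rw [hP]; positivity
  have hQ0 : 0 < Q := by rw [hQ]; positivity
  refine ⟨3 * C * Q ^ 2 + 3 * C ^ 2 * (3 * C ^ 2 * Q + 12 * C ^ 2) ^ 2
    + 3 * C ^ 2 * (3 * C ^ 2 * Q) ^ 2 + C * (3 * Q + 1) ^ 2, by positivity, ?_⟩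
  intro M hM υ ζ h T δ hδ
  have hT := hM.hT_pos T
  have hδ0 := hδ.nonneg
  have hRT : FieldBound (M.hull T) (M.compRT ζ T) (A * δ) := by
    rw [hA]; exact h.fieldBound_compRT hM hδ
  have hγ : ∀ F ∈ M.facesOf T, FieldBound (M.hull T) (M.gammaT ζ F) (B * δ) := fun F hF => by
    rw [hB]; exact h.fieldBound_gammaT hM hδ hF
  have hc : FieldBound (M.hull T) (M.elemCurl ζ T) (D * δ / M.hT T) :=
    (hM.fieldBound_elemCurl (by positivity) (by positivity) hRT hγ).mono
      (le_of_eq (by rw [hD]; ring))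
  have hp : FieldBound (M.hull T) (M.potHat ζ T) (P * δ) :=
    (hM.fieldBound_potHat (by positivity) (by positivity) (h.compRTperp_eq T) hc hγ).mono
      (le_of_eq (by rw [hP]; ring))
  have hpot : FieldBound (M.hull T) (M.pot ζ T) (Q * δ) :=
    (hM.fieldBound_pot (by positivity) hRT hp).mono (le_of_eq (by rw [hQ]; ring))
  have h1 := (le_abs_self _).trans (hM.abs_ipV_elem_le (by positivity) (by positivity) hpot hpot)
  have hface : ∀ f : Fin M.nF → VPoly3, ∀ R : ℝ, 0 ≤ R →
      (∀ F ∈ M.facesOf T, FieldBound (M.hull T) (f F) R) →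
      ∑ F ∈ M.facesOf T, M.hF F * ipV (M.mF F) (f F) (f F) ≤ 3 * C ^ 2 * R ^ 2 * M.hT T ^ 3 := by
    intro f R hR hf
    have : ∀ F ∈ M.facesOf T, M.hF F * ipV (M.mF F) (f F) (f F)
        ≤ M.hT T * (3 * C * R * R * M.hT T ^ 2) := fun F hF =>
      mul_le_mul (hF_le_hT hF) ((le_abs_self _).trans (hM.abs_ipV_face_le hF hR hR (hf F hF)
        (hf F hF))) (ipV_self_nonneg _) hT.le
    refine (Finset.sum_le_sum this).trans ?_
    rw [Finset.sum_const, nsmul_eq_mul]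
    refine (mul_le_mul_of_nonneg_right (hM.card_faces T) (by positivity)).trans_eq ?_
    ring
  have h2 := hface (fun F => M.diffRF ζ T F) ((3 * C ^ 2 * Q + 12 * C ^ 2) * δ) (by positivity)
    fun F hF => ((hM.fieldBound_face_projOn hF
      ((RolyF_le _ _).trans (VPF_mono (by omega) _)) (by positivity) hpot).sub
        (h.fieldBound_compRF hM hδ hF)).mono (le_of_eq (by ring))
  have h3 := hface (fun F => M.diffRFperp ζ T F) (3 * C ^ 2 * Q * δ) (by positivity)
    fun F hF => by
      rw [diffRFperp, h.compRFperp_eq, sub_zero]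
      exact (hM.fieldBound_face_projOn hF ((perpIn_le _ _ _).trans (VPF_mono (by omega) _))
        (by positivity) hpot).mono (le_of_eq (by ring))
  have h4 : ∑ E ∈ M.elemEdges T, M.hE E ^ 2 * ipS (M.mE E) (M.diffE ζ T E) (M.diffE ζ T E)
      ≤ C * (3 * Q + 1) ^ 2 * δ ^ 2 * M.hT T ^ 3 := by
    have : ∀ E ∈ M.elemEdges T, M.hE E ^ 2 * ipS (M.mE E) (M.diffE ζ T E) (M.diffE ζ T E)
        ≤ M.hT T ^ 2 * ((3 * Q + 1) * δ * ((3 * Q + 1) * δ) * M.hT T) := by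
      intro E hE
      have hb : ∀ y ∈ M.hull T, |evalAt y (M.diffE ζ T E)| ≤ (3 * Q + 1) * δ := by
        intro y hy
        have ht : ‖M.tangent E‖ = 1 := by
          have := inner_tangent E
          rw [real_inner_self_eq_norm_sq] at this
          nlinarith [norm_nonneg (M.tangent E)]
        rw [diffE, evalAt_sub, evalAt_dotProduct, h.compE_eq, evalAt_C, sub_neg_eq_add]
        refine (abs_add_le _ _).trans ?_
        have hs : |∑ i, evalAt y (M.pot ζ T i) * evalAt y (cst (M.tangent E) i)| ≤ 3 * (Q * δ) := by
          refine (Finset.abs_sum_le_sum_abs _ _).trans ((Finset.sum_le_sum (g := fun _ => Q * δ)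
            fun i _ => ?_).trans_eq (by simp))
          rw [abs_mul, cst, evalAt_C]
          exact mul_le_of_le_one_right (by positivity) (abs_apply_le_one ht i) |>.trans'
            (mul_le_mul_of_nonneg_right (hpot y hy i) (abs_nonneg _))
        have := hδ.edgeAvg_le E hE
        linarith
      refine mul_le_mul ?_ ((le_abs_self _).trans (MeshBound.abs_ipS_edge_le hE (by positivity)
        (by positivity) hb hb)) (ipS_self_nonneg _) (by positivity)
      rw [hE_eq_len]
      exact pow_le_pow_left₀ (len_pos E).le (len_le_hT hE) 2
    refine (Finset.sum_le_sum this).trans ?_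
    rw [Finset.sum_const, nsmul_eq_mul]
    refine (mul_le_mul_of_nonneg_right (hM.card_edges T) (by positivity)).trans_eq ?_
    ring
  rw [stab]
  refine (add_le_add h1 (add_le_add (add_le_add h2 h3) h4)).trans_eq ?_
  ring


/-! ### Global estimates -/

theorem tnormDivT_sq (w : M.Xdiv k) (T : Fin M.nT) : M.tnormDivT w T ^ 2
    = ipV (M.mT T) ((w.1 T).1 + (w.1 T).2) ((w.1 T).1 + (w.1 T).2)
      + ∑ F ∈ M.facesOf T, M.hF F * ipS (M.mF F) (w.2 F) (w.2 F) := by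
  simp only [tnormDivT, normV_sq, normS_sq]
  exact Real.sq_sqrt (add_nonneg (ipV_self_nonneg _)
    (Finset.sum_nonneg fun F _ => mul_nonneg (hF_nonneg F) (ipS_self_nonneg _)))

/-- The square of the right-hand side of the Poincaré inequality, restricted to an element. -/
noncomputable def localData (υ : M.Xcurl k) (T : Fin M.nT) : ℝ :=
  M.hT T ^ 2 * M.tnormDivT (M.discCurl υ) T ^ 2
    + ∑ E ∈ M.elemEdges T, M.hE E ^ 2 * M.len E * M.edgeAvg υ E ^ 2

theorem edge_term_nonneg (υ : M.Xcurl k) (E : Fin M.nE) :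
    0 ≤ M.hE E ^ 2 * M.len E * M.edgeAvg υ E ^ 2 :=
  mul_nonneg (mul_nonneg (sq_nonneg _) (len_pos E).le) (sq_nonneg _)

theorem localData_nonneg (υ : M.Xcurl k) (T : Fin M.nT) : 0 ≤ localData υ T :=
  add_nonneg (by positivity) (Finset.sum_nonneg fun E _ => edge_term_nonneg υ E)

/-- In `localData`, curls in `L²(T)` carry `h_T²`, so their sup norms have the scale of `δ / h_T`,
and edge averages that of `δ`. The factor `C ^ 3` comes from `h_T³ ≤ (C |E|)³` in the edge terms;
the curls need at most `C ^ 2`. -/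
theorem MeshBound.isLocalBound {C : ℝ} (hM : MeshBound M k C) (υ : M.Xcurl k) (T : Fin M.nT)
    {δ : ℝ} (hδ : 0 ≤ δ) (hδ' : δ ^ 2 * M.hT T ^ 3 = C ^ 3 * localData υ T) :
    IsLocalBound υ T δ := by
  have hT := hM.hT_pos T
  have hC := hM.pos
  have hC1 := hM.one_le
  set H := M.hT T with hH
  have hL := localData_nonneg υ T
  have hsum : 0 ≤ ∑ E ∈ M.elemEdges T, M.hE E ^ 2 * M.len E * M.edgeAvg υ E ^ 2 :=
    Finset.sum_nonneg fun E _ => edge_term_nonneg υ E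
  have hdiv : H ^ 2 * M.tnormDivT (M.discCurl υ) T ^ 2 ≤ localData υ T :=
    le_add_of_nonneg_right hsum
  rw [tnormDivT_sq] at hdiv
  have hfaces : 0 ≤ ∑ F ∈ M.facesOf T, M.hF F * ipS (M.mF F) ((M.discCurl υ).2 F)
      ((M.discCurl υ).2 F) :=
    Finset.sum_nonneg fun F _ => mul_nonneg (hF_nonneg F) (ipS_self_nonneg _)
  have habs : ∀ a : ℝ, H ^ 5 * a ^ 2 ≤ C ^ 2 * localData υ T → |a| ≤ δ / H := by
    intro a ha
    refine abs_le_of_sq_le_sq ?_ (by positivity)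
    have h1 : C ^ 2 * localData υ T ≤ C ^ 3 * localData υ T :=
      mul_le_mul_of_nonneg_right (pow_le_pow_right₀ hC1 (by norm_num)) hL
    have h2 : H ^ 5 * a ^ 2 ≤ H ^ 5 * (δ / H) ^ 2 := by
      refine (ha.trans h1).trans_eq ?_
      rw [← hδ']
      field_simp
    exact le_of_mul_le_mul_left h2 (by positivity)
  refine ⟨hδ, fun F hF y hy => habs _ ?_, fun E hE => ?_, ?_⟩
  · obtain ⟨E, hE⟩ := exists_mem_edgesOf F
    have h1 := hM.sup_face T F hF _ (PF_mono (by omega) _ (M.faceCurl υ F).2) y hy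
    -- The diameter of a face dominates the length of one of its edges, hence is comparable with
    -- `h_T`.
    have h2 : H ≤ C * M.hF F := (hM.le_len T E (edgesOf_subset_elemEdges hF hE)).trans
      (mul_le_mul_of_nonneg_left (len_le_hF hE) hC.le)
    have h3 : M.hF F * ipS (M.mF F) (M.faceCurl υ F) (M.faceCurl υ F) ≤
        ∑ F ∈ M.facesOf T, M.hF F * ipS (M.mF F) ((M.discCurl υ).2 F) ((M.discCurl υ).2 F) :=
      Finset.single_le_sum (f := fun F => M.hF F * ipS (M.mF F) ((M.discCurl υ).2 F)
        ((M.discCurl υ).2 F)) (fun F _ => mul_nonneg (hF_nonneg F) (ipS_self_nonneg _)) hF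
    have h4 : H ^ 2 * (M.hF F * ipS (M.mF F) (M.faceCurl υ F) (M.faceCurl υ F)) ≤ localData υ T :=
      (mul_le_mul_of_nonneg_left (h3.trans (le_add_of_nonneg_left (ipV_self_nonneg _)))
        (by positivity)).trans hdiv
    have h5 : 0 ≤ ipS (M.mF F) (M.faceCurl υ F) (M.faceCurl υ F) := ipS_self_nonneg _
    calc H ^ 5 * evalAt y (M.faceCurl υ F) ^ 2
        = H ^ 3 * (H ^ 2 * evalAt y (M.faceCurl υ F) ^ 2) := by ring
      _ ≤ H ^ 3 * (C * ipS (M.mF F) (M.faceCurl υ F) (M.faceCurl υ F)) :=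
        mul_le_mul_of_nonneg_left h1 (by positivity)
      _ = H * (H ^ 2 * C * ipS (M.mF F) (M.faceCurl υ F) (M.faceCurl υ F)) := by ring
      _ ≤ C * M.hF F * (H ^ 2 * C * ipS (M.mF F) (M.faceCurl υ F) (M.faceCurl υ F)) :=
        mul_le_mul_of_nonneg_right h2 (by positivity)
      _ = C ^ 2 * (H ^ 2 * (M.hF F * ipS (M.mF F) (M.faceCurl υ F) (M.faceCurl υ F))) := by ring
      _ ≤ _ := mul_le_mul_of_nonneg_left h4 (by positivity)
  · refine abs_le_of_sq_le_sq ?_ hδ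
    have h1 : M.hE E ^ 2 * M.len E * M.edgeAvg υ E ^ 2 ≤ localData υ T :=
      (Finset.single_le_sum (f := fun E => M.hE E ^ 2 * M.len E * M.edgeAvg υ E ^ 2)
        (fun E _ => edge_term_nonneg υ E) hE).trans (le_add_of_nonneg_left (by positivity))
    rw [hE_eq_len] at h1
    have h2 : H ^ 3 ≤ (C * M.len E) ^ 3 := pow_le_pow_left₀ hT.le (hM.le_len T E hE) 3
    have h3 : H ^ 3 * M.edgeAvg υ E ^ 2 ≤ H ^ 3 * δ ^ 2 := by
      calc _ ≤ (C * M.len E) ^ 3 * M.edgeAvg υ E ^ 2 :=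
            mul_le_mul_of_nonneg_right h2 (sq_nonneg _)
        _ = C ^ 3 * (M.len E ^ 2 * M.len E * M.edgeAvg υ E ^ 2) := by ring
        _ ≤ C ^ 3 * localData υ T := mul_le_mul_of_nonneg_left h1 (by positivity)
        _ = _ := by rw [← hδ']; ring
    exact le_of_mul_le_mul_left h3 (by positivity)
  · have hG : Goly ((k : ℤ) - 1) ≤ VP k := (Goly_le _).trans (VP_mono (by omega))
    have hP : M.GolyPerp k T ≤ VP k := perpIn_le _ _ _
    have := finite_of_le hP
    set g := projOn (M.mT T) (Goly ((k : ℤ) - 1)) (M.elemCurl υ T)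
    set p := projOn (M.mT T) (M.GolyPerp k T) (M.elemCurl υ T)
    refine ⟨(g : VPoly3) + p, fun y hy i => habs _ ?_, fun w hw => ?_⟩
    · have hu : (g : VPoly3) + p ∈ VP ((k : ℤ) + 1) :=
        VP_mono (by omega) (Submodule.add_mem _ (hG g.2) (hP p.2))
      have h1 := (hM.sup_elem T _ (mem_VP.1 hu i) y hy).1
      have h2 : H ^ 2 * ipV (M.mT T) ((g : VPoly3) + p) ((g : VPoly3) + p) ≤ localData υ T :=
        (mul_le_mul_of_nonneg_left (le_add_of_nonneg_right hfaces) (by positivity)).trans hdiv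
      have h3 := ipS_apply_le_ipV (M.integrable_mT T) ((g : VPoly3) + p) i
      calc H ^ 5 * evalAt y (((g : VPoly3) + p) i) ^ 2
          = H ^ 2 * (H ^ 3 * evalAt y (((g : VPoly3) + p) i) ^ 2) := by ring
        _ ≤ H ^ 2 * (C * ipV (M.mT T) ((g : VPoly3) + p) ((g : VPoly3) + p)) :=
          mul_le_mul_of_nonneg_left (h1.trans (mul_le_mul_of_nonneg_left h3 hC.le)) (by positivity)
        _ = C * (H ^ 2 * ipV (M.mT T) ((g : VPoly3) + p) ((g : VPoly3) + p)) := by ring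
        _ ≤ C * localData υ T := mul_le_mul_of_nonneg_left h2 hC.le
        _ ≤ C ^ 2 * localData υ T := mul_le_mul_of_nonneg_right (by nlinarith) hL
    -- `u` is the sum of the two projections kept by the discrete curl; the first, in `G^{k-1} ⊆
    -- G^k`, is invisible to `w`.
    · have h1 : ipV (M.mT T) g w = 0 := by
        rw [ipV_comm]
        obtain ⟨q, hq, hqg⟩ := g.2
        exact hw.2 _ ⟨q, P_mono (by omega) hq, hqg⟩
      rw [ipV_add_left (M.integrable_mT T), h1, zero_add,
        projOn_spec (M.integrable_mT T) (fun w hw h0 => hM.definite_elem T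
          (VP_mono (by omega) (hP hw)) h0) _ w hw]

/-- Each edge belongs to at most `C` elements, and `a² + C b² ≤ C (a + b)²` as `C ≥ 1`. -/
theorem MeshBound.sum_localData_le {C : ℝ} (hM : MeshBound M k C) (υ : M.Xcurl k) :
    ∑ T, localData υ T ≤ C * (√(∑ T, M.hT T ^ 2 * M.tnormDivT (M.discCurl υ) T ^ 2)
      + M.avgNorm υ) ^ 2 := by
  have hC := hM.pos
  have hC1 := hM.one_le
  have ha : 0 ≤ ∑ T, M.hT T ^ 2 * M.tnormDivT (M.discCurl υ) T ^ 2 :=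
    Finset.sum_nonneg fun T _ => by positivity
  have hb : 0 ≤ ∑ E, M.hE E ^ 2 * M.len E * M.edgeAvg υ E ^ 2 :=
    Finset.sum_nonneg fun E _ => edge_term_nonneg υ E
  have h1 := Real.sq_sqrt ha
  have h2 := Real.sq_sqrt hb
  have h3 : ∑ T, ∑ E ∈ M.elemEdges T, M.hE E ^ 2 * M.len E * M.edgeAvg υ E ^ 2
      ≤ C * ∑ E, M.hE E ^ 2 * M.len E * M.edgeAvg υ E ^ 2 := by
    rw [Finset.sum_comm' (t' := Finset.univ)
      (s' := fun E => Finset.univ.filter fun T => E ∈ M.elemEdges T) (by simp), Finset.mul_sum]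
    refine Finset.sum_le_sum fun E _ => ?_
    rw [Finset.sum_const, nsmul_eq_mul]
    exact mul_le_mul_of_nonneg_right (hM.card_elems E _ (by simp)) (edge_term_nonneg υ E)
  simp only [localData]
  rw [Finset.sum_add_distrib, avgNorm]
  set a := √(∑ T, M.hT T ^ 2 * M.tnormDivT (M.discCurl υ) T ^ 2)
  set b := √(∑ E, M.hE E ^ 2 * M.len E * M.edgeAvg υ E ^ 2)
  rw [← h2] at h3
  rw [← h1]
  have ha0 : 0 ≤ a := Real.sqrt_nonneg _
  have hb0 : 0 ≤ b := Real.sqrt_nonneg _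
  have h4 : 0 ≤ C * (a * b) := by positivity
  nlinarith [sq_nonneg a]

theorem exists_normCurl_le (Ω : Set E3) (k : ℕ) {ρ : ℝ} (hρ : 0 < ρ) {μhi : ℝ} (hμ : 0 < μhi) :
    ∃ C : ℝ, 0 < C ∧ ∀ M : PolyMesh Ω, M.IsRegular ρ → ∀ μ : Fin M.nT → ℝ,
      (∀ T, 0 ≤ μ T ∧ μ T ≤ μhi) → ∀ υ : M.Xcurl k, ∃ ζ : M.Xcurl k, M.discCurl (υ + ζ) = 0 ∧
        M.normCurl μ ζ ≤
          C * (√(∑ T, M.hT T ^ 2 * M.tnormDivT (M.discCurl υ) T ^ 2) + M.avgNorm υ) := by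
  obtain ⟨C, hCM⟩ := exists_meshBound (Ω := Ω) k hρ
  -- The bound `1 ≤ C` is available only once a regular mesh is given, while the final constant
  -- precedes the mesh.
  have hC : 0 < max C 1 := zero_lt_one.trans_le (le_max_right _ _)
  obtain ⟨K, hK, H⟩ := exists_local_bound (Ω := Ω) k hC
  -- Three powers come from the choice of `δ` and one from the overlap of elements around edges.
  refine ⟨√(μhi * K * max C 1 ^ 4), by positivity, fun M hR μ hμT υ => ?_⟩
  have hM : MeshBound M k (max C 1) := by
    have := hCM M hR
    rwa [max_eq_left this.one_le]
  obtain ⟨ζ, hζ⟩ := hM.exists_correction υ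
  refine ⟨ζ, hζ.discCurl_add_eq_zero hM, ?_⟩
  have hlocal : ∀ T, μ T * ipV (M.mT T) (M.pot ζ T) (M.pot ζ T) + μ T * M.stab ζ ζ T
      ≤ μhi * K * max C 1 ^ 3 * localData υ T := by
    intro T
    have hT := hM.hT_pos T
    have hL := localData_nonneg υ T
    set δ := √(max C 1 ^ 3 * localData υ T / M.hT T ^ 3) with hδ
    have hδ2 : δ ^ 2 * M.hT T ^ 3 = max C 1 ^ 3 * localData υ T := by
      rw [hδ, Real.sq_sqrt (by positivity), div_mul_cancel₀ _ (by positivity)]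
    have h1 := H M hM υ ζ hζ T δ (hM.isLocalBound υ T (Real.sqrt_nonneg _) hδ2)
    rw [hδ2] at h1
    rw [← mul_add]
    calc _ ≤ μ T * (K * (max C 1 ^ 3 * localData υ T)) :=
          mul_le_mul_of_nonneg_left h1 (hμT T).1
      _ ≤ μhi * (K * (max C 1 ^ 3 * localData υ T)) :=
          mul_le_mul_of_nonneg_right (hμT T).2 (by positivity)
      _ = _ := by ring
  set R := √(∑ T, M.hT T ^ 2 * M.tnormDivT (M.discCurl υ) T ^ 2) + M.avgNorm υ with hRdef
  have hR0 : 0 ≤ R := add_nonneg (Real.sqrt_nonneg _) (Real.sqrt_nonneg _)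
  rw [← Real.sqrt_sq hR0, ← Real.sqrt_mul (by positivity), normCurl]
  refine Real.sqrt_le_sqrt ?_
  rw [prodCurl]
  refine (Finset.sum_le_sum fun T _ => hlocal T).trans ?_
  rw [← Finset.mul_sum]
  refine (mul_le_mul_of_nonneg_left (hM.sum_localData_le υ) (by positivity)).trans_eq ?_
  ring

theorem sqrt_sum_le (υ : M.Xcurl k) {h : ℝ} (hh : 0 ≤ h) (hle : ∀ T, M.hT T ≤ h) :
    √(∑ T, M.hT T ^ 2 * M.tnormDivT (M.discCurl υ) T ^ 2) ≤ h * M.tnormDiv (M.discCurl υ) := by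
  rw [tnormDiv, ← Real.sqrt_sq hh, ← Real.sqrt_mul (by positivity), Finset.mul_sum]
  refine Real.sqrt_le_sqrt (Finset.sum_le_sum fun T _ => ?_)
  exact mul_le_mul_of_nonneg_right (pow_le_pow_left₀ Metric.diam_nonneg (hle T) 2) (sq_nonneg _)

theorem hT_le_diam (hΩ : Bornology.IsBounded Ω) (T : Fin M.nT) : M.hT T ≤ Metric.diam Ω :=
  Metric.diam_mono (M.elem_subset T) hΩ

end PolyMesh

theorem IsPolyhedralDomain.isBounded {Ω : Set E3} (h : IsPolyhedralDomain Ω) :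
    Bornology.IsBounded Ω := by
  obtain ⟨m, s, -, hs⟩ := h.simplices
  refine Bornology.IsBounded.subset ?_ subset_closure
  rw [hs]
  exact Bornology.isBounded_iUnion.2 fun i => isBounded_convexHull.2 (finite_range _).isBounded

/-- An element orthogonal to `υ + ζ` is not longer than `ζ`. -/
theorem sqrt_apply_self_le_of_orthogonal {E : Type*} [AddCommGroup E] [Module ℝ E]
    {B : LinearMap.BilinForm ℝ E} (hs : ∀ v w, B v w = B w v) (hp : ∀ v, v ≠ 0 → 0 < B v v)
    {υ ζ : E} (h : B υ (υ + ζ) = 0) : √(B υ υ) ≤ √(B ζ ζ) := by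
  have hnn : ∀ v, 0 ≤ B v v := fun v => by
    by_cases hv : v = 0
    · simp [hv]
    · exact (hp v hv).le
  have h1 := abs_apply_le_sqrt B hs hnn υ ζ
  rw [map_add] at h
  have h2 : B υ υ ≤ √(B υ υ) * √(B ζ ζ) := by
    have := neg_le_abs (B υ ζ)
    linarith
  rcases (Real.sqrt_nonneg (B υ υ)).eq_or_lt with h0 | h0
  · rw [← h0]; exact Real.sqrt_nonneg _
  · refine le_of_mul_le_mul_left ?_ h0
    rwa [Real.mul_self_sqrt (hnn υ)]

end DDR

theorem mainTheorem7 (Ω : Set DDR.E3) (hΩ : DDR.IsPolyhedralDomain Ω) (k : ℕ)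
    (ρ : ℝ) (hρ : 0 < ρ) (hρ' : ρ < 1) (μlo μhi : ℝ) (hlo : 0 < μlo) (hhi : μlo ≤ μhi) :
    (∃ C : ℝ, 0 < C ∧ ∀ M : DDR.PolyMesh Ω, M.IsRegular ρ →
      ∀ μ : Fin M.nT → ℝ, (∀ T, μlo ≤ μ T ∧ μ T ≤ μhi) →
      ∀ υ : M.Xcurl k, ∃ ζ : M.Xcurl k, M.discCurl (υ + ζ) = 0 ∧
        M.normCurl μ ζ ≤
          C * (√(∑ T, M.hT T ^ 2 * M.tnormDivT (M.discCurl υ) T ^ 2) + M.avgNorm υ)) ∧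
    (∀ c₁ c₂ : ℝ, 0 < c₁ → 0 < c₂ →
      ∃ C : ℝ, 0 < C ∧ ∀ M : DDR.PolyMesh Ω, M.IsRegular ρ →
      ∀ μ : Fin M.nT → ℝ, (∀ T, μlo ≤ μ T ∧ μ T ≤ μhi) →
      ∀ B : LinearMap.BilinForm ℝ (M.Xcurl k),
        (∀ υ ζ, B υ ζ = B ζ υ) → (∀ υ, υ ≠ 0 → 0 < B υ υ) →
        (∀ υ, c₁ * M.normCurl μ υ ≤ √(B υ υ) ∧ √(B υ υ) ≤ c₂ * M.normCurl μ υ) →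
      ∀ υ : M.Xcurl k, (∀ w : M.Xcurl k, M.discCurl w = 0 → B υ w = 0) →
        M.normCurl μ υ ≤ C * (M.tnormDiv (M.discCurl υ) + M.avgNorm υ)) := by
  obtain ⟨C, hC, H⟩ := DDR.PolyMesh.exists_normCurl_le Ω k hρ (hlo.trans_le hhi)
  have H' : ∀ M : DDR.PolyMesh Ω, M.IsRegular ρ → ∀ μ : Fin M.nT → ℝ,
      (∀ T, μlo ≤ μ T ∧ μ T ≤ μhi) → ∀ υ : M.Xcurl k, ∃ ζ : M.Xcurl k, M.discCurl (υ + ζ) = 0 ∧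
        M.normCurl μ ζ ≤
          C * (√(∑ T, M.hT T ^ 2 * M.tnormDivT (M.discCurl υ) T ^ 2) + M.avgNorm υ) :=
    fun M hM μ hμ => H M hM μ fun T => ⟨hlo.le.trans (hμ T).1, (hμ T).2⟩
  refine ⟨⟨C, hC, H'⟩, fun c₁ c₂ hc₁ hc₂ => ?_⟩
  -- At least the diameter, to absorb the weights `h_T`, and at least 1, to be common to the edge
  -- term.
  set d := max (Metric.diam Ω) 1
  have hd : 1 ≤ d := le_max_right _ _
  refine ⟨c₁⁻¹ * c₂ * C * d, by positivity, fun M hM μ hμ B hs hp hB υ hυ => ?_⟩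
  obtain ⟨ζ, hζ, hle⟩ := H' M hM μ hμ υ
  -- `υ + ζ` is in the kernel, hence orthogonal to `υ`.
  have h1 := DDR.sqrt_apply_self_le_of_orthogonal hs hp (hυ _ hζ)
  have h2 := DDR.PolyMesh.sqrt_sum_le υ (zero_le_one.trans hd) fun T =>
    (DDR.PolyMesh.hT_le_diam hΩ.isBounded T).trans (le_max_left _ 1)
  have h3 : M.avgNorm υ ≤ d * M.avgNorm υ := le_mul_of_one_le_left (Real.sqrt_nonneg _) hd
  have h4 : c₁ * M.normCurl μ υ
      ≤ c₂ * (C * (d * M.tnormDiv (M.discCurl υ) + d * M.avgNorm υ)) :=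
    ((hB υ).1.trans (h1.trans (hB ζ).2)).trans (mul_le_mul_of_nonneg_left (hle.trans
      (mul_le_mul_of_nonneg_left (add_le_add h2 h3) hC.le)) hc₂.le)
  rw [← le_inv_mul_iff₀ hc₁] at h4
  exact h4.trans_eq (by ring)
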